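/- Let $\mathbb R^3_1$ be $\mathbb R^3$ with $\langle a,b\rangle=a_0b_0+a_1b_1-a_2b_2$ and the Lorentzian vector product, $\langle a\times b,c\rangle=\det(a,b,c)$. For a local parametrization $x(u,v)$ of a smooth surface $M$ put $E=\langle x_u,x_u\rangle$, $F=\langle x_u,x_v\rangle$, $G=\langle x_v,x_v\rangle$, $\bar l=\langle x_u\times x_v,x_{uu}\rangle$, $\bar m=\langle x_u\times x_v,x_{uv}\rangle$, $\bar n=\langle x_u\times x_v,x_{vv}\rangle$, and $\delta=F^2-EG$, $\tilde\delta=(E\bar n-G\bar l)^2-4(F\bar n-G\bar m)(E\bar m-F\bar l)$, $\bar K=\bar l\bar n-\bar m^2$, $\bar H=\bar lG-2\bar mF+\bar nE$. The Lorentzian region is $\delta>0$; the LPL, the PC and the MCNC are the zero sets of $\tilde\delta$, $\bar K$ and $\bar H$. A point of the LPL is regular if $\tilde\delta=0$ and $d\tilde\delta\ne0$ there. If $\gamma$ is a regular parametrization of the LPL at such a point $p$, then $m(LPL,PC:p)$ and $m(LPL,MCNC:p)$ are the orders of vanishing of $\bar K\circ\gamma$ and $\bar H\circ\gamma$ at $p$.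 The germs of local parametrizations $(\mathbb R^2,0)\to(\mathbb R^3_1,p)$ carry the Whitney topology (the coarsest for which all jets at $0$ are continuous), and the set $\mathcal G$ of germs $(M,p)$ of smooth surfaces carries the quotient topology with respect to changes of parameters. A property is generic in a subset of $\mathcal G$ if it holds exactly on a subset that is open and dense in the induced topology. Let $\mathcal G_1\subset\mathcal G$ be the set of $(M,p)$ such that $p$ is in the Lorentzian region, is a regular point of the LPL, and $m(LPL,PC:p)>2$. A deformation of a parametrization $x$ of $(M,p)$ is a family $x_t=x+h(t,\cdot)$ with $h$ smooth near $0$ and $h(0,\cdot)=0$. Its displacements lie in a linear subspace $V$ of $\mathbb R^3$ if $h$ takes values in $V$; for $V$ a line transverse to $T_pM$ these are deformations of Monge form, for $V=\mathbb R^3$ all deformations. Deformations are given the topology of jets of $h$ at $0$. **Theorem.** The following property of $(M,p)$ is generic in $\mathcal G_1$. (1) $m(LPL,PC:p)=4$ and $m(LPL,MCNC:p)=2$; near $p$ the PC and the MCNC are regular curves through $p$ that do not meet the LPL outside $p$; the PC lies on the side $\tilde\delta>0$ of the LPL, and the three curves are in one of two configurations: outside $p$, the MCNC lies on the same side of the LPL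 as the PC, or it lies on the opposite side. (2) For every local parametrization $x$ of $(M,p)$ and every subspace $V\subset\mathbb R^3$ with $V+T_pM=\mathbb R^3$, there is an open and dense set of deformations of $x$ with displacements in $V$ for which the following holds with some sign $\sigma\in\{1,-1\}$. In arbitrarily small neighbourhoods of $p$ and for all sufficiently small $t$ (depending on the neighbourhood), the sets $LPL_t\cap MCNC_t$, $LPL_t\cap PC_t$ and $MCNC_t\cap PC_t$ coincide; they consist of 2 points if $\sigma t>0$ and are empty if $\sigma t<0$. Moreover, in suitable local coordinates $(s,w)$ depending smoothly on $t$, the curves $LPL_t$, $PC_t$, $MCNC_t$ are the graphs $w=0$, $w=P(t,s)$, $w=Q(t,s)$ with $P,Q$ smooth, $P(0,0)=Q(0,0)=0$, $P\ge0$, $P=0$ exactly where $Q=0$, and $P<Q$ where $Q>0$. If $\sigma t<0$, then $MCNC_t$ lies entirely on the side of $LPL_t$ given by the configuration in (1). If $\sigma t>0$, then $MCNC_t$ crosses $LPL_t$ transversally at two points, the arc between them lies on the other side, and the two outer arcs lie on the side given by the configuration in (1). Both configurations are realized by some $(M,p)\in\mathcal G_1$ with properties (1) and (2). -/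

import Mathlib

open Filter Topology
open scoped ContDiff

noncomputable section

namespace MinkowskiSurface

/-- Parameter plane, with coordinates `(u, v)`. -/
abbrev Plane := ℝ × ℝ

/-- The vector space underlying Minkowski 3-space. -/
abbrev Space := Fin 3 → ℝ

/-- The Lorentzian scalar product `u₀v₀ + u₁v₁ - u₂v₂`. -/
def mink (u v : Space) : ℝ := u 0 * v 0 + u 1 * v 1 - u 2 * v 2

/-- The Lorentzian vector product: `mink (cross u v) w = det (u, v, w)`. -/
def cross (u v : Space) : Space :=
  ![u 1 * v 2 - u 2 * v 1, u 2 * v 0 - u 0 * v 2, -(u 0 * v 1 - u 1 * v 0)]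

/-- `f_u`. -/
def pu (f : Plane → Space) (q : Plane) : Space := fderiv ℝ f q (1, 0)

/-- `f_v`. -/
def pv (f : Plane → Space) (q : Plane) : Space := fderiv ℝ f q (0, 1)

/-! Coefficients of the first fundamental form. -/

def coefE (f : Plane → Space) (q : Plane) : ℝ := mink (pu f q) (pu f q)

def coefF (f : Plane → Space) (q : Plane) : ℝ := mink (pu f q) (pv f q)

def coefG (f : Plane → Space) (q : Plane) : ℝ := mink (pv f q) (pv f q)

/-! Coefficients of the second fundamental form, multiplied by `‖f_u × f_v‖`. -/

def lbar (f : Plane → Space) (q : Plane) : ℝ := mink (cross (pu f q) (pv f q)) (pu (pu f) q)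

def mbar (f : Plane → Space) (q : Plane) : ℝ := mink (cross (pu f q) (pv f q)) (pv (pu f) q)

def nbar (f : Plane → Space) (q : Plane) : ℝ := mink (cross (pu f q) (pv f q)) (pv (pv f) q)

/-- `δ = F² - EG`; the induced metric is Lorentzian where `δ > 0`. -/
def metricDisc (f : Plane → Space) (q : Plane) : ℝ := coefF f q ^ 2 - coefE f q * coefG f q

/-- Discriminant of the equation of the lines of principal curvature. -/
def lplDisc (f : Plane → Space) (q : Plane) : ℝ :=
  (coefE f q * nbar f q - coefG f q * lbar f q) ^ 2 -
    4 * (coefF f q * nbar f q - coefG f q * mbar f q) *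
      (coefE f q * mbar f q - coefF f q * lbar f q)

/-- Its zero set is the zero set of the Gaussian curvature, away from the degenerate locus. -/
def Kbar (f : Plane → Space) (q : Plane) : ℝ := lbar f q * nbar f q - mbar f q ^ 2

/-- Its zero set is the zero set of the mean curvature, away from the degenerate locus. -/
def Hbar (f : Plane → Space) (q : Plane) : ℝ :=
  lbar f q * coefG f q - 2 * mbar f q * coefF f q + nbar f q * coefE f q

/-! The three curves, as subsets of the parameter plane. -/

def LPL (f : Plane → Space) : Set Plane := {q | lplDisc f q = 0}

def PC (f : Plane → Space) : Set Plane := {q | Kbar f q = 0}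

def MCNC (f : Plane → Space) : Set Plane := {q | Hbar f q = 0}

/-- `f` is smooth on a neighbourhood of `a`. -/
def SmoothNear {V W : Type*} [NormedAddCommGroup V] [NormedSpace ℝ V]
    [NormedAddCommGroup W] [NormedSpace ℝ W] (f : V → W) (a : V) : Prop :=
  ∀ᶠ y in 𝓝 a, ContDiffAt ℝ ∞ f y

theorem SmoothNear.comp {V W Z : Type*} [NormedAddCommGroup V] [NormedSpace ℝ V]
    [NormedAddCommGroup W] [NormedSpace ℝ W] [NormedAddCommGroup Z] [NormedSpace ℝ Z]
    {g : W → Z} {f : V → W} {a : V} (hg : SmoothNear g (f a)) (hf : SmoothNear f a) :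
    SmoothNear (g ∘ f) a := by
  have hc : ContinuousAt f a := (hf.self_of_nhds).continuousAt
  have hg' : ∀ᶠ y in 𝓝 a, ContDiffAt ℝ ∞ g (f y) := hc.eventually hg
  unfold SmoothNear
  filter_upwards [hg', hf] with y h1 h2
  exact h1.comp y h2

theorem smoothNear_id {V : Type*} [NormedAddCommGroup V] [NormedSpace ℝ V] (a : V) :
    SmoothNear (id : V → V) a :=
  Eventually.of_forall fun _ => contDiffAt_id

/-- `h` represents a germ of a diffeomorphism of the plane at the origin. -/
def IsDiffeoGerm (h : Plane → Plane) : Prop :=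
  SmoothNear h 0 ∧ h 0 = 0 ∧ ∃ k : Plane → Plane, SmoothNear k 0 ∧ k 0 = 0 ∧
    (∀ᶠ q in 𝓝 (0 : Plane), k (h q) = q) ∧ ∀ᶠ q in 𝓝 (0 : Plane), h (k q) = q

/-- A representative of a germ of a local parametrization `(ℝ², 0) → (ℝ³₁, p)`, `p = x(0)`.
An immersion has a continuous inverse on a small neighbourhood of the origin, so this need not
be required separately. -/
structure LocalParam where
  toFun : Plane → Space
  smooth : SmoothNear toFun 0
  immersion : Function.Injective (fderiv ℝ toFun 0)

instance : CoeFun LocalParam (fun _ => Plane → Space) := ⟨LocalParam.toFun⟩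

/-- The Whitney topology on germs: the coarsest one for which all jets at the origin are
continuous. -/
instance : TopologicalSpace LocalParam :=
  ⨅ k : ℕ, TopologicalSpace.induced (fun x : LocalParam => iteratedFDeriv ℝ k x.toFun 0)
    inferInstance

/-- Equality of germs up to a germ of a diffeomorphism of the source. -/
instance paramSetoid : Setoid LocalParam where
  r x y := ∃ h : Plane → Plane, IsDiffeoGerm h ∧ y.toFun =ᶠ[𝓝 0] x.toFun ∘ h
  iseqv := by
    refine ⟨fun x => ⟨id, ⟨smoothNear_id 0, rfl, id, smoothNear_id 0, rfl, ?_, ?_⟩, ?_⟩, ?_, ?_⟩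
    · exact Eventually.of_forall fun _ => rfl
    · exact Eventually.of_forall fun _ => rfl
    · exact Eventually.of_forall fun _ => rfl
    · rintro x y ⟨h, ⟨hs, h0, k, ks, k0, hkh, hhk⟩, e⟩
      refine ⟨k, ⟨ks, k0, h, hs, h0, hhk, hkh⟩, ?_⟩
      have hc : Tendsto k (𝓝 0) (𝓝 0) := by
        have := ks.self_of_nhds.continuousAt.tendsto
        rwa [k0] at this
      filter_upwards [hc.eventually e, hhk] with q h1 h2
      simp only [Function.comp_apply] at h1 ⊢
      rw [h1, h2]
    · rintro x y z ⟨h, ⟨hs, h0, k, ks, k0, hkh, hhk⟩, e⟩ ⟨h', ⟨hs', h0', k', ks', k0', hkh', hhk'⟩, e'⟩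
      have ch' : Tendsto h' (𝓝 0) (𝓝 0) := by
        have := hs'.self_of_nhds.continuousAt.tendsto
        rwa [h0'] at this
      have ck : Tendsto k (𝓝 0) (𝓝 0) := by
        have := ks.self_of_nhds.continuousAt.tendsto
        rwa [k0] at this
      refine ⟨h ∘ h', ⟨SmoothNear.comp (by rwa [h0']) hs', by simp [h0, h0'], k' ∘ k,
        SmoothNear.comp (by rwa [k0]) ks, by simp [k0, k0'], ?_, ?_⟩, ?_⟩
      · filter_upwards [ch'.eventually hkh, hkh'] with q h1 h2
        simp [h1, h2]
      · filter_upwards [ck.eventually hhk', hhk] with q h1 h2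
        simp [h1, h2]
      · filter_upwards [ch'.eventually e, e'] with q h1 h2
        simp only [Function.comp_apply] at h1 h2 ⊢
        rw [h2, h1]

/-- Germs `(M, p)` of smooth surfaces: local parametrizations up to a change of parameters. -/
def SurfaceGerm : Type := Quotient paramSetoid

/-- The quotient of the Whitney topology. -/
instance : TopologicalSpace SurfaceGerm :=
  inferInstanceAs (TopologicalSpace (Quotient paramSetoid))

/-- `x` is a local parametrization of the germ `g`. -/
def Parametrizes (x : LocalParam) (g : SurfaceGerm) : Prop := Quotient.mk paramSetoid x = g

/-- The property `P` is generic in `A`: within `A`, with the induced topology, it holds exactly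
on an open and dense set. -/
def IsGenericIn (A : Set SurfaceGerm) (P : SurfaceGerm → Prop) : Prop :=
  IsOpen {g : A | P g} ∧ Dense {g : A | P g}

/-- `γ` is a regular parametrization, near `0`, of an arc of the curve `φ = 0` through the
origin. -/
def IsRegularArc (φ : Plane → ℝ) (γ : ℝ → Plane) : Prop :=
  SmoothNear γ 0 ∧ γ 0 = 0 ∧ deriv γ 0 ≠ 0 ∧ ∀ᶠ s in 𝓝 (0 : ℝ), φ (γ s) = 0

/-- Order of contact at the origin of the curve `φ = 0`, regular there, with the curve `ψ = 0`:
the order of vanishing of `ψ ∘ γ`, where `γ` is a regular parametrization of `φ = 0`. -/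
def contactOrder (φ ψ : Plane → ℝ) : ℕ∞ :=
  ⨆ k ∈ {k : ℕ | ∃ γ : ℝ → Plane, IsRegularArc φ γ ∧ ∀ j < k, iteratedDeriv j (ψ ∘ γ) 0 = 0},
    (k : ℕ∞)

/-- The germs `(M, p)` such that `p` is in the Lorentzian region and is a regular point of the
LPL, at which the LPL and the PC have order of contact greater than 2. -/
def G1 : Set SurfaceGerm :=
  {g | ∃ x : LocalParam, Parametrizes x g ∧ 0 < metricDisc x 0 ∧
    lplDisc x 0 = 0 ∧ fderiv ℝ (lplDisc x) 0 ≠ 0 ∧ 2 < contactOrder (lplDisc x) (Kbar x)}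

/-- Position of the PC and of the MCNC relative to the LPL. -/
inductive Configuration
  | sameSide
  | oppositeSides

/-- Which side of the LPL the MCNC lies on, the side of the PC being counted as positive. -/
def Configuration.sign : Configuration → ℝ
  | .sameSide => 1
  | .oppositeSides => -1

/-- Near `p` the PC and the MCNC are regular curves which meet the LPL only at `p`, the PC lies on
the side `lplDisc > 0` of the LPL, and the MCNC lies on the same or on the opposite side. -/
def HasConfiguration (c : Configuration) (x : LocalParam) : Prop :=
  fderiv ℝ (Kbar x) 0 ≠ 0 ∧ fderiv ℝ (Hbar x) 0 ≠ 0 ∧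
  (0 : Plane) ∈ PC x ∧ (0 : Plane) ∈ MCNC x ∧
  ∀ᶠ q in 𝓝 (0 : Plane), q ≠ 0 →
    (q ∈ PC x → 0 < lplDisc x q) ∧ (q ∈ MCNC x → 0 < c.sign * lplDisc x q)

/-- A 1-parameter deformation `x_t(q) = x(q) + h(t, q)` of `x`, with displacements in `E`.
For `E` a line transverse to the surface these are the deformations in Monge form
(`h` being the change of the height function); for `E = ⊤` these are all the deformations. -/
structure Deformation (x : LocalParam) (E : Submodule ℝ Space) where
  h : ℝ × Plane → Space
  smooth : SmoothNear h 0
  mem : ∀ᶠ y in 𝓝 (0 : ℝ × Plane), h y ∈ E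
  at_zero : ∀ᶠ q in 𝓝 (0 : Plane), h (0, q) = 0

/-- The Whitney topology on germs of deformations. -/
instance (x : LocalParam) (E : Submodule ℝ Space) : TopologicalSpace (Deformation x E) :=
  ⨅ k : ℕ, TopologicalSpace.induced (fun D : Deformation x E => iteratedFDeriv ℝ k D.h 0)
    inferInstance

/-- The parametrization `x_t` of the surface `M_t`. -/
def Deformation.surface {x : LocalParam} {E : Submodule ℝ Space} (D : Deformation x E) (t : ℝ)
    (q : Plane) : Space := x q + D.h (t, q)

/-- In arbitrarily small neighbourhoods of `p`, for all small `t`, any two of the three curves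
meet in the same points, and these are 2 points if `σ t > 0` and no point if `σ t < 0`. -/
def IntersectionsBifurcate {x : LocalParam} {E : Submodule ℝ Space} (D : Deformation x E)
    (σ : ℝ) : Prop :=
  ∀ W ∈ 𝓝 (0 : Plane), ∃ V ∈ 𝓝 (0 : Plane), V ⊆ W ∧ ∀ᶠ t in 𝓝 (0 : ℝ),
    (0 < σ * t → (V ∩ LPL (D.surface t) ∩ MCNC (D.surface t)).ncard = 2) ∧
    (σ * t < 0 → V ∩ LPL (D.surface t) ∩ MCNC (D.surface t) = ∅) ∧
    V ∩ LPL (D.surface t) ∩ PC (D.surface t) = V ∩ LPL (D.surface t) ∩ MCNC (D.surface t) ∧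
    V ∩ MCNC (D.surface t) ∩ PC (D.surface t) = V ∩ LPL (D.surface t) ∩ MCNC (D.surface t)

/-- Relative position of the three deformed curves. In local coordinates `(s, w)` of the surfaces
that depend smoothly on `t`, the LPL, the PC and the MCNC of `M_t` are the graphs `w = 0`,
`w = P(t, s)` and `w = Q(t, s)`. The PC stays on one side of the LPL, touches it exactly where the
MCNC meets it, and is between the LPL and the MCNC where the latter is on the same side. If
`σ t < 0` the MCNC stays on the side of the LPL given by `c`; if `σ t > 0` it crosses the LPL
transversally at two points, and only the arc between these is on the other side. -/
def CurvesDeform {x : LocalParam} {E : Submodule ℝ Space} (D : Deformation x E)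
    (c : Configuration) (σ : ℝ) : Prop :=
  ∃ (Φ : ℝ × Plane → Plane) (P Q : ℝ × ℝ → ℝ),
    SmoothNear Φ 0 ∧ Φ 0 = 0 ∧ Function.Bijective (fderiv ℝ (fun y : Plane => Φ (0, y)) 0) ∧
    SmoothNear P 0 ∧ SmoothNear Q 0 ∧ P 0 = 0 ∧ Q 0 = 0 ∧
    (∀ᶠ y in 𝓝 (0 : ℝ × Plane),
      (Φ y ∈ LPL (D.surface y.1) ↔ y.2.2 = 0) ∧
      (Φ y ∈ PC (D.surface y.1) ↔ y.2.2 = P (y.1, y.2.1)) ∧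
      (Φ y ∈ MCNC (D.surface y.1) ↔ y.2.2 = Q (y.1, y.2.1))) ∧
    (∀ᶠ z in 𝓝 (0 : ℝ × ℝ), 0 ≤ P z ∧ (P z = 0 ↔ Q z = 0) ∧ (0 < Q z → P z < Q z)) ∧
    ∀ᶠ r in 𝓝[>] (0 : ℝ), ∀ᶠ t in 𝓝 (0 : ℝ),
      (σ * t < 0 → ∀ s ∈ Set.Ioo (-r) r, 0 < c.sign * Q (t, s)) ∧
      (0 < σ * t → ∃ a b : ℝ, -r < a ∧ a < b ∧ b < r ∧
        deriv (fun s => Q (t, s)) a ≠ 0 ∧ deriv (fun s => Q (t, s)) b ≠ 0 ∧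
        ∀ s ∈ Set.Ioo (-r) r, (Q (t, s) = 0 ↔ s = a ∨ s = b) ∧
          (c.sign * Q (t, s) < 0 ↔ a < s ∧ s < b))

/-- The bifurcation of the three curves in the family, starting from the configuration `c`. The
sign `σ` says for which sign of `t` there are intersections. -/
def Deformation.Bifurcates {x : LocalParam} {E : Submodule ℝ Space} (D : Deformation x E)
    (c : Configuration) : Prop :=
  ∃ σ : ℝ, (σ = 1 ∨ σ = -1) ∧ IntersectionsBifurcate D σ ∧ CurvesDeform D c σ

/-- In any local parametrization, the orders of contact are 4 and 2 and the three curves are in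
configuration `c`. -/
def StaticPart (c : Configuration) (g : SurfaceGerm) : Prop :=
  ∀ x : LocalParam, Parametrizes x g →
    contactOrder (lplDisc x) (Kbar x) = 4 ∧ contactOrder (lplDisc x) (Hbar x) = 2 ∧
    HasConfiguration c x

/-- In any local parametrization `x`, and for displacements in any space `E` that is transverse to
the surface at `p`, generic (open and dense) deformations bifurcate as described. -/
def FamilyPart (c : Configuration) (g : SurfaceGerm) : Prop :=
  ∀ x : LocalParam, Parametrizes x g → ∀ E : Submodule ℝ Space,
    E ⊔ LinearMap.range (fderiv ℝ x 0 : Plane →ₗ[ℝ] Space) = ⊤ →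
    ∃ O : Set (Deformation x E), IsOpen O ∧ Dense O ∧ ∀ D ∈ O, D.Bifurcates c

end MinkowskiSurface

end

open MinkowskiSurface

/-! Write L for the discriminant of the LPL, and H, K, δ for the other invariants. Everything rests
on the polynomial identity L = H² + 4δK (`jetL_eq`). Where δ > 0 it says that the PC is the curve L
= H². So the three curves are L = 0, H = 0 and L = H², and any two of these equations imply the
third. Along the LPL, K = -H²/(4δ), so K vanishes to twice the order of H. Hence contact greater
than 2 with the PC means H(p) = 0 and dH = lam dL at p (`TangentLPL`, `mem_G1_iff`), and K then
vanishes to order at least 4.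

For a family of surfaces with lam ≠ 0, take w = L(t, ·) as one of the coordinates (s, w). The MCNC
becomes a graph w = Q(t, s) and the PC a graph w = P(t, s) on which P = H²; this gives all the
relations between P and Q (`P_relations`). Implicit differentiation at the origin yields Q_s = 0,
lam Q_t = -(H_t - lam L_t), and lam Q_ss = -Hess(H - lam L) on a vector tangent to the LPL
(`fderiv_Q`, `fderiv_fderiv_Q`). If Q_ss and Q_t are nonzero, the zeros of Q(t, ·) undergo a fold
(`fold_bifurcation`), which is the bifurcation in (2). The sign of Q_ss is the configuration, and
the constant family gives (1).

For generic deformations, Q_t ≠ 0 amounts to H_t ≠ lam L_t, an open condition on the jet of the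
deformation. Adding t times a quadratic form along a vector of V transverse to the surface changes
H_t - lam L_t at a constant rate. This rate is nonzero for some quadratic form, since otherwise δ
would be a multiple of K, which vanishes at p (`exists_quadratic_direction`).

For generic germs, the condition Q_ss ≠ 0 is that lam (H ∘ γ)'' ≠ 0 for a regular parametrization γ
of the LPL. The sign of this product does not depend on the parameters (`NondegenerateLPL.comp`),
and it is the sign of a polynomial `tangencyIndex` in the jet. On `G1` the property of the theorem
holds exactly where the index is nonzero (`generic_iff`), which gives openness. For density, choose
parameters along null directions at p. There cubic perturbations along the normal produce lam ≠ 0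
without destroying the tangency, and quartic ones fix dH and dL but change the index at a constant
nonzero rate (`exists_near_ne_zero`, `exists_affine_path`). Along such a path the index takes both
signs, so a single model surface yields both configurations. -/

namespace MinkowskiSurface

/-! ### Calculus of smooth germs: inverse and implicit functions. -/

section Smooth

variable {V W Z : Type*} [NormedAddCommGroup V] [NormedSpace ℝ V]
  [NormedAddCommGroup W] [NormedSpace ℝ W] [NormedAddCommGroup Z] [NormedSpace ℝ Z]

theorem SmoothNear.contDiffAt {f : V → W} {a : V} (hf : SmoothNear f a) : ContDiffAt ℝ ∞ f a :=
  hf.self_of_nhds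

theorem SmoothNear.continuousAt {f : V → W} {a : V} (hf : SmoothNear f a) : ContinuousAt f a :=
  hf.contDiffAt.continuousAt

theorem SmoothNear.differentiableAt {f : V → W} {a : V} (hf : SmoothNear f a) :
    DifferentiableAt ℝ f a :=
  hf.contDiffAt.differentiableAt (by simp)

theorem SmoothNear.eventually {f : V → W} {a : V} (hf : SmoothNear f a) :
    ∀ᶠ y in 𝓝 a, SmoothNear f y :=
  eventually_eventually_nhds.2 hf

theorem smoothNear_of_contDiff {f : V → W} (hf : ContDiff ℝ ∞ f) (a : V) : SmoothNear f a :=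
  Eventually.of_forall fun _ => hf.contDiffAt

theorem SmoothNear.congr {f g : V → W} {a : V} (hf : SmoothNear f a) (h : g =ᶠ[𝓝 a] f) :
    SmoothNear g a := by
  filter_upwards [Filter.Eventually.and hf h.eventuallyEq_nhds] with y hy
  exact hy.1.congr_of_eventuallyEq hy.2

theorem SmoothNear.add {f g : V → W} {a : V} (hf : SmoothNear f a) (hg : SmoothNear g a) :
    SmoothNear (fun y => f y + g y) a := by
  filter_upwards [Filter.Eventually.and hf hg] with y hy using hy.1.add hy.2

theorem SmoothNear.sub {f g : V → W} {a : V} (hf : SmoothNear f a) (hg : SmoothNear g a) :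
    SmoothNear (fun y => f y - g y) a := by
  filter_upwards [Filter.Eventually.and hf hg] with y hy using hy.1.sub hy.2

theorem SmoothNear.mul {f g : V → ℝ} {a : V} (hf : SmoothNear f a) (hg : SmoothNear g a) :
    SmoothNear (fun y => f y * g y) a := by
  filter_upwards [Filter.Eventually.and hf hg] with y hy using hy.1.mul hy.2

theorem SmoothNear.pow {f : V → ℝ} {a : V} (hf : SmoothNear f a) (n : ℕ) :
    SmoothNear (fun y => f y ^ n) a := by
  filter_upwards [hf] with y hy using hy.pow n

theorem SmoothNear.smul {f : V → ℝ} {g : V → W} {a : V} (hf : SmoothNear f a)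
    (hg : SmoothNear g a) : SmoothNear (fun y => f y • g y) a := by
  filter_upwards [Filter.Eventually.and hf hg] with y hy using hy.1.smul hy.2

theorem SmoothNear.prodMk {f : V → W} {g : V → Z} {a : V} (hf : SmoothNear f a)
    (hg : SmoothNear g a) : SmoothNear (fun y => (f y, g y)) a := by
  filter_upwards [Filter.Eventually.and hf hg] with y hy using hy.1.prodMk hy.2

theorem smoothNear_const (c : W) (a : V) : SmoothNear (fun _ : V => c) a :=
  smoothNear_of_contDiff contDiff_const a

theorem SmoothNear.clm_comp {f : V → W} {a : V} (T : W →L[ℝ] Z) (hf : SmoothNear f a) :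
    SmoothNear (fun y => T (f y)) a := by
  filter_upwards [hf] with y hy using T.contDiff.contDiffAt.comp y hy

theorem SmoothNear.fderiv {f : V → W} {a : V} (hf : SmoothNear f a) :
    SmoothNear (fderiv ℝ f) a := by
  filter_upwards [hf] with y hy using hy.fderiv_right (by simp)

theorem SmoothNear.fderiv_apply {f : V → W} {a : V} (hf : SmoothNear f a) (v : V) :
    SmoothNear (fun y => _root_.fderiv ℝ f y v) a :=
  hf.fderiv.clm_comp (ContinuousLinearMap.apply ℝ W v)

theorem SmoothNear.deriv {f : ℝ → W} {a : ℝ} (hf : SmoothNear f a) : SmoothNear (deriv f) a :=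
  (hf.fderiv_apply 1).congr (Eventually.of_forall fun _ => by simp)

theorem SmoothNear.comp_of_eq {g : W → Z} {f : V → W} {a : V} {b : W} (hg : SmoothNear g b)
    (hf : SmoothNear f a) (h : f a = b) : SmoothNear (fun y => g (f y)) a := by
  subst h
  exact SmoothNear.comp hg hf

/-- The second derivative of a function along a curve. -/
theorem deriv_deriv_comp {Z : V → ℝ} {γ : ℝ → V} {s : ℝ}
    (hZ : SmoothNear Z (γ s)) (hγ : SmoothNear γ s) :
    deriv (deriv (fun r => Z (γ r))) s =
      fderiv ℝ (fun y => fderiv ℝ Z y (deriv γ s)) (γ s) (deriv γ s) +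
        fderiv ℝ Z (γ s) (deriv (deriv γ) s) := by
  have h1 : deriv (fun r => Z (γ r)) =ᶠ[𝓝 s] fun r => fderiv ℝ Z (γ r) (deriv γ r) := by
    filter_upwards [hγ.continuousAt.eventually hZ, hγ] with r hr1 hr2
    exact ((hr1.differentiableAt (by simp)).hasFDerivAt.comp_hasDerivAt r
      (hr2.differentiableAt (by simp)).hasDerivAt).deriv
  rw [h1.deriv_eq]
  have hd : HasDerivAt (fun r => fderiv ℝ Z (γ r))
      (fderiv ℝ (fderiv ℝ Z) (γ s) (deriv γ s)) s :=
    hZ.fderiv.differentiableAt.hasFDerivAt.comp_hasDerivAt s hγ.differentiableAt.hasDerivAt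
  rw [(hd.clm_apply hγ.deriv.differentiableAt.hasDerivAt).deriv]
  rw [fderiv_clm_apply hZ.fderiv.differentiableAt (differentiableAt_const _)]
  simp

/-- At a critical point the acceleration of the curve drops out and only the Hessian on its velocity
remains. Second-order contact can therefore be computed along any curve with the right tangent. -/
theorem deriv_deriv_comp_of_fderiv_eq_zero {Z : V → ℝ} {γ : ℝ → V} {s : ℝ}
    (hZ : SmoothNear Z (γ s)) (hγ : SmoothNear γ s) (h0 : fderiv ℝ Z (γ s) = 0) :
    deriv (deriv (fun r => Z (γ r))) s =
      fderiv ℝ (fun y => fderiv ℝ Z y (deriv γ s)) (γ s) (deriv γ s) := by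
  rw [deriv_deriv_comp hZ hγ, h0]
  simp

/-- The inverse function theorem for smooth germs at the origin. -/
theorem exists_smooth_inverse [FiniteDimensional ℝ V] {F : V → V} (hF : SmoothNear F 0)
    (h0 : F 0 = 0) (hinj : Function.Injective (fderiv ℝ F 0)) :
    ∃ G : V → V, SmoothNear G 0 ∧ G 0 = 0 ∧ (∀ᶠ y in 𝓝 0, G (F y) = y) ∧
      ∀ᶠ y in 𝓝 0, F (G y) = y := by
  have : CompleteSpace V := FiniteDimensional.complete ℝ V
  let e : V ≃L[ℝ] V :=
    (LinearEquiv.ofInjectiveEndo (fderiv ℝ F 0 : V →ₗ[ℝ] V) hinj).toContinuousLinearEquiv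
  have he : (e : V →L[ℝ] V) = fderiv ℝ F 0 := by ext v; rfl
  have hd : HasFDerivAt F (e : V →L[ℝ] V) 0 := by
    rw [he]; exact hF.differentiableAt.hasFDerivAt
  have hn : (∞ : WithTop ℕ∞) ≠ 0 := by simp
  let f := hF.contDiffAt.toOpenPartialHomeomorph F hd hn
  have hs : (0 : V) ∈ f.source := hF.contDiffAt.mem_toOpenPartialHomeomorph_source hd hn
  have ht : (0 : V) ∈ f.target := by
    have := hF.contDiffAt.image_mem_toOpenPartialHomeomorph_target hd hn
    rwa [h0] at this
  have hG0 : f.symm 0 = 0 := by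
    have := f.left_inv hs
    rwa [show f 0 = 0 from h0] at this
  have hGc : Tendsto f.symm (𝓝 0) (𝓝 0) := by
    have := (f.symm.continuousAt ht).tendsto
    rwa [hG0] at this
  -- Smoothness of the inverse is needed on a whole neighbourhood; it holds because invertibility of
  -- the derivative is an open condition.
  have hinv : ∀ᶠ y in 𝓝 (0 : V), fderiv ℝ F y ∈
      Set.range ((↑) : (V ≃L[ℝ] V) → V →L[ℝ] V) := by
    have hc := hF.fderiv.continuousAt.tendsto
    rw [← he] at hc
    exact hc.eventually (ContinuousLinearEquiv.nhds e)
  refine ⟨f.symm, ?_, hG0, ?_, ?_⟩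
  · filter_upwards [hGc.eventually (Filter.Eventually.and hinv hF), f.open_target.mem_nhds ht]
      with y hy hyt
    obtain ⟨e', he'⟩ := hy.1
    refine f.contDiffAt_symm hyt (f₀' := e') ?_ hy.2
    rw [he']
    exact (hy.2.differentiableAt (by simp)).hasFDerivAt
  · filter_upwards [f.open_source.mem_nhds hs] with y hy using f.left_inv hy
  · filter_upwards [f.open_target.mem_nhds ht] with y hy using f.right_inv hy

/-- A smooth equation `F(t, s, w) = 0` with `∂F/∂w ≠ 0` is the equation of a smooth graph. -/
theorem exists_graph {F : ℝ × Plane → ℝ} (hF : SmoothNear F 0) (h0 : F 0 = 0)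
    (hw : fderiv ℝ F 0 (0, (0, 1)) ≠ 0) :
    ∃ Q : ℝ × ℝ → ℝ, SmoothNear Q 0 ∧ Q 0 = 0 ∧
      ∀ᶠ y in 𝓝 (0 : ℝ × Plane), F y = 0 ↔ y.2.2 = Q (y.1, y.2.1) := by
  -- Replace the coordinate `w` by the value of `F`. The graph is then the `w`-component of the
  -- inverse map on the set where this value is 0.
  let M : ℝ × Plane → ℝ × Plane := fun y => (y.1, (y.2.1, F y))
  have hM : SmoothNear M 0 :=
    (smoothNear_of_contDiff contDiff_fst 0).prodMk
      ((smoothNear_of_contDiff (contDiff_fst.comp contDiff_snd) 0).prodMk hF)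
  have hM0 : M 0 = 0 := by simp [M, h0]
  have hMd : ∀ v : ℝ × Plane, fderiv ℝ M 0 v = (v.1, (v.2.1, fderiv ℝ F 0 v)) := by
    intro v
    have h1 : HasFDerivAt M ((ContinuousLinearMap.fst ℝ ℝ Plane).prod
        (((ContinuousLinearMap.fst ℝ ℝ ℝ).comp (ContinuousLinearMap.snd ℝ ℝ Plane)).prod
          (fderiv ℝ F 0))) 0 :=
      hasFDerivAt_fst.prodMk ((hasFDerivAt_fst.comp _ hasFDerivAt_snd).prodMk
        hF.differentiableAt.hasFDerivAt)
    rw [h1.fderiv]; rfl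
  have hinj : Function.Injective (fderiv ℝ M 0) := by
    rw [injective_iff_map_eq_zero]
    rintro ⟨t, s, w⟩ hv
    rw [hMd] at hv
    simp only [Prod.mk_eq_zero] at hv
    obtain ⟨rfl, rfl, h3⟩ := hv
    have : fderiv ℝ F 0 (0, (0, w)) = w * fderiv ℝ F 0 (0, (0, 1)) := by
      rw [← smul_eq_mul, ← map_smul]; simp
    rw [this] at h3
    simp [(mul_eq_zero.1 h3).resolve_right hw]
  obtain ⟨G, hG, hG0, hGM, hMG⟩ := exists_smooth_inverse hM hM0 hinj
  have hι : SmoothNear (fun z : ℝ × ℝ => ((z.1, (z.2, 0)) : ℝ × Plane)) 0 :=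
    smoothNear_of_contDiff (by fun_prop) 0
  have hr : Tendsto (fun y : ℝ × Plane => ((y.1, (y.2.1, 0)) : ℝ × Plane)) (𝓝 0) (𝓝 0) := by
    have : Continuous (fun y : ℝ × Plane => ((y.1, (y.2.1, 0)) : ℝ × Plane)) := by fun_prop
    exact this.tendsto' _ _ rfl
  refine ⟨fun z => (G (z.1, (z.2, 0))).2.2, ?_, ?_, ?_⟩
  · exact (hG.comp_of_eq hι rfl).clm_comp
      ((ContinuousLinearMap.snd ℝ ℝ ℝ).comp (ContinuousLinearMap.snd ℝ ℝ Plane))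
  · change (G 0).2.2 = 0
    rw [hG0]; rfl
  · filter_upwards [hGM, hr.eventually hMG] with y hy1 hy2
    constructor
    · intro hy
      rw [show M y = (y.1, (y.2.1, 0)) by simp [M, hy]] at hy1
      simp only [hy1]
    · intro hy
      have e1 := congrArg Prod.fst hy2
      have e2 := congrArg (fun z : ℝ × Plane => z.2.1) hy2
      have e3 := congrArg (fun z : ℝ × Plane => z.2.2) hy2
      simp only [M] at e1 e2 e3
      have : G (y.1, (y.2.1, 0)) = y := by
        refine Prod.ext e1 (Prod.ext e2 hy.symm)
      rwa [this] at e3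

/-- Local coordinates `(s, w)` depending smoothly on `t`, in which `L(t, ·) = w`. -/
theorem exists_straightening {L : ℝ × Plane → ℝ} (hL : SmoothNear L 0) (h0 : L 0 = 0)
    (hd : ∃ v : Plane, fderiv ℝ L 0 (0, v) ≠ 0) :
    ∃ (Φ : ℝ × Plane → Plane) (S : Plane →L[ℝ] ℝ), SmoothNear Φ 0 ∧ Φ 0 = 0 ∧
      (∀ᶠ y in 𝓝 (0 : ℝ × Plane), L (y.1, Φ y) = y.2.2) ∧
      (∀ᶠ y in 𝓝 (0 : ℝ × Plane), S (Φ y) = y.2.1) ∧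
      ∀ᶠ y in 𝓝 (0 : ℝ × Plane), Φ (y.1, (S y.2, L y)) = y.2 := by
  set a := fderiv ℝ L 0 (0, ((1, 0) : Plane)) with ha
  set b := fderiv ℝ L 0 (0, ((0, 1) : Plane)) with hb
  have hab : ∀ v : Plane, fderiv ℝ L 0 (0, v) = v.1 * a + v.2 * b := by
    intro v
    rw [ha, hb, ← smul_eq_mul, ← smul_eq_mul, ← map_smul, ← map_smul, ← map_add]
    simp
  -- `S` is the differential of `L(0, ·)` rotated by a right angle, so `(S, dL)` has determinant
  -- `-(a² + b²) ≠ 0`.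
  let S : Plane →L[ℝ] ℝ :=
    (-b) • ContinuousLinearMap.fst ℝ ℝ ℝ + a • ContinuousLinearMap.snd ℝ ℝ ℝ
  have hS : ∀ v : Plane, S v = -b * v.1 + a * v.2 := fun v => rfl
  let M : ℝ × Plane → ℝ × Plane := fun y => (y.1, (S y.2, L y))
  have hM : SmoothNear M 0 :=
    (smoothNear_of_contDiff contDiff_fst 0).prodMk
      ((smoothNear_of_contDiff (S.contDiff.comp contDiff_snd) 0).prodMk hL)
  have hM0 : M 0 = 0 := by simp [M, h0]
  have hMd : ∀ v : ℝ × Plane, fderiv ℝ M 0 v = (v.1, (S v.2, fderiv ℝ L 0 v)) := by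
    intro v
    have h1 : HasFDerivAt M ((ContinuousLinearMap.fst ℝ ℝ Plane).prod
        ((S.comp (ContinuousLinearMap.snd ℝ ℝ Plane)).prod (fderiv ℝ L 0))) 0 :=
      hasFDerivAt_fst.prodMk ((S.hasFDerivAt.comp _ hasFDerivAt_snd).prodMk
        hL.differentiableAt.hasFDerivAt)
    rw [h1.fderiv]; rfl
  have hN : a ^ 2 + b ^ 2 ≠ 0 := by
    intro h
    have h1 : a = 0 := by nlinarith [sq_nonneg a, sq_nonneg b]
    have h2 : b = 0 := by nlinarith [sq_nonneg a, sq_nonneg b]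
    obtain ⟨v, hv⟩ := hd
    exact hv (by rw [hab, h1, h2]; ring)
  have hinj : Function.Injective (fderiv ℝ M 0) := by
    rw [injective_iff_map_eq_zero]
    rintro ⟨t, u, v⟩ hv
    rw [hMd] at hv
    simp only [Prod.mk_eq_zero] at hv
    obtain ⟨rfl, h2, h3⟩ := hv
    rw [hab] at h3
    rw [hS] at h2
    simp only at h2 h3
    have hu : u = 0 := by
      have : u * (a ^ 2 + b ^ 2) = 0 := by linear_combination a * h3 - b * h2
      exact (mul_eq_zero.1 this).resolve_right hN
    have hv : v = 0 := by
      have : v * (a ^ 2 + b ^ 2) = 0 := by linear_combination b * h3 + a * h2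
      exact (mul_eq_zero.1 this).resolve_right hN
    simp [hu, hv]
  obtain ⟨G, hG, hG0, hGM, hMG⟩ := exists_smooth_inverse hM hM0 hinj
  refine ⟨fun y => (G y).2, S, hG.clm_comp (ContinuousLinearMap.snd ℝ ℝ Plane), by simp [hG0],
    ?_, ?_, ?_⟩
  · filter_upwards [hMG] with y hy
    have e1 := congrArg Prod.fst hy
    have e3 := congrArg (fun z : ℝ × Plane => z.2.2) hy
    simp only [M] at e1 e3
    rw [← e1, ← e3]
  · filter_upwards [hMG] with y hy
    exact congrArg (fun z : ℝ × Plane => z.2.1) hy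
  · filter_upwards [hGM] with y hy
    exact congrArg Prod.snd hy

end Smooth

/-! ### Strictly convex functions and the fold bifurcation. -/

theorem lt_zero_of_strictConvexOn {f : ℝ → ℝ} {S : Set ℝ} (hf : StrictConvexOn ℝ S f)
    {a b s : ℝ} (ha : a ∈ S) (hb : b ∈ S) (hfa : f a ≤ 0) (hfb : f b ≤ 0) (h1 : a < s)
    (h2 : s < b) : f s < 0 := by
  have hab : a < b := h1.trans h2
  have := hf.lt_on_openSegment ha hb hab.ne (by rw [openSegment_eq_Ioo hab]; exact ⟨h1, h2⟩)
  exact this.trans_le (max_le hfa hfb)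

/-- A strictly convex function which is negative at `0` and positive at `±r` has two roots in
between, and they are simple. -/
theorem exists_two_roots {f : ℝ → ℝ} {S : Set ℝ} {r : ℝ} (hr : 0 < r)
    (hf : StrictConvexOn ℝ S f) (hS : Set.Icc (-r) r ⊆ S)
    (hd : ∀ s ∈ Set.Icc (-r) r, DifferentiableAt ℝ f s)
    (h0 : f 0 < 0) (h1 : 0 < f r) (h2 : 0 < f (-r)) :
    ∃ a b : ℝ, -r < a ∧ a < b ∧ b < r ∧ deriv f a ≠ 0 ∧ deriv f b ≠ 0 ∧
      ∀ s ∈ Set.Ioo (-r) r, (f s = 0 ↔ s = a ∨ s = b) ∧ (f s < 0 ↔ a < s ∧ s < b) := by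
  have hc : ContinuousOn f (Set.Icc (-r) r) := fun s hs =>
    (hd s hs).continuousAt.continuousWithinAt
  obtain ⟨a, ha, hfa⟩ := intermediate_value_Ioo' (by linarith : -r ≤ 0)
    (hc.mono (Set.Icc_subset_Icc_right hr.le)) (⟨h0, h2⟩ : (0 : ℝ) ∈ Set.Ioo (f 0) (f (-r)))
  obtain ⟨b, hb, hfb⟩ := intermediate_value_Ioo hr.le
    (hc.mono (Set.Icc_subset_Icc_left (by linarith))) (⟨h0, h1⟩ : (0 : ℝ) ∈ Set.Ioo (f 0) (f r))
  have ha' : a ∈ Set.Icc (-r) r := ⟨ha.1.le, by linarith [ha.2]⟩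
  have hb' : b ∈ Set.Icc (-r) r := ⟨by linarith [hb.1], hb.2.le⟩
  have h0' : (0 : ℝ) ∈ Set.Icc (-r) r := ⟨by linarith, hr.le⟩
  -- Beyond a root the sign is forced by convexity: a value `≤ 0` at `s < a`, together with `f 0 <
  -- 0`, would make `f` negative at the intermediate point `a`.
  have key : ∀ s ∈ Set.Ioo (-r) r, (s < a → 0 < f s) ∧ (b < s → 0 < f s) ∧
      (a < s → s < b → f s < 0) := by
    intro s hs
    have hs' := hS (Set.Ioo_subset_Icc_self hs)
    refine ⟨fun h => ?_, fun h => ?_, fun h h' => ?_⟩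
    · by_contra hn
      have := lt_zero_of_strictConvexOn hf hs' (hS h0') (not_lt.1 hn) h0.le h ha.2
      linarith
    · by_contra hn
      have := lt_zero_of_strictConvexOn hf (hS h0') hs' h0.le (not_lt.1 hn) hb.1 h
      linarith
    · exact lt_zero_of_strictConvexOn hf (hS ha') (hS hb') hfa.le hfb.le h h'
  refine ⟨a, b, ha.1, ha.2.trans hb.1, hb.2, ?_, ?_, fun s hs => ?_⟩
  -- The root is simple: the derivative at `a` is below the slope of the chord from `a` to 0, which
  -- is negative.
  · have := hf.lt_slope_of_hasDerivAt (hS ha') (hS h0') ha.2 (hd a ha').hasDerivAt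
    rw [slope_def_field, hfa] at this
    have h3 : (f 0 - 0) / (0 - a) < 0 := div_neg_of_neg_of_pos (by linarith) (by linarith [ha.2])
    exact (this.trans h3).ne
  · have := hf.slope_lt_of_hasDerivAt (hS h0') (hS hb') hb.1 (hd b hb').hasDerivAt
    rw [slope_def_field, hfb] at this
    have h3 : 0 < (0 - f 0) / (b - 0) := div_pos (by linarith) (by linarith [hb.1])
    exact (h3.trans this).ne'
  · obtain ⟨k1, k2, k3⟩ := key s hs
    have hab := ha.2.trans hb.1
    rcases lt_trichotomy s a with h | rfl | h
    · have := k1 h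
      exact ⟨⟨fun e => by linarith, by rintro (rfl | rfl) <;> linarith⟩,
        ⟨fun e => by linarith, fun e => by linarith [e.1]⟩⟩
    · exact ⟨⟨fun _ => .inl rfl, fun _ => hfa⟩, ⟨fun e => by linarith, fun e => by linarith [e.1]⟩⟩
    · rcases lt_trichotomy s b with h' | rfl | h'
      · have := k3 h h'
        exact ⟨⟨fun e => by linarith, by rintro (rfl | rfl) <;> linarith⟩,
          ⟨fun _ => ⟨h, h'⟩, fun _ => this⟩⟩
      · exact ⟨⟨fun _ => .inr rfl, fun _ => hfb⟩,
          ⟨fun e => by linarith, fun e => by linarith [e.2]⟩⟩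
      · have := k2 h'
        exact ⟨⟨fun e => by linarith, by rintro (rfl | rfl) <;> linarith⟩,
          ⟨fun e => by linarith, fun e => by linarith [e.2]⟩⟩

theorem hasDerivAt_slice_snd {q : ℝ × ℝ → ℝ} {t s : ℝ} (h : DifferentiableAt ℝ q (t, s)) :
    HasDerivAt (fun s => q (t, s)) (fderiv ℝ q (t, s) (0, 1)) s :=
  h.hasFDerivAt.comp_hasDerivAt s ((hasDerivAt_const s t).prodMk (hasDerivAt_id s))

theorem hasDerivAt_slice_fst {q : ℝ × ℝ → ℝ} {t s : ℝ} (h : DifferentiableAt ℝ q (t, s)) :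
    HasDerivAt (fun t => q (t, s)) (fderiv ℝ q (t, s) (1, 0)) t :=
  h.hasFDerivAt.comp_hasDerivAt t ((hasDerivAt_id t).prodMk (hasDerivAt_const t s))

theorem strictConvexOn_slice {q : ℝ × ℝ → ℝ} {ρ t : ℝ}
    (h : ∀ s ∈ Set.Ioo (-ρ) ρ, SmoothNear q (t, s) ∧
      0 < fderiv ℝ (fun y => fderiv ℝ q y (0, 1)) (t, s) (0, 1)) :
    StrictConvexOn ℝ (Set.Ioo (-ρ) ρ) (fun s => q (t, s)) := by
  refine strictConvexOn_of_deriv2_pos' (convex_Ioo _ _) (fun s hs => ?_) fun s hs => ?_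
  · exact (hasDerivAt_slice_snd (h s hs).1.differentiableAt).continuousAt.continuousWithinAt
  · have e : deriv (fun s => q (t, s)) =ᶠ[𝓝 s] fun s => fderiv ℝ q (t, s) (0, 1) := by
      filter_upwards [isOpen_Ioo.mem_nhds hs] with s' hs'
      exact (hasDerivAt_slice_snd (h s' hs').1.differentiableAt).deriv
    rw [Function.iterate_succ, Function.iterate_one, Function.comp_apply, e.deriv_eq,
      (hasDerivAt_slice_snd ((h s hs).1.fderiv_apply (0, 1)).differentiableAt).deriv]
    exact (h s hs).2

/-- The graph lies strictly above its horizontal tangent at 0. -/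
theorem pos_of_strictConvexOn {f : ℝ → ℝ} {S : Set ℝ} (hf : StrictConvexOn ℝ S f)
    (h0 : (0 : ℝ) ∈ S) (f0 : f 0 = 0) (hd : HasDerivAt f 0 0) {s : ℝ} (hs : s ∈ S) (hne : s ≠ 0) :
    0 < f s := by
  rcases lt_or_gt_of_ne hne with h | h
  · have := hf.slope_lt_of_hasDerivAt hs h0 h hd
    rw [slope_def_field, f0, div_lt_iff₀ (by linarith)] at this
    linarith
  · have := hf.lt_slope_of_hasDerivAt h0 hs h hd
    rw [slope_def_field, f0, lt_div_iff₀ (by linarith)] at this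
    linarith

theorem eventually_pos_slice {q : ℝ × ℝ → ℝ} (hq : SmoothNear q 0) (q0 : q 0 = 0)
    (hs : fderiv ℝ q 0 (0, 1) = 0)
    (hss : 0 < fderiv ℝ (fun y => fderiv ℝ q y (0, 1)) 0 (0, 1)) :
    ∀ᶠ s in 𝓝 (0 : ℝ), s ≠ 0 → 0 < q (0, s) := by
  obtain ⟨ρ, hρ, hball⟩ := Metric.eventually_nhds_iff.1 (hq.eventually.and
    (((hq.fderiv_apply (0, 1)).fderiv_apply (0, 1)).continuousAt.eventually (lt_mem_nhds hss)))
  have hconv : StrictConvexOn ℝ (Set.Ioo (-ρ) ρ) (fun s => q (0, s)) := by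
    refine strictConvexOn_slice fun s hs' => hball ?_
    rw [dist_zero_right, Prod.norm_def]
    exact max_lt (by simpa using hρ) (abs_lt.2 hs')
  have hd := hasDerivAt_slice_snd (q := q) (t := 0) (s := 0) hq.differentiableAt
  rw [show fderiv ℝ q (0, 0) (0, 1) = 0 from hs] at hd
  filter_upwards [Ioo_mem_nhds (by linarith : -ρ < 0) hρ] with s hs' hne
  exact pos_of_strictConvexOn hconv ⟨by linarith, hρ⟩ q0 hd hs' hne

/-- At a nondegenerate minimum of `q(0, ·)` with `q = 0` and `∂q/∂t ≠ 0`, the zeros of `q(t, ·)`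
undergo a fold bifurcation. -/
theorem fold_bifurcation {q : ℝ × ℝ → ℝ} {σ : ℝ} (hq : SmoothNear q 0) (q0 : q 0 = 0)
    (hs : fderiv ℝ q 0 (0, 1) = 0)
    (hss : 0 < fderiv ℝ (fun y => fderiv ℝ q y (0, 1)) 0 (0, 1))
    (ht : σ * fderiv ℝ q 0 (1, 0) < 0) :
    ∀ᶠ r in 𝓝[>] (0 : ℝ), ∀ᶠ t in 𝓝 (0 : ℝ),
      (σ * t < 0 → ∀ s ∈ Set.Ioo (-r) r, 0 < q (t, s)) ∧
      (0 < σ * t → ∃ a b : ℝ, -r < a ∧ a < b ∧ b < r ∧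
        deriv (fun s => q (t, s)) a ≠ 0 ∧ deriv (fun s => q (t, s)) b ≠ 0 ∧
        ∀ s ∈ Set.Ioo (-r) r, (q (t, s) = 0 ↔ s = a ∨ s = b) ∧
          (q (t, s) < 0 ↔ a < s ∧ s < b)) := by
  have hev : ∀ᶠ y in 𝓝 (0 : ℝ × ℝ), SmoothNear q y ∧
      0 < fderiv ℝ (fun y => fderiv ℝ q y (0, 1)) y (0, 1) ∧ σ * fderiv ℝ q y (1, 0) < 0 := by
    refine hq.eventually.and (Filter.Eventually.and ?_ ?_)
    · exact ((hq.fderiv_apply (0, 1)).fderiv_apply (0, 1)).continuousAt.eventually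
        (lt_mem_nhds hss)
    · exact ((hq.fderiv_apply (1, 0)).continuousAt.const_mul σ).eventually (gt_mem_nhds ht)
  obtain ⟨ρ, hρ, hball⟩ := Metric.eventually_nhds_iff.1 hev
  have hB : ∀ t s : ℝ, t ∈ Set.Ioo (-ρ) ρ → s ∈ Set.Ioo (-ρ) ρ → SmoothNear q (t, s) ∧
      0 < fderiv ℝ (fun y => fderiv ℝ q y (0, 1)) (t, s) (0, 1) ∧
      σ * fderiv ℝ q (t, s) (1, 0) < 0 := by
    intro t s ht hs
    refine hball (y := (t, s)) ?_
    rw [dist_zero_right, Prod.norm_def]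
    exact max_lt (abs_lt.2 ht) (abs_lt.2 hs)
  have h00 : (0 : ℝ) ∈ Set.Ioo (-ρ) ρ := ⟨by linarith, hρ⟩
  have hconv : ∀ t ∈ Set.Ioo (-ρ) ρ,
      StrictConvexOn ℝ (Set.Ioo (-ρ) ρ) (fun s => q (t, s)) := fun t ht =>
    strictConvexOn_slice fun s hs => ⟨(hB t s ht hs).1, (hB t s ht hs).2.1⟩
  have hpos : ∀ s ∈ Set.Ioo (-ρ) ρ, s ≠ 0 → 0 < q (0, s) := by
    intro s hs' hne
    have hd := hasDerivAt_slice_snd (hB 0 0 h00 h00).1.differentiableAt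
    rw [show fderiv ℝ q (0, 0) (0, 1) = 0 from hs] at hd
    exact pos_of_strictConvexOn (hconv 0 h00) h00 q0 hd hs' hne
  have hanti : ∀ s ∈ Set.Ioo (-ρ) ρ,
      StrictAntiOn (fun t => σ * q (t, s)) (Set.Ioo (-ρ) ρ) := by
    intro s hs'
    have hd : ∀ t ∈ Set.Ioo (-ρ) ρ, HasDerivAt (fun t => σ * q (t, s))
        (σ * fderiv ℝ q (t, s) (1, 0)) t := fun t ht' =>
      (hasDerivAt_slice_fst (hB t s ht' hs').1.differentiableAt).const_mul σ
    refine strictAntiOn_of_deriv_neg (convex_Ioo _ _)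
      (fun t ht' => (hd t ht').continuousAt.continuousWithinAt) fun t ht' => ?_
    rw [interior_Ioo] at ht'
    rw [(hd t ht').deriv]
    exact (hB t s ht' hs').2.2
  -- Since `σ q` decreases in `t`, each slice is compared with the slice `t = 0`, which is positive
  -- except for its zero at `s = 0`: a slice is above it for `σ t < 0` and below it for `σ t > 0`.
  have hcmp : ∀ t ∈ Set.Ioo (-ρ) ρ, ∀ s ∈ Set.Ioo (-ρ) ρ,
      (σ * t < 0 → q (0, s) < q (t, s)) ∧ (0 < σ * t → q (t, s) < q (0, s)) := by
    intro t ht' s hs'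
    have mono := hanti s hs'
    constructor
    · intro h
      rcases lt_trichotomy t 0 with h' | rfl | h'
      · have h1 := mono ht' h00 h'
        have h2 : 0 < σ := pos_of_mul_neg_left h h'.le
        exact lt_of_mul_lt_mul_left h1 h2.le
      · simp at h
      · have h1 := mono h00 ht' h'
        have h2 : σ < 0 := neg_of_mul_neg_left h h'.le
        simp only at h1
        nlinarith
    · intro h
      rcases lt_trichotomy t 0 with h' | rfl | h'
      · have h1 := mono ht' h00 h'
        have h2 : σ < 0 := neg_of_mul_pos_left h h'.le
        simp only at h1
        nlinarith
      · simp at h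
      · have h1 := mono h00 ht' h'
        have h2 : 0 < σ := pos_of_mul_pos_left h h'.le
        exact lt_of_mul_lt_mul_left h1 h2.le
  have hr : ∀ᶠ r in 𝓝[>] (0 : ℝ), r ∈ Set.Ioo 0 ρ := Ioo_mem_nhdsGT hρ
  filter_upwards [hr] with r hr
  have hI : Set.Icc (-r) r ⊆ Set.Ioo (-ρ) ρ := fun s hs' =>
    ⟨by linarith [hs'.1, hr.2], by linarith [hs'.2, hr.2]⟩
  have hrm : r ∈ Set.Ioo (-ρ) ρ := hI ⟨by linarith [hr.1], le_rfl⟩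
  have hrm' : -r ∈ Set.Ioo (-ρ) ρ := hI ⟨le_rfl, by linarith [hr.1]⟩
  -- Positivity at the ends `±r` survives for small `t`; with the negative value at 0 when `σ t >
  -- 0`, this is the sign pattern of `exists_two_roots`.
  have hend : ∀ s ∈ Set.Ioo (-ρ) ρ, s ≠ 0 → ∀ᶠ t in 𝓝 (0 : ℝ), 0 < q (t, s) := by
    intro s hs' hne
    exact (hasDerivAt_slice_fst (hB 0 s h00 hs').1.differentiableAt).continuousAt.eventually
      (lt_mem_nhds (hpos s hs' hne))
  filter_upwards [hend r hrm hr.1.ne', hend (-r) hrm' (by linarith [hr.1]),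
    Ioo_mem_nhds (by linarith : -ρ < 0) hρ] with t h1 h2 ht'
  constructor
  · intro h s hs'
    have hsm := hI (Set.Ioo_subset_Icc_self hs')
    have h3 := (hcmp t ht' s hsm).1 h
    by_cases hs0 : s = 0
    · subst hs0
      rwa [show q (0, 0) = 0 from q0] at h3
    · exact (hpos s hsm hs0).trans h3
  · intro h
    have h3 := (hcmp t ht' 0 h00).2 h
    rw [show q (0, 0) = 0 from q0] at h3
    exact exists_two_roots hr.1 (hconv t ht') hI
      (fun s hs' => (hasDerivAt_slice_snd (hB t s ht' (hI hs')).1.differentiableAt).differentiableAt)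
      h3 h1 h2

/-! ### Coordinates adapted to a family of curves `L = 0`, `H = 0`, `L = H²`. -/

/-- Coordinates `(s, w)` of the plane depending on `t`, in which `L(t, ·) = 0`, `H(t, ·) = 0` and
`L(t, ·) = H(t, ·)²` are the graphs `w = 0`, `w = Q(t, s)` and `w = P(t, s)`. -/
structure AdaptedCoordinates (L H : ℝ × Plane → ℝ) where
  Φ : ℝ × Plane → Plane
  S : Plane →L[ℝ] ℝ
  P : ℝ × ℝ → ℝ
  Q : ℝ × ℝ → ℝ
  smoothΦ : SmoothNear Φ 0
  Φ_zero : Φ 0 = 0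
  L_comp : ∀ᶠ y in 𝓝 (0 : ℝ × Plane), L (y.1, Φ y) = y.2.2
  S_comp : ∀ᶠ y in 𝓝 (0 : ℝ × Plane), S (Φ y) = y.2.1
  left_inv : ∀ᶠ y in 𝓝 (0 : ℝ × Plane), Φ (y.1, (S y.2, L y)) = y.2
  smoothP : SmoothNear P 0
  smoothQ : SmoothNear Q 0
  P_zero : P 0 = 0
  Q_zero : Q 0 = 0
  H_iff : ∀ᶠ y in 𝓝 (0 : ℝ × Plane), H (y.1, Φ y) = 0 ↔ y.2.2 = Q (y.1, y.2.1)
  P_iff : ∀ᶠ y in 𝓝 (0 : ℝ × Plane),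
    L (y.1, Φ y) = H (y.1, Φ y) ^ 2 ↔ y.2.2 = P (y.1, y.2.1)

theorem fderiv_snd_snd (y v : ℝ × Plane) :
    fderiv ℝ (fun y : ℝ × Plane => y.2.2) y v = v.2.2 := by
  have h := ((ContinuousLinearMap.snd ℝ ℝ ℝ).comp
    (ContinuousLinearMap.snd ℝ ℝ Plane)).hasFDerivAt (x := y)
  exact congrArg (fun T : ℝ × Plane →L[ℝ] ℝ => T v) h.fderiv

theorem fderiv_snd_fst (y v : ℝ × Plane) :
    fderiv ℝ (fun y : ℝ × Plane => y.2.1) y v = v.2.1 := by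
  have h := ((ContinuousLinearMap.fst ℝ ℝ ℝ).comp
    (ContinuousLinearMap.snd ℝ ℝ Plane)).hasFDerivAt (x := y)
  exact congrArg (fun T : ℝ × Plane →L[ℝ] ℝ => T v) h.fderiv

theorem fderiv_comp_family {f : ℝ × Plane → ℝ} {Φ : ℝ × Plane → Plane} (hf : SmoothNear f 0)
    (hΦ : SmoothNear Φ 0) (h0 : Φ 0 = 0) (v : ℝ × Plane) :
    fderiv ℝ (fun y : ℝ × Plane => f (y.1, Φ y)) 0 v = fderiv ℝ f 0 (v.1, fderiv ℝ Φ 0 v) := by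
  have h1 : HasFDerivAt (fun y : ℝ × Plane => ((y.1, Φ y) : ℝ × Plane))
      ((ContinuousLinearMap.fst ℝ ℝ Plane).prod (fderiv ℝ Φ 0)) 0 :=
    hasFDerivAt_fst.prodMk hΦ.differentiableAt.hasFDerivAt
  have h2 : HasFDerivAt f (fderiv ℝ f 0) (((0 : ℝ × Plane).1, Φ 0) : ℝ × Plane) := by
    rw [h0]; exact hf.differentiableAt.hasFDerivAt
  have h3 := h2.comp (0 : ℝ × Plane) h1
  rw [show (fun y : ℝ × Plane => f (y.1, Φ y)) = f ∘ fun y => (y.1, Φ y) from rfl, h3.fderiv]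
  rfl

theorem smoothNear_family {W : Type*} [NormedAddCommGroup W] [NormedSpace ℝ W]
    {f : ℝ × Plane → W} {Φ : ℝ × Plane → Plane} (hf : SmoothNear f 0)
    (hΦ : SmoothNear Φ 0) (h0 : Φ 0 = 0) :
    SmoothNear (fun y : ℝ × Plane => f (y.1, Φ y)) 0 :=
  hf.comp_of_eq ((smoothNear_of_contDiff contDiff_fst 0).prodMk hΦ) (by simp [h0])

/-- Once `L` is the coordinate `w`, the relation `dH = lam dL` gives `H` the `w`-derivative `lam ≠
0`. Since `H` vanishes at the origin, `H²` has no linear part, and `L - H²` has `w`-derivative 1.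
The implicit function theorem then applies to both. -/
theorem exists_adaptedCoordinates {L H : ℝ × Plane → ℝ} (hL : SmoothNear L 0)
    (hH : SmoothNear H 0) (L0 : L 0 = 0) (H0 : H 0 = 0) {lam : ℝ} (hlam : lam ≠ 0)
    (hHL : ∀ v : Plane, fderiv ℝ H 0 (0, v) = lam * fderiv ℝ L 0 (0, v))
    (hd : ∃ v : Plane, fderiv ℝ L 0 (0, v) ≠ 0) : Nonempty (AdaptedCoordinates L H) := by
  obtain ⟨Φ, S, hΦ, Φ0, hLΦ, hSΦ, hinv⟩ := exists_straightening hL L0 hd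
  have hHΦ := smoothNear_family hH hΦ Φ0
  have hHΦ0 : H ((0 : ℝ × Plane).1, Φ 0) = 0 := by rw [Φ0]; exact H0
  have e1 : fderiv ℝ (fun y : ℝ × Plane => L (y.1, Φ y)) 0 (0, (0, 1)) = 1 := by
    have hLΦ' : (fun y : ℝ × Plane => L (y.1, Φ y)) =ᶠ[𝓝 0] fun y => y.2.2 := hLΦ
    rw [hLΦ'.fderiv_eq, fderiv_snd_snd]
  have e2 : fderiv ℝ (fun y : ℝ × Plane => H (y.1, Φ y)) 0 (0, (0, 1)) = lam := by
    rw [fderiv_comp_family hH hΦ Φ0, hHL]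
    rw [fderiv_comp_family hL hΦ Φ0] at e1
    rw [e1, mul_one]
  obtain ⟨Q, hQ, Q0, hQiff⟩ := exists_graph hHΦ hHΦ0 (by rw [e2]; exact hlam)
  have hP' : SmoothNear (fun y : ℝ × Plane => L (y.1, Φ y) - H (y.1, Φ y) ^ 2) 0 :=
    (smoothNear_family hL hΦ Φ0).sub (hHΦ.pow 2)
  have e3 : fderiv ℝ (fun y : ℝ × Plane => L (y.1, Φ y) - H (y.1, Φ y) ^ 2) 0 (0, (0, 1)) = 1 := by
    rw [fderiv_fun_sub (smoothNear_family hL hΦ Φ0).differentiableAt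
      (hHΦ.pow 2).differentiableAt, fderiv_fun_pow 2 hHΦ.differentiableAt]
    simp only [sub_apply, e1, hHΦ0]
    simp
  obtain ⟨P, hP, P0, hPiff⟩ := exists_graph hP'
    (by rw [hHΦ0, Φ0, show (((0 : ℝ × Plane).1, 0) : ℝ × Plane) = 0 from rfl, L0]; simp)
    (by rw [e3]; exact one_ne_zero)
  refine ⟨⟨Φ, S, P, Q, hΦ, Φ0, hLΦ, hSΦ, hinv, hP, hQ, P0, Q0, hQiff, ?_⟩⟩
  filter_upwards [hPiff] with y hy
  rw [← hy, sub_eq_zero]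

namespace AdaptedCoordinates

variable {L H : ℝ × Plane → ℝ}

theorem L_comp_fderiv (A : AdaptedCoordinates L H) (hL : SmoothNear L 0) (v : ℝ × Plane) :
    fderiv ℝ L 0 (v.1, fderiv ℝ A.Φ 0 v) = v.2.2 := by
  have h : (fun y : ℝ × Plane => L (y.1, A.Φ y)) =ᶠ[𝓝 0] fun y => y.2.2 := A.L_comp
  rw [← fderiv_comp_family hL A.smoothΦ A.Φ_zero, h.fderiv_eq, fderiv_snd_snd]

theorem S_comp_fderiv (A : AdaptedCoordinates L H) (v : ℝ × Plane) :
    A.S (fderiv ℝ A.Φ 0 v) = v.2.1 := by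
  have h1 : HasFDerivAt (fun y => A.S (A.Φ y)) (A.S.comp (fderiv ℝ A.Φ 0)) 0 :=
    A.S.hasFDerivAt.comp _ A.smoothΦ.differentiableAt.hasFDerivAt
  have h : (fun y : ℝ × Plane => A.S (A.Φ y)) =ᶠ[𝓝 0] fun y => y.2.1 := A.S_comp
  have h2 := h.fderiv_eq (𝕜 := ℝ)
  rw [h1.fderiv] at h2
  exact (congrArg (fun T : ℝ × Plane →L[ℝ] ℝ => T v) h2).trans (fderiv_snd_fst 0 v)

/-- Applying `S` and `L` recovers `s` and `w`, so the derivative of the slice has trivial kernel. -/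
theorem bijective_fderiv_slice (A : AdaptedCoordinates L H) (hL : SmoothNear L 0) :
    Function.Bijective (fderiv ℝ (fun y : Plane => A.Φ (0, y)) 0) := by
  have h1 : ∀ v, fderiv ℝ (fun y : Plane => A.Φ (0, y)) 0 v = fderiv ℝ A.Φ 0 (0, v) := by
    intro v
    have hi : HasFDerivAt (fun y : Plane => ((0, y) : ℝ × Plane))
        (ContinuousLinearMap.inr ℝ ℝ Plane) 0 := hasFDerivAt_prodMk_right 0 0
    have := (A.smoothΦ.differentiableAt.hasFDerivAt (𝕜 := ℝ)).comp (0 : Plane) hi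
    exact congrArg (fun T : Plane →L[ℝ] Plane => T v) this.fderiv
  have hinj : Function.Injective (fderiv ℝ (fun y : Plane => A.Φ (0, y)) 0) := by
    rw [injective_iff_map_eq_zero]
    intro v hv
    rw [h1] at hv
    have h2 := A.S_comp_fderiv (0, v)
    have h3 := A.L_comp_fderiv hL (0, v)
    simp only [hv, map_zero] at h2 h3
    rw [show ((0, 0) : ℝ × Plane) = 0 from rfl, map_zero] at h3
    exact Prod.ext h2.symm h3.symm
  exact ⟨hinj, (LinearMap.injective_iff_surjective
    (f := (fderiv ℝ (fun y : Plane => A.Φ (0, y)) 0 : Plane →ₗ[ℝ] Plane))).1 hinj⟩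

theorem tendsto_graph {R : ℝ × ℝ → ℝ} (hR : SmoothNear R 0) (hR0 : R 0 = 0) :
    Tendsto (fun z : ℝ × ℝ => ((z.1, (z.2, R z)) : ℝ × Plane)) (𝓝 0) (𝓝 0) := by
  have h1 : ContinuousAt (fun z : ℝ × ℝ => ((z.1, (z.2, R z)) : ℝ × Plane)) 0 :=
    continuousAt_fst.prodMk (continuousAt_snd.prodMk hR.continuousAt)
  have h2 := h1.tendsto
  simp only [hR0] at h2
  exact h2

theorem tendsto_axis : Tendsto (fun z : ℝ × ℝ => ((z.1, (z.2, 0)) : ℝ × Plane)) (𝓝 0) (𝓝 0) :=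
  tendsto_graph (smoothNear_const 0 0) rfl

/-- On its graph `P` equals `H²`, hence `P ≥ 0`; on the axis `w = 0` the equations `L = H²` and `H =
0` coincide, hence `P` and `Q` have the same zeros. For the last relation, `H` vanishes on the graph
of `Q` and is Lipschitz in `w`. If `P ≥ Q > 0`, then `P = H² ≤ C² (P - Q)² ≤ C² P²`, which is
impossible when `P` is small. -/
theorem P_relations (A : AdaptedCoordinates L H) (hH : SmoothNear H 0) :
    ∀ᶠ z in 𝓝 (0 : ℝ × ℝ), 0 ≤ A.P z ∧ (A.P z = 0 ↔ A.Q z = 0) ∧ (0 < A.Q z → A.P z < A.Q z) := by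
  have hHΦ := smoothNear_family hH A.smoothΦ A.Φ_zero
  obtain ⟨C, U, hU, hLip⟩ := (hHΦ.contDiffAt.of_le (by simp : (1 : WithTop ℕ∞) ≤ ∞)).exists_lipschitzOnWith
  have hPs : ∀ᶠ z in 𝓝 (0 : ℝ × ℝ), (C : ℝ) ^ 2 * A.P z < 1 := by
    have h1 : ContinuousAt (fun z => (C : ℝ) ^ 2 * A.P z) 0 := A.smoothP.continuousAt.const_mul _
    exact h1.eventually (gt_mem_nhds (by simp [A.P_zero]))
  have tP := tendsto_graph A.smoothP A.P_zero
  have tQ := tendsto_graph A.smoothQ A.Q_zero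
  filter_upwards [tP.eventually (A.P_iff.and A.L_comp), tQ.eventually A.H_iff,
    tendsto_axis.eventually (A.P_iff.and (A.L_comp.and A.H_iff)), tP.eventually_mem hU,
    tQ.eventually_mem hU, hPs] with z h1 h2 h3 h4 h5 h6
  simp only [iff_true] at h1 h2
  have hP : A.P z = H (z.1, A.Φ (z.1, (z.2, A.P z))) ^ 2 := by
    exact h1.2.symm.trans h1.1
  obtain ⟨h3a, h3b, h3c⟩ := h3
  refine ⟨by rw [hP]; positivity, ?_, fun hQ => ?_⟩
  · rw [eq_comm (b := (0 : ℝ)), eq_comm (b := (0 : ℝ)), ← h3c, ← h3a, h3b]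
    constructor
    · intro h; exact pow_eq_zero_iff two_ne_zero |>.1 h.symm
    · intro h; rw [h]; simp
  · by_contra hn
    have hn := not_lt.1 hn
    have hl := hLip.dist_le_mul _ h4 _ h5
    simp only [h2, dist_zero_right, Real.norm_eq_abs] at hl
    have hd : dist ((z.1, (z.2, A.P z)) : ℝ × Plane) (z.1, (z.2, A.Q z)) = A.P z - A.Q z := by
      rw [Prod.dist_eq, Prod.dist_eq]
      simp only [dist_self]
      rw [max_eq_right (le_max_of_le_left le_rfl), max_eq_right dist_nonneg, Real.dist_eq,
        abs_of_nonneg (by linarith)]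
    rw [hd] at hl
    have h7 : H (z.1, A.Φ (z.1, (z.2, A.P z))) ^ 2 ≤ (C * (A.P z - A.Q z)) ^ 2 :=
      sq_le_sq' (by linarith [neg_abs_le (H (z.1, A.Φ (z.1, (z.2, A.P z))))]) ((le_abs_self _).trans hl)
    rw [← hP, mul_pow] at h7
    have h8 : (A.P z - A.Q z) ^ 2 ≤ A.P z ^ 2 := by
      apply pow_le_pow_left₀ <;> linarith
    have hPpos : 0 < A.P z := by linarith
    have h9 : A.P z ≤ (C : ℝ) ^ 2 * A.P z ^ 2 :=
      h7.trans (mul_le_mul_of_nonneg_left h8 (sq_nonneg _))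
    nlinarith

/-- The curve `H = 0` in the coordinates of the source. -/
theorem graphQ_props (A : AdaptedCoordinates L H) :
    ∀ᶠ z in 𝓝 (0 : ℝ × ℝ), H (z.1, A.Φ (z.1, (z.2, A.Q z))) = 0 ∧
      L (z.1, A.Φ (z.1, (z.2, A.Q z))) = A.Q z ∧ A.S (A.Φ (z.1, (z.2, A.Q z))) = z.2 := by
  filter_upwards [(tendsto_graph A.smoothQ A.Q_zero).eventually
    (A.H_iff.and (A.L_comp.and A.S_comp))] with z hz
  exact ⟨hz.1.2 rfl, hz.2.1, hz.2.2⟩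

theorem smooth_graphQ (A : AdaptedCoordinates L H) :
    SmoothNear (fun z : ℝ × ℝ => A.Φ (z.1, (z.2, A.Q z))) 0 :=
  A.smoothΦ.comp_of_eq ((smoothNear_of_contDiff contDiff_fst 0).prodMk
    ((smoothNear_of_contDiff contDiff_snd 0).prodMk A.smoothQ)) (by simp [A.Q_zero])

/-- Differentiate `H = 0` and `L = Q` along the MCNC and eliminate the unknown motion in the plane
by means of `dH = lam dL`. It follows that `Q_s = 0`, and that `Q_t ≠ 0` exactly when `H_t ≠ lam
L_t`, provided `lam ≠ 0`. -/
theorem fderiv_Q (A : AdaptedCoordinates L H) (hL : SmoothNear L 0) (hH : SmoothNear H 0)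
    {lam : ℝ} (hHL : ∀ v : Plane, fderiv ℝ H 0 (0, v) = lam * fderiv ℝ L 0 (0, v)) (v : ℝ × ℝ) :
    lam * fderiv ℝ A.Q 0 v =
      -v.1 * (fderiv ℝ H 0 (1, 0) - lam * fderiv ℝ L 0 (1, 0)) := by
  have hsm := A.smooth_graphQ
  set κ : ℝ × ℝ → Plane := fun z => A.Φ (z.1, (z.2, A.Q z)) with hκ
  have hκ0 : κ 0 = 0 := by simp only [hκ, A.Q_zero]; exact A.Φ_zero
  have hG : HasFDerivAt (fun z : ℝ × ℝ => ((z.1, κ z) : ℝ × Plane))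
      ((ContinuousLinearMap.fst ℝ ℝ ℝ).prod (fderiv ℝ κ 0)) 0 :=
    hasFDerivAt_fst.prodMk hsm.differentiableAt.hasFDerivAt
  have hG0 : (((0 : ℝ × ℝ).1, κ 0) : ℝ × Plane) = 0 := by rw [hκ0]; rfl
  have hLd : HasFDerivAt L (fderiv ℝ L 0) (((0 : ℝ × ℝ).1, κ 0) : ℝ × Plane) := by
    rw [hG0]; exact hL.differentiableAt.hasFDerivAt
  have hHd : HasFDerivAt H (fderiv ℝ H 0) (((0 : ℝ × ℝ).1, κ 0) : ℝ × Plane) := by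
    rw [hG0]; exact hH.differentiableAt.hasFDerivAt
  have e1 : fderiv ℝ L 0 (v.1, fderiv ℝ κ 0 v) = fderiv ℝ A.Q 0 v := by
    have h1 := (hLd.comp (0 : ℝ × ℝ) hG).fderiv
    have h2 : (L ∘ fun z : ℝ × ℝ => ((z.1, κ z) : ℝ × Plane)) =ᶠ[𝓝 0] A.Q := by
      filter_upwards [A.graphQ_props] with z hz using hz.2.1
    rw [h2.fderiv_eq] at h1
    rw [h1]; rfl
  have e2 : fderiv ℝ H 0 (v.1, fderiv ℝ κ 0 v) = 0 := by
    have h1 := (hHd.comp (0 : ℝ × ℝ) hG).fderiv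
    have h2 : (H ∘ fun z : ℝ × ℝ => ((z.1, κ z) : ℝ × Plane)) =ᶠ[𝓝 0] fun _ => 0 := by
      filter_upwards [A.graphQ_props] with z hz using hz.1
    rw [h2.fderiv_eq] at h1
    have h3 := congrArg (fun T : ℝ × ℝ →L[ℝ] ℝ => T v) h1
    simp only [fderiv_fun_const] at h3
    exact h3.symm
  have split : ∀ (T : ℝ × Plane →L[ℝ] ℝ) (p : Plane), T (v.1, p) = v.1 * T (1, 0) + T (0, p) := by
    intro T p
    rw [← smul_eq_mul, ← map_smul, ← map_add]; simp
  rw [split] at e1 e2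
  rw [hHL] at e2
  linear_combination e2 - lam * e1

/-- For `t = 0` the function `H - lam L` is critical at the origin and equals `-lam Q` along the
MCNC. Its second derivative there is thus the Hessian on the velocity `ξ` of the MCNC, and `ξ` is in
the kernel of `dL` by tangency. -/
theorem fderiv_fderiv_Q (A : AdaptedCoordinates L H) (hL : SmoothNear L 0) (hH : SmoothNear H 0)
    {lam : ℝ} (hlam : lam ≠ 0)
    (hHL : ∀ v : Plane, fderiv ℝ H 0 (0, v) = lam * fderiv ℝ L 0 (0, v)) :
    ∃ ξ : Plane, ξ ≠ 0 ∧ fderiv ℝ L 0 (0, ξ) = 0 ∧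
      lam * fderiv ℝ (fun y => fderiv ℝ A.Q y (0, 1)) 0 (0, 1) =
        -fderiv ℝ (fun y => fderiv ℝ (fun q : Plane => H (0, q) - lam * L (0, q)) y ξ) 0 ξ := by
  set ζ : ℝ → Plane := fun s => A.Φ (0, (s, A.Q (0, s))) with hζ
  have hinr : SmoothNear (fun s : ℝ => ((0, s) : ℝ × ℝ)) 0 :=
    smoothNear_of_contDiff (by fun_prop) 0
  have hinr' : SmoothNear (fun q : Plane => ((0, q) : ℝ × Plane)) 0 :=
    smoothNear_of_contDiff (by fun_prop) 0
  have hζs : SmoothNear ζ 0 := A.smooth_graphQ.comp_of_eq hinr rfl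
  have hζ0 : ζ 0 = 0 := by
    simp only [hζ]
    rw [show A.Q (0, 0) = 0 from A.Q_zero]; exact A.Φ_zero
  have tz : Tendsto (fun s : ℝ => ((0, s) : ℝ × ℝ)) (𝓝 0) (𝓝 0) := hinr.continuousAt
  have props := tz.eventually A.graphQ_props
  have hQ1 : fderiv ℝ A.Q 0 (0, 1) = 0 := by
    have := A.fderiv_Q hL hH hHL (0, 1)
    simpa [hlam] using this
  set Z : Plane → ℝ := fun q => H (0, q) - lam * L (0, q) with hZ
  have hZs : SmoothNear Z 0 :=
    (hH.comp_of_eq hinr' rfl).sub ((smoothNear_const lam 0).mul (hL.comp_of_eq hinr' rfl))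
  have hZ' : SmoothNear Z (ζ 0) := by rwa [hζ0]
  have slice : ∀ {f : ℝ × Plane → ℝ}, SmoothNear f 0 →
      HasFDerivAt (fun q : Plane => f (0, q))
        ((fderiv ℝ f 0).comp (ContinuousLinearMap.inr ℝ ℝ Plane)) 0 := by
    intro f hf
    exact (hf.differentiableAt.hasFDerivAt (𝕜 := ℝ)).comp (0 : Plane) (hasFDerivAt_prodMk_right 0 0)
  have hdZ : fderiv ℝ Z 0 = 0 := by
    have h1 : HasFDerivAt Z _ 0 := (slice hH).sub ((slice hL).const_mul lam)
    rw [h1.fderiv]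
    ext
    · simpa [sub_eq_zero] using hHL (1, 0)
    · simpa [sub_eq_zero] using hHL (0, 1)
  have hdZ' : fderiv ℝ Z (ζ 0) = 0 := by rwa [hζ0]
  have hd2 := deriv_deriv_comp_of_fderiv_eq_zero hZ' hζs hdZ'
  rw [hζ0] at hd2
  have hQs : ∀ᶠ s in 𝓝 (0 : ℝ), HasDerivAt (fun s => A.Q (0, s)) (fderiv ℝ A.Q (0, s) (0, 1)) s :=
    (tz.eventually A.smoothQ).mono fun s hs => hasDerivAt_slice_snd (hs.differentiableAt (by simp))
  have hQQ : deriv (deriv (fun s => A.Q (0, s))) 0 =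
      fderiv ℝ (fun y => fderiv ℝ A.Q y (0, 1)) 0 (0, 1) := by
    have e : deriv (fun s => A.Q (0, s)) =ᶠ[𝓝 0] fun s => fderiv ℝ A.Q (0, s) (0, 1) :=
      hQs.mono fun s hs => hs.deriv
    rw [e.deriv_eq]
    exact (hasDerivAt_slice_snd (t := 0) (s := 0)
      (A.smoothQ.fderiv_apply (0, 1)).differentiableAt).deriv
  have hZQ : (fun s => Z (ζ s)) =ᶠ[𝓝 0] fun s => -lam * A.Q (0, s) := by
    filter_upwards [props] with s hs
    simp only [hZ, hζ]
    rw [hs.1, hs.2.1]; ring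
  have hZQ2 : deriv (deriv (fun s => Z (ζ s))) 0 = -lam * deriv (deriv (fun s => A.Q (0, s))) 0 := by
    have e : deriv (fun s => Z (ζ s)) =ᶠ[𝓝 0] fun s => -lam * deriv (fun s => A.Q (0, s)) s := by
      filter_upwards [hZQ.eventuallyEq_nhds] with s hs
      rw [hs.deriv_eq, deriv_const_mul_field]
    rw [e.deriv_eq, deriv_const_mul_field]
  have hζd := hζs.differentiableAt.hasDerivAt
  refine ⟨deriv ζ 0, ?_, ?_, ?_⟩
  · intro h
    have h1 : HasDerivAt (fun s => A.S (ζ s)) (A.S (deriv ζ 0)) 0 :=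
      A.S.hasFDerivAt.comp_hasDerivAt 0 hζd
    have h2 : (fun s => A.S (ζ s)) =ᶠ[𝓝 0] fun s => s := by
      filter_upwards [props] with s hs using hs.2.2
    have h3 := h2.deriv_eq
    rw [h1.deriv, h, map_zero, deriv_id''] at h3
    exact zero_ne_one h3
  · have hL' : HasFDerivAt (fun q : Plane => L (0, q))
        ((fderiv ℝ L 0).comp (ContinuousLinearMap.inr ℝ ℝ Plane)) (ζ 0) := by
      rw [hζ0]; exact slice hL
    have h1 := hL'.comp_hasDerivAt 0 hζd
    have h2 : ((fun q : Plane => L (0, q)) ∘ ζ) =ᶠ[𝓝 0] fun s => A.Q (0, s) := by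
      filter_upwards [props] with s hs using hs.2.1
    have h3 := h2.deriv_eq
    rw [h1.deriv, hQs.self_of_nhds.deriv] at h3
    exact h3.trans hQ1
  · rw [← hd2, hZQ2, hQQ]; ring

end AdaptedCoordinates

/-- For `σ t < 0` the function `ε Q(t, ·)` is positive near `0`; for `σ t > 0` it has two simple
zeros, between which it is negative. -/
def Folds (Q : ℝ × ℝ → ℝ) (ε σ : ℝ) : Prop :=
  ∀ᶠ r in 𝓝[>] (0 : ℝ), ∀ᶠ t in 𝓝 (0 : ℝ),
      (σ * t < 0 → ∀ s ∈ Set.Ioo (-r) r, 0 < ε * Q (t, s)) ∧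
      (0 < σ * t → ∃ a b : ℝ, -r < a ∧ a < b ∧ b < r ∧
        deriv (fun s => Q (t, s)) a ≠ 0 ∧ deriv (fun s => Q (t, s)) b ≠ 0 ∧
        ∀ s ∈ Set.Ioo (-r) r, (Q (t, s) = 0 ↔ s = a ∨ s = b) ∧
          (ε * Q (t, s) < 0 ↔ a < s ∧ s < b))

theorem folds_of_fderiv {Q : ℝ × ℝ → ℝ} {ε σ : ℝ} (hQ : SmoothNear Q 0) (Q0 : Q 0 = 0)
    (hs : fderiv ℝ Q 0 (0, 1) = 0)
    (hss : 0 < ε * fderiv ℝ (fun y => fderiv ℝ Q y (0, 1)) 0 (0, 1))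
    (ht : σ * (ε * fderiv ℝ Q 0 (1, 0)) < 0) : Folds Q ε σ := by
  have hε : ε ≠ 0 := by rintro rfl; simp at hss
  have hfd : ∀ v, (fun y => fderiv ℝ (fun z => ε * Q z) y v) =ᶠ[𝓝 0]
      fun y => ε * fderiv ℝ Q y v := by
    intro v
    filter_upwards [hQ] with y hy
    rw [fderiv_const_mul (hy.differentiableAt (by simp))]
    rfl
  have hd : ∀ (t s : ℝ), deriv (fun s => ε * Q (t, s)) s = ε * deriv (fun s => Q (t, s)) s :=
    fun t s => deriv_const_mul_field ε
  have key := fold_bifurcation (q := fun z => ε * Q z) (σ := σ)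
    ((smoothNear_const ε 0).mul hQ) (by simp [Q0])
    ((hfd _).self_of_nhds.trans (by simp [hs]))
    (by rw [(hfd _).fderiv_eq, fderiv_const_mul (hQ.fderiv_apply _).differentiableAt]; exact hss)
    (by rw [show fderiv ℝ (fun z => ε * Q z) 0 (1, 0) = _ from (hfd _).self_of_nhds]; exact ht)
  filter_upwards [key] with r hr
  filter_upwards [hr] with t ht
  refine ⟨ht.1, fun h => ?_⟩
  obtain ⟨a, b, h1, h2, h3, h4, h5, h6⟩ := ht.2 h
  rw [hd] at h4 h5
  refine ⟨a, b, h1, h2, h3, right_ne_zero_of_mul h4, right_ne_zero_of_mul h5, fun s hs => ?_⟩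
  have := h6 s hs
  rwa [mul_eq_zero, or_iff_right hε] at this

/-- Counting the solutions of `L(t, ·) = H(t, ·) = 0` near the origin. -/
theorem AdaptedCoordinates.card_solutions {L H : ℝ × Plane → ℝ} (A : AdaptedCoordinates L H)
    (hL : SmoothNear L 0) (L0 : L 0 = 0) {ε σ : ℝ} (hF : Folds A.Q ε σ) :
    ∀ᶠ ρ in 𝓝[>] (0 : ℝ), ∀ᶠ t in 𝓝 (0 : ℝ),
      (0 < σ * t → ({q | q ∈ Metric.ball (0 : Plane) ρ ∧ L (t, q) = 0 ∧ H (t, q) = 0}).ncard = 2) ∧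
      (σ * t < 0 → ∀ q ∈ Metric.ball (0 : Plane) ρ, ¬ (L (t, q) = 0 ∧ H (t, q) = 0)) := by
  obtain ⟨r₀, hr₀, hF'⟩ := mem_nhdsGT_iff_exists_Ioo_subset.1 hF
  have hr₀ : 0 < r₀ := hr₀
  have hFr : ∀ r, 0 < r → r < r₀ → _ := fun r h1 h2 => hF' ⟨h1, h2⟩
  set r := r₀ / 2 with hr
  have hr1 : 0 < r := by positivity
  have hr2 : r < r₀ := by rw [hr]; linarith
  have tN : Tendsto (fun y : ℝ × Plane => ((y.1, (A.S y.2, L y)) : ℝ × Plane)) (𝓝 0) (𝓝 0) := by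
    have h1 : ContinuousAt (fun y : ℝ × Plane => ((y.1, (A.S y.2, L y)) : ℝ × Plane)) 0 :=
      continuousAt_fst.prodMk ((A.S.continuous.comp continuous_snd).continuousAt.prodMk
        hL.continuousAt)
    have h2 := h1.tendsto
    simp only [L0, Prod.snd_zero, map_zero, Prod.fst_zero] at h2
    exact h2
  have hS : ∀ᶠ y in 𝓝 (0 : ℝ × Plane), A.S y.2 ∈ Set.Ioo (-r) r := by
    have h1 : Tendsto (fun y : ℝ × Plane => A.S y.2) (𝓝 0) (𝓝 0) :=
      (A.S.continuous.comp continuous_snd).tendsto' _ _ (by simp)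
    exact h1.eventually_mem (Ioo_mem_nhds (by linarith) hr1)
  obtain ⟨ρ₀, hρ₀, hball⟩ := Metric.eventually_nhds_iff.1
    (A.left_inv.and ((tN.eventually A.H_iff).and hS))
  have hρ : ∀ᶠ ρ in 𝓝[>] (0 : ℝ), ρ ∈ Set.Ioo 0 ρ₀ := Ioo_mem_nhdsGT hρ₀
  filter_upwards [hρ] with ρ hρ
  have hΦball : ∀ᶠ z in 𝓝 (0 : ℝ × ℝ), A.Φ (z.1, (z.2, 0)) ∈ Metric.ball (0 : Plane) ρ := by
    have h1 : Tendsto A.Φ (𝓝 0) (𝓝 0) := by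
      have := A.smoothΦ.continuousAt.tendsto
      rwa [A.Φ_zero] at this
    exact (h1.comp tendsto_axis).eventually_mem (Metric.ball_mem_nhds 0 hρ.1)
  obtain ⟨η, hη, hball'⟩ := Metric.eventually_nhds_iff.1
    (hΦball.and (tendsto_axis.eventually (A.L_comp.and (A.S_comp.and A.H_iff))))
  -- Two scales are needed. Solutions in the ball have `S` in `(-r, r)`, and every `s` in `(-r',
  -- r')` gives a point of the ball. Both intervals contain exactly two zeros of `Q(t, ·)`, so these
  -- are the same zeros.
  set r' := min (η / 2) (r / 2) with hr'
  have hr'1 : 0 < r' := by positivity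
  have hr'2 : r' < r := (min_le_right _ _).trans_lt (by linarith)
  have hr'3 : r' < η := (min_le_left _ _).trans_lt (by linarith)
  filter_upwards [hFr r hr1 hr2, hFr r' hr'1 (hr'2.trans hr2),
    Metric.ball_mem_nhds (0 : ℝ) hρ₀, Metric.ball_mem_nhds (0 : ℝ) hη] with t ht1 ht2 ht3 ht4
  have hV : ∀ q ∈ Metric.ball (0 : Plane) ρ, L (t, q) = 0 → H (t, q) = 0 →
      A.Φ (t, (A.S q, 0)) = q ∧ A.Q (t, A.S q) = 0 ∧ A.S q ∈ Set.Ioo (-r) r := by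
    intro q hq h1 h2
    have hy : dist ((t, q) : ℝ × Plane) 0 < ρ₀ := by
      rw [Prod.dist_eq]
      exact max_lt ht3 ((Metric.mem_ball.1 hq).trans hρ.2)
    obtain ⟨k1, k2, k3⟩ := hball hy
    simp only [h1] at k1 k2 k3
    rw [k1] at k2
    exact ⟨k1, (k2.1 h2).symm, k3⟩
  have hB : ∀ s ∈ Set.Ioo (-r') r', A.Φ (t, (s, 0)) ∈ Metric.ball (0 : Plane) ρ ∧
      L (t, A.Φ (t, (s, 0))) = 0 ∧ A.S (A.Φ (t, (s, 0))) = s ∧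
      (H (t, A.Φ (t, (s, 0))) = 0 ↔ 0 = A.Q (t, s)) := by
    intro s hs
    refine hball' (y := (t, s)) ?_
    rw [Prod.dist_eq]
    refine max_lt ht4 ?_
    rw [show dist (t, s).2 (0 : ℝ × ℝ).2 = |s| by simp]
    exact (abs_lt.2 hs).trans hr'3
  constructor
  · intro h
    obtain ⟨a, b, h1, h2, h3, -, -, h6⟩ := ht1.2 h
    obtain ⟨a', b', h1', h2', h3', -, -, h6'⟩ := ht2.2 h
    have ha' : a' ∈ Set.Ioo (-r') r' := ⟨h1', h2'.trans h3'⟩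
    have hb' : b' ∈ Set.Ioo (-r') r' := ⟨h1'.trans h2', h3'⟩
    have hsub : ∀ s ∈ Set.Ioo (-r') r', s ∈ Set.Ioo (-r) r := fun s hs =>
      ⟨by linarith [hs.1], by linarith [hs.2]⟩
    have qa : A.Q (t, a') = 0 := (h6' a' ha').1.2 (.inl rfl)
    have qb : A.Q (t, b') = 0 := (h6' b' hb').1.2 (.inr rfl)
    have ea := (h6 a' (hsub a' ha')).1.1 qa
    have eb := (h6 b' (hsub b' hb')).1.1 qb
    have e1 : a = a' := by rcases ea with e | e <;> rcases eb with e' | e' <;> linarith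
    have e2 : b = b' := by rcases ea with e | e <;> rcases eb with e' | e' <;> linarith
    have hset : {q | q ∈ Metric.ball (0 : Plane) ρ ∧ L (t, q) = 0 ∧ H (t, q) = 0} =
        {A.Φ (t, (a', 0)), A.Φ (t, (b', 0))} := by
      ext q
      constructor
      · rintro ⟨k1, k2, k3⟩
        obtain ⟨m1, m2, m3⟩ := hV q k1 k2 k3
        rcases (h6 _ m3).1.1 m2 with e | e
        · left; rw [← e1, ← e, m1]
        · right; rw [Set.mem_singleton_iff, ← e2, ← e, m1]
      · rintro (rfl | rfl)
        · obtain ⟨m1, m2, m3, m4⟩ := hB a' ha'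
          exact ⟨m1, m2, m4.2 qa.symm⟩
        · obtain ⟨m1, m2, m3, m4⟩ := hB b' hb'
          exact ⟨m1, m2, m4.2 qb.symm⟩
    rw [hset, Set.ncard_pair]
    intro he
    have := congrArg A.S he
    rw [(hB a' ha').2.2.1, (hB b' hb').2.2.1] at this
    exact h2'.ne this
  · rintro h q hq ⟨k1, k2⟩
    obtain ⟨m1, m2, m3⟩ := hV q hq k1 k2
    have := ht1.1 h _ m3
    rw [m2, mul_zero] at this
    exact lt_irrefl _ this

/-! ### The invariants as polynomials in the 2-jet. -/

/-- The derivatives of order 1 and 2 that enter the fundamental forms: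
`(f_a, f_b, f_aa, f_ab, f_bb)`. -/
abbrev Jet := Space × Space × Space × Space × Space

def jetE (j : Jet) : ℝ := mink j.1 j.1

def jetF (j : Jet) : ℝ := mink j.1 j.2.1

def jetG (j : Jet) : ℝ := mink j.2.1 j.2.1

def jetl (j : Jet) : ℝ := mink (cross j.1 j.2.1) j.2.2.1

def jetm (j : Jet) : ℝ := mink (cross j.1 j.2.1) j.2.2.2.1

def jetn (j : Jet) : ℝ := mink (cross j.1 j.2.1) j.2.2.2.2

def jetDisc (j : Jet) : ℝ := jetF j ^ 2 - jetE j * jetG j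

def jetL (j : Jet) : ℝ :=
  (jetE j * jetn j - jetG j * jetl j) ^ 2 -
    4 * (jetF j * jetn j - jetG j * jetm j) * (jetE j * jetm j - jetF j * jetl j)

def jetK (j : Jet) : ℝ := jetl j * jetn j - jetm j ^ 2

def jetH (j : Jet) : ℝ := jetl j * jetG j - 2 * jetm j * jetF j + jetn j * jetE j

/-- Up to a factor this is the discriminant of the characteristic polynomial of the shape operator,
in terms of its trace and determinant. It removes `K` from the problem wherever `δ > 0`. -/
theorem jetL_eq (j : Jet) : jetL j = jetH j ^ 2 + 4 * jetDisc j * jetK j := by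
  unfold jetL jetH jetDisc jetK; ring

theorem contDiff_jetE : ContDiff ℝ ∞ jetE := by
  unfold jetE mink; fun_prop

theorem contDiff_jetF : ContDiff ℝ ∞ jetF := by
  unfold jetF mink; fun_prop

theorem contDiff_jetG : ContDiff ℝ ∞ jetG := by
  unfold jetG mink; fun_prop

theorem mink_cross (a b c : Space) : mink (cross a b) c =
    (a 1 * b 2 - a 2 * b 1) * c 0 + (a 2 * b 0 - a 0 * b 2) * c 1 +
      (a 0 * b 1 - a 1 * b 0) * c 2 := by
  simp [mink, cross]; ring

theorem contDiff_jetl : ContDiff ℝ ∞ jetl := by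
  unfold jetl; simp only [mink_cross]; fun_prop

theorem contDiff_jetm : ContDiff ℝ ∞ jetm := by
  unfold jetm; simp only [mink_cross]; fun_prop

theorem contDiff_jetn : ContDiff ℝ ∞ jetn := by
  unfold jetn; simp only [mink_cross]; fun_prop

theorem contDiff_jetDisc : ContDiff ℝ ∞ jetDisc :=
  (contDiff_jetF.pow 2).sub (contDiff_jetE.mul contDiff_jetG)

theorem contDiff_jetK : ContDiff ℝ ∞ jetK :=
  (contDiff_jetl.mul contDiff_jetn).sub (contDiff_jetm.pow 2)

theorem contDiff_jetH : ContDiff ℝ ∞ jetH :=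
  ((contDiff_jetl.mul contDiff_jetG).sub
    ((contDiff_const.mul contDiff_jetm).mul contDiff_jetF)).add (contDiff_jetn.mul contDiff_jetE)

theorem contDiff_jetL : ContDiff ℝ ∞ jetL := by
  rw [show jetL = fun j => jetH j ^ 2 + 4 * jetDisc j * jetK j from funext jetL_eq]
  exact (contDiff_jetH.pow 2).add ((contDiff_const.mul contDiff_jetDisc).mul contDiff_jetK)

section JetOf

variable {V : Type*} [NormedAddCommGroup V] [NormedSpace ℝ V]

/-- The derivatives of `f` of order 1 and 2 in two directions. -/
noncomputable def jetOf (a b : V) (f : V → Space) (y : V) : Jet :=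
  (fderiv ℝ f y a, fderiv ℝ f y b, fderiv ℝ (fun z => fderiv ℝ f z a) y a,
    fderiv ℝ (fun z => fderiv ℝ f z a) y b, fderiv ℝ (fun z => fderiv ℝ f z b) y b)

theorem smoothNear_jetOf (a b : V) {f : V → Space} {y : V} (hf : SmoothNear f y) :
    SmoothNear (jetOf a b f) y :=
  (hf.fderiv_apply a).prodMk ((hf.fderiv_apply b).prodMk
    (((hf.fderiv_apply a).fderiv_apply a).prodMk (((hf.fderiv_apply a).fderiv_apply b).prodMk
      ((hf.fderiv_apply b).fderiv_apply b))))

theorem fderiv_apply_congr {W : Type*} [NormedAddCommGroup W] [NormedSpace ℝ W] {f g : V → W}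
    {y : V} (h : f =ᶠ[𝓝 y] g) (v : V) :
    (fun z => fderiv ℝ f z v) =ᶠ[𝓝 y] fun z => fderiv ℝ g z v :=
  (h.fderiv (𝕜 := ℝ)).mono fun z hz => by simp only [hz]

theorem jetOf_congr (a b : V) {f g : V → Space} {y : V} (h : f =ᶠ[𝓝 y] g) :
    jetOf a b f =ᶠ[𝓝 y] jetOf a b g := by
  filter_upwards [h.eventuallyEq_nhds] with z hz
  unfold jetOf
  rw [hz.fderiv_eq, (fderiv_apply_congr hz a).fderiv_eq, (fderiv_apply_congr hz b).fderiv_eq]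

theorem fderiv_fderiv_add {W : Type*} [NormedAddCommGroup W] [NormedSpace ℝ W] {f g : V → W}
    {y : V} (hf : SmoothNear f y) (hg : SmoothNear g y) (v w : V) :
    fderiv ℝ (fun z => fderiv ℝ (fun z => f z + g z) z v) y w =
      fderiv ℝ (fun z => fderiv ℝ f z v) y w + fderiv ℝ (fun z => fderiv ℝ g z v) y w := by
  have h : (fun z => fderiv ℝ (fun z => f z + g z) z v) =ᶠ[𝓝 y]
      fun z => fderiv ℝ f z v + fderiv ℝ g z v := by
    filter_upwards [hf, hg] with z h1 h2
    rw [fderiv_fun_add (h1.differentiableAt (by simp)) (h2.differentiableAt (by simp))]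
    rfl
  rw [h.fderiv_eq, fderiv_fun_add (hf.fderiv_apply v).differentiableAt
    (hg.fderiv_apply v).differentiableAt]
  rfl

theorem jetOf_add (a b : V) {f g : V → Space} {y : V} (hf : SmoothNear f y)
    (hg : SmoothNear g y) :
    jetOf a b (fun z => f z + g z) y = jetOf a b f y + jetOf a b g y := by
  unfold jetOf
  rw [fderiv_fderiv_add hf hg, fderiv_fderiv_add hf hg, fderiv_fderiv_add hf hg,
    fderiv_fun_add hf.differentiableAt hg.differentiableAt]
  rfl

end JetOf

/-! The functions attached to a parametrized surface, in terms of jets. -/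

noncomputable abbrev planeJet (f : Plane → Space) : Plane → Jet := jetOf ((1, 0) : Plane) (0, 1) f

theorem Hbar_eq (f : Plane → Space) : Hbar f = fun q => jetH (planeJet f q) := rfl

theorem Kbar_eq (f : Plane → Space) : Kbar f = fun q => jetK (planeJet f q) := rfl

theorem lplDisc_eq (f : Plane → Space) : lplDisc f = fun q => jetL (planeJet f q) := rfl

theorem metricDisc_eq (f : Plane → Space) : metricDisc f = fun q => jetDisc (planeJet f q) := rfl

theorem lplDisc_eq_sq_add (f : Plane → Space) (q : Plane) :
    lplDisc f q = Hbar f q ^ 2 + 4 * metricDisc f q * Kbar f q :=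
  jetL_eq (planeJet f q)

theorem smoothNear_jet {V : Type*} [NormedAddCommGroup V] [NormedSpace ℝ V] {p : Jet → ℝ}
    (hp : ContDiff ℝ ∞ p) (a b : V) {f : V → Space} {y : V} (hf : SmoothNear f y) :
    SmoothNear (fun z => p (jetOf a b f z)) y :=
  (smoothNear_of_contDiff hp _).comp_of_eq (smoothNear_jetOf a b hf) rfl

theorem smoothNear_Hbar {f : Plane → Space} {q : Plane} (hf : SmoothNear f q) :
    SmoothNear (Hbar f) q :=
  smoothNear_jet contDiff_jetH _ _ hf

theorem smoothNear_Kbar {f : Plane → Space} {q : Plane} (hf : SmoothNear f q) :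
    SmoothNear (Kbar f) q :=
  smoothNear_jet contDiff_jetK _ _ hf

theorem smoothNear_lplDisc {f : Plane → Space} {q : Plane} (hf : SmoothNear f q) :
    SmoothNear (lplDisc f) q :=
  smoothNear_jet contDiff_jetL _ _ hf

theorem smoothNear_metricDisc {f : Plane → Space} {q : Plane} (hf : SmoothNear f q) :
    SmoothNear (metricDisc f) q :=
  smoothNear_jet contDiff_jetDisc _ _ hf

/-! Derivatives of the invariants in the direction of the second order part of a jet. -/

/-- The jet with second order part `(α e, β e, γ e)`. -/
def vertJet (e : Space) (α β γ : ℝ) : Jet := (0, 0, α • e, β • e, γ • e)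

theorem fderiv_eq_deriv_line {V W : Type*} [NormedAddCommGroup V] [NormedSpace ℝ V]
    [NormedAddCommGroup W] [NormedSpace ℝ W] {p : V → W} {j : V} (hp : DifferentiableAt ℝ p j) (k : V) :
    fderiv ℝ p j k = deriv (fun s : ℝ => p (j + s • k)) 0 :=
  (hp.lineDeriv_eq_fderiv (v := k)).symm

theorem jetE_add_vertJet (j : Jet) (e : Space) (α β γ s : ℝ) :
    jetE (j + s • vertJet e α β γ) = jetE j := by
  simp [jetE, vertJet]

theorem jetF_add_vertJet (j : Jet) (e : Space) (α β γ s : ℝ) :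
    jetF (j + s • vertJet e α β γ) = jetF j := by
  simp [jetF, vertJet]

theorem jetG_add_vertJet (j : Jet) (e : Space) (α β γ s : ℝ) :
    jetG (j + s • vertJet e α β γ) = jetG j := by
  simp [jetG, vertJet]

theorem jetl_add_vertJet (j : Jet) (e : Space) (α β γ s : ℝ) :
    jetl (j + s • vertJet e α β γ) = jetl j + s * (α * mink (cross j.1 j.2.1) e) := by
  simp [jetl, vertJet, mink_cross]; ring

theorem jetm_add_vertJet (j : Jet) (e : Space) (α β γ s : ℝ) :
    jetm (j + s • vertJet e α β γ) = jetm j + s * (β * mink (cross j.1 j.2.1) e) := by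
  simp [jetm, vertJet, mink_cross]; ring

theorem jetn_add_vertJet (j : Jet) (e : Space) (α β γ s : ℝ) :
    jetn (j + s • vertJet e α β γ) = jetn j + s * (γ * mink (cross j.1 j.2.1) e) := by
  simp [jetn, vertJet, mink_cross]; ring

theorem deriv_quadratic (a b c : ℝ) : deriv (fun s : ℝ => a + s * b + s ^ 2 * c) 0 = b := by
  have h1 : HasDerivAt (fun s : ℝ => a + s * b + s ^ 2 * c)
      (0 + 1 * b + ((2 : ℕ) * (0 : ℝ) ^ (2 - 1) * 1) * c) 0 :=
    (((hasDerivAt_const (0 : ℝ) a).add ((hasDerivAt_id (0 : ℝ)).mul_const b))).add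
      (((hasDerivAt_id (0 : ℝ)).pow 2).mul_const c)
  rw [h1.deriv]; simp

/-- Moving the second-order part fixes `E`, `F`, `G` and shifts `l`, `m`, `n` linearly, so `H` is
affine along the line. -/
theorem fderiv_jetH_vertJet (j : Jet) (e : Space) (α β γ : ℝ) :
    fderiv ℝ jetH j (vertJet e α β γ) =
      mink (cross j.1 j.2.1) e * (α * jetG j - 2 * β * jetF j + γ * jetE j) := by
  rw [fderiv_eq_deriv_line (contDiff_jetH.differentiable (by simp) j)]
  rw [← deriv_quadratic (jetH j) (mink (cross j.1 j.2.1) e *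
    (α * jetG j - 2 * β * jetF j + γ * jetE j)) 0]
  congr 1
  funext s
  rw [jetH, jetH, jetE_add_vertJet, jetF_add_vertJet, jetG_add_vertJet, jetl_add_vertJet,
    jetm_add_vertJet, jetn_add_vertJet]
  ring

/-- Where `H = 0` the term `H²` of `L` is of second order, so only `4 δ dK` contributes. -/
theorem fderiv_jetL_vertJet {j : Jet} (hH : jetH j = 0) (e : Space) (α β γ : ℝ) :
    fderiv ℝ jetL j (vertJet e α β γ) =
      4 * jetDisc j * (mink (cross j.1 j.2.1) e *
        (α * jetn j - 2 * β * jetm j + γ * jetl j)) := by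
  set ν := mink (cross j.1 j.2.1) e with hν
  rw [fderiv_eq_deriv_line (contDiff_jetL.differentiable (by simp) j)]
  rw [← deriv_quadratic (4 * jetDisc j * jetK j) (4 * jetDisc j * (ν *
        (α * jetn j - 2 * β * jetm j + γ * jetl j)))
      ((ν * (α * jetG j - 2 * β * jetF j + γ * jetE j)) ^ 2 +
        4 * jetDisc j * ν ^ 2 * (α * γ - β ^ 2))]
  congr 1
  funext s
  have hH' : jetH (j + s • vertJet e α β γ) =
      s * (ν * (α * jetG j - 2 * β * jetF j + γ * jetE j)) := by
    have : jetH (j + s • vertJet e α β γ) =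
      jetH j + s * (ν * (α * jetG j - 2 * β * jetF j + γ * jetE j)) := by
      rw [jetH, jetH, jetE_add_vertJet, jetF_add_vertJet, jetG_add_vertJet, jetl_add_vertJet,
        jetm_add_vertJet, jetn_add_vertJet]
      ring
    rw [this, hH, zero_add]
  rw [jetL_eq, hH', jetK, jetK, jetDisc, jetDisc, jetE_add_vertJet, jetF_add_vertJet,
    jetG_add_vertJet, jetl_add_vertJet, jetm_add_vertJet, jetn_add_vertJet]
  ring

/-! Behaviour under a change of parameters. -/

/-- The jet of a surface after a change of parameters with first order part `(a, b)`, `(c, d)`;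
the last six arguments are the second derivatives of the change of parameters. -/
def reparamJet (j : Jet) (a b c d k₁ k₂ k₃ k₄ k₅ k₆ : ℝ) : Jet :=
  (a • j.1 + b • j.2.1, c • j.1 + d • j.2.1,
    (a * a) • j.2.2.1 + (2 * a * b) • j.2.2.2.1 + (b * b) • j.2.2.2.2 + (k₁ • j.1 + k₂ • j.2.1),
    (a * c) • j.2.2.1 + (a * d + b * c) • j.2.2.2.1 + (b * d) • j.2.2.2.2 +
      (k₃ • j.1 + k₄ • j.2.1),
    (c * c) • j.2.2.1 + (2 * c * d) • j.2.2.2.1 + (d * d) • j.2.2.2.2 + (k₅ • j.1 + k₆ • j.2.1))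

section Reparam

variable (j : Jet) (a b c d k₁ k₂ k₃ k₄ k₅ k₆ : ℝ)

theorem jetE_reparam : jetE (reparamJet j a b c d k₁ k₂ k₃ k₄ k₅ k₆) =
    a ^ 2 * jetE j + 2 * a * b * jetF j + b ^ 2 * jetG j := by
  simp [jetE, jetF, jetG, reparamJet, mink]; ring

theorem jetF_reparam : jetF (reparamJet j a b c d k₁ k₂ k₃ k₄ k₅ k₆) =
    a * c * jetE j + (a * d + b * c) * jetF j + b * d * jetG j := by
  simp [jetE, jetF, jetG, reparamJet, mink]; ring

theorem jetG_reparam : jetG (reparamJet j a b c d k₁ k₂ k₃ k₄ k₅ k₆) =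
    c ^ 2 * jetE j + 2 * c * d * jetF j + d ^ 2 * jetG j := by
  simp [jetE, jetF, jetG, reparamJet, mink]; ring

/-- The terms with `k₁, k₂` are tangential and orthogonal to the normal; the outer factor is the
Jacobian by which the normal is rescaled. -/
theorem jetl_reparam : jetl (reparamJet j a b c d k₁ k₂ k₃ k₄ k₅ k₆) =
    (a * d - b * c) * (a ^ 2 * jetl j + 2 * a * b * jetm j + b ^ 2 * jetn j) := by
  simp [jetl, jetm, jetn, reparamJet, mink_cross]; ring

theorem jetm_reparam : jetm (reparamJet j a b c d k₁ k₂ k₃ k₄ k₅ k₆) =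
    (a * d - b * c) * (a * c * jetl j + (a * d + b * c) * jetm j + b * d * jetn j) := by
  simp [jetl, jetm, jetn, reparamJet, mink_cross]; ring

theorem jetn_reparam : jetn (reparamJet j a b c d k₁ k₂ k₃ k₄ k₅ k₆) =
    (a * d - b * c) * (c ^ 2 * jetl j + 2 * c * d * jetm j + d ^ 2 * jetn j) := by
  simp [jetl, jetm, jetn, reparamJet, mink_cross]; ring

theorem jetDisc_reparam : jetDisc (reparamJet j a b c d k₁ k₂ k₃ k₄ k₅ k₆) =
    (a * d - b * c) ^ 2 * jetDisc j := by
  rw [jetDisc, jetDisc, jetE_reparam, jetF_reparam, jetG_reparam]; ring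

theorem jetK_reparam : jetK (reparamJet j a b c d k₁ k₂ k₃ k₄ k₅ k₆) =
    (a * d - b * c) ^ 4 * jetK j := by
  rw [jetK, jetK, jetl_reparam, jetm_reparam, jetn_reparam]; ring

theorem jetH_reparam : jetH (reparamJet j a b c d k₁ k₂ k₃ k₄ k₅ k₆) =
    (a * d - b * c) ^ 3 * jetH j := by
  rw [jetH, jetH, jetE_reparam, jetF_reparam, jetG_reparam, jetl_reparam, jetm_reparam,
    jetn_reparam]; ring

theorem jetL_reparam : jetL (reparamJet j a b c d k₁ k₂ k₃ k₄ k₅ k₆) =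
    (a * d - b * c) ^ 6 * jetL j := by
  rw [jetL_eq, jetL_eq, jetDisc_reparam, jetK_reparam, jetH_reparam]; ring

end Reparam

/-- The Jacobian determinant. -/
noncomputable def jacobian (h : Plane → Plane) (q : Plane) : ℝ :=
  (fderiv ℝ h q (1, 0)).1 * (fderiv ℝ h q (0, 1)).2 -
    (fderiv ℝ h q (1, 0)).2 * (fderiv ℝ h q (0, 1)).1

theorem smoothNear_jacobian {h : Plane → Plane} {q : Plane} (hh : SmoothNear h q) :
    SmoothNear (jacobian h) q := by
  have h1 : ∀ v, SmoothNear (fun q => (fderiv ℝ h q v).1) q := fun v =>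
    (hh.fderiv_apply v).clm_comp (ContinuousLinearMap.fst ℝ ℝ ℝ)
  have h2 : ∀ v, SmoothNear (fun q => (fderiv ℝ h q v).2) q := fun v =>
    (hh.fderiv_apply v).clm_comp (ContinuousLinearMap.snd ℝ ℝ ℝ)
  exact ((h1 _).mul (h2 _)).sub ((h2 _).mul (h1 _))

theorem apply_plane {W : Type*} [NormedAddCommGroup W] [NormedSpace ℝ W] (T : Plane →L[ℝ] W)
    (p : Plane) : T p = p.1 • T (1, 0) + p.2 • T (0, 1) := by
  rw [← map_smul, ← map_smul, ← map_add]; simp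

theorem fderiv_fderiv_comp {x : Plane → Space} {h : Plane → Plane} {q : Plane}
    (hx : SmoothNear x (h q)) (hh : SmoothNear h q) (v w : Plane) :
    fderiv ℝ (fun z => fderiv ℝ (x ∘ h) z v) q w =
      fderiv ℝ (fderiv ℝ x) (h q) (fderiv ℝ h q w) (fderiv ℝ h q v) +
        fderiv ℝ x (h q) (fderiv ℝ (fun z => fderiv ℝ h z v) q w) := by
  have e : (fun z => fderiv ℝ (x ∘ h) z v) =ᶠ[𝓝 q]
      fun z => fderiv ℝ x (h z) (fderiv ℝ h z v) := by
    filter_upwards [hh.continuousAt.eventually hx, hh] with z h1 h2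
    rw [fderiv_comp z (h1.differentiableAt (by simp)) (h2.differentiableAt (by simp))]
    rfl
  have h1 : HasFDerivAt (fun z => fderiv ℝ x (h z))
      ((fderiv ℝ (fderiv ℝ x) (h q)).comp (fderiv ℝ h q)) q :=
    hx.fderiv.differentiableAt.hasFDerivAt.comp q hh.differentiableAt.hasFDerivAt
  rw [e.fderiv_eq, (h1.clm_apply (hh.fderiv_apply v).differentiableAt.hasFDerivAt).fderiv]
  simp [add_comm]

theorem fderiv_fderiv_apply {W : Type*} [NormedAddCommGroup W] [NormedSpace ℝ W]
    {V : Type*} [NormedAddCommGroup V] [NormedSpace ℝ V] {x : V → W} {z : V}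
    (hx : SmoothNear x z) (v w : V) :
    fderiv ℝ (fun y => fderiv ℝ x y v) z w = fderiv ℝ (fderiv ℝ x) z w v := by
  rw [fderiv_clm_apply hx.fderiv.differentiableAt (differentiableAt_const _)]
  simp

theorem fderiv_fderiv_symm {W : Type*} [NormedAddCommGroup W] [NormedSpace ℝ W]
    {V : Type*} [NormedAddCommGroup V] [NormedSpace ℝ V] {x : V → W} {z : V}
    (hx : SmoothNear x z) (v w : V) :
    fderiv ℝ (fderiv ℝ x) z w v = fderiv ℝ (fderiv ℝ x) z v w :=
  (hx.contDiffAt.isSymmSndFDerivAt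
    (by rw [minSmoothness_of_isRCLikeNormedField]; exact WithTop.coe_le_coe.2 le_top)) w v

theorem planeJet_comp {x : Plane → Space} {h : Plane → Plane} {q : Plane}
    (hx : SmoothNear x (h q)) (hh : SmoothNear h q) :
    ∃ k₁ k₂ k₃ k₄ k₅ k₆ : ℝ, planeJet (x ∘ h) q = reparamJet (planeJet x (h q))
      (fderiv ℝ h q (1, 0)).1 (fderiv ℝ h q (1, 0)).2 (fderiv ℝ h q (0, 1)).1
      (fderiv ℝ h q (0, 1)).2 k₁ k₂ k₃ k₄ k₅ k₆ := by
  set a := fderiv ℝ h q (1, 0) with ha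
  set b := fderiv ℝ h q (0, 1) with hb
  have hfirst : ∀ v, fderiv ℝ (x ∘ h) q v = (fderiv ℝ h q v).1 • fderiv ℝ x (h q) (1, 0) +
      (fderiv ℝ h q v).2 • fderiv ℝ x (h q) (0, 1) := by
    intro v
    rw [fderiv_comp q hx.differentiableAt hh.differentiableAt, ContinuousLinearMap.comp_apply,
      apply_plane]
  have hD : ∀ p r : Plane, fderiv ℝ (fderiv ℝ x) (h q) p r =
      (p.1 * r.1) • fderiv ℝ (fun z => fderiv ℝ x z (1, 0)) (h q) (1, 0) +
      (p.1 * r.2 + p.2 * r.1) • fderiv ℝ (fun z => fderiv ℝ x z (1, 0)) (h q) (0, 1) +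
      (p.2 * r.2) • fderiv ℝ (fun z => fderiv ℝ x z (0, 1)) (h q) (0, 1) := by
    intro p r
    rw [fderiv_fderiv_apply hx, fderiv_fderiv_apply hx, fderiv_fderiv_apply hx,
      apply_plane (fderiv ℝ (fderiv ℝ x) (h q)) p]
    simp only [add_apply, smul_apply]
    rw [apply_plane (fderiv ℝ (fderiv ℝ x) (h q) (1, 0)) r,
      apply_plane (fderiv ℝ (fderiv ℝ x) (h q) (0, 1)) r,
      fderiv_fderiv_symm hx (0, 1) (1, 0)]
    module
  refine ⟨(fderiv ℝ (fun z => fderiv ℝ h z (1, 0)) q (1, 0)).1,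
    (fderiv ℝ (fun z => fderiv ℝ h z (1, 0)) q (1, 0)).2,
    (fderiv ℝ (fun z => fderiv ℝ h z (1, 0)) q (0, 1)).1,
    (fderiv ℝ (fun z => fderiv ℝ h z (1, 0)) q (0, 1)).2,
    (fderiv ℝ (fun z => fderiv ℝ h z (0, 1)) q (0, 1)).1,
    (fderiv ℝ (fun z => fderiv ℝ h z (0, 1)) q (0, 1)).2, ?_⟩
  unfold planeJet jetOf reparamJet
  simp only [fderiv_fderiv_comp hx hh, hfirst]
  rw [← ha, ← hb]
  refine Prod.ext rfl (Prod.ext rfl (Prod.ext ?_ (Prod.ext ?_ ?_))) <;>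
  · simp only
    rw [hD, apply_plane (fderiv ℝ x (h q))]
    module

/-- How the invariants of a surface change under a change of parameters. -/
theorem invariants_comp {x y : Plane → Space} {h : Plane → Plane} (hx : SmoothNear x (h 0))
    (hh : SmoothNear h 0) (hy : y =ᶠ[𝓝 0] x ∘ h) :
    ∀ᶠ q in 𝓝 (0 : Plane), metricDisc y q = jacobian h q ^ 2 * metricDisc x (h q) ∧
      Kbar y q = jacobian h q ^ 4 * Kbar x (h q) ∧ Hbar y q = jacobian h q ^ 3 * Hbar x (h q) ∧
      lplDisc y q = jacobian h q ^ 6 * lplDisc x (h q) := by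
  filter_upwards [jetOf_congr (1, 0) (0, 1) hy, hh.eventually,
    hh.continuousAt.eventually hx.eventually] with q h1 h2 h3
  obtain ⟨k₁, k₂, k₃, k₄, k₅, k₆, hk⟩ := planeJet_comp h3 h2
  have h4 := h1.trans hk
  simp only [metricDisc_eq, Kbar_eq, Hbar_eq, lplDisc_eq]
  rw [show planeJet y q = _ from h4, jetDisc_reparam, jetK_reparam, jetH_reparam, jetL_reparam]
  exact ⟨rfl, rfl, rfl, rfl⟩

/-! Families of surfaces. -/

theorem fderiv_slice {W : Type*} [NormedAddCommGroup W] [NormedSpace ℝ W] {X : ℝ × Plane → W}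
    {t : ℝ} {q : Plane} (hX : DifferentiableAt ℝ X (t, q)) (v : Plane) :
    fderiv ℝ (fun q => X (t, q)) q v = fderiv ℝ X (t, q) (0, v) := by
  have h := hX.hasFDerivAt.comp q (hasFDerivAt_prodMk_right (𝕜 := ℝ) t q)
  exact congrArg (fun T : Plane →L[ℝ] W => T v) h.fderiv

theorem fderiv_fderiv_slice {W : Type*} [NormedAddCommGroup W] [NormedSpace ℝ W]
    {X : ℝ × Plane → W} {t : ℝ} {q : Plane} (hX : SmoothNear X (t, q)) (v w : Plane) :
    fderiv ℝ (fun z => fderiv ℝ (fun q => X (t, q)) z v) q w =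
      fderiv ℝ (fun z => fderiv ℝ X z (0, v)) (t, q) (0, w) := by
  have hc : Tendsto (fun q : Plane => (t, q)) (𝓝 q) (𝓝 (t, q)) :=
    (Continuous.prodMk_right t).tendsto q
  have e : (fun z => fderiv ℝ (fun q => X (t, q)) z v) =ᶠ[𝓝 q]
      fun z => fderiv ℝ X (t, z) (0, v) := by
    filter_upwards [hc.eventually hX] with z hz
    exact fderiv_slice (hz.differentiableAt (by simp)) v
  rw [e.fderiv_eq]
  exact fderiv_slice (X := fun y => fderiv ℝ X y (0, v)) (hX.fderiv_apply _).differentiableAt w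

noncomputable abbrev familyJet (X : ℝ × Plane → Space) : ℝ × Plane → Jet :=
  jetOf ((0, (1, 0)) : ℝ × Plane) (0, (0, 1)) X

theorem planeJet_slice {X : ℝ × Plane → Space} {t : ℝ} {q : Plane} (hX : SmoothNear X (t, q)) :
    planeJet (fun q => X (t, q)) q = familyJet X (t, q) := by
  unfold planeJet familyJet jetOf
  simp only [fderiv_fderiv_slice hX, fderiv_slice hX.differentiableAt]

/-! ### Continuous dependence of jets, and the Whitney topologies. -/

section JetContinuous

variable {X : Type*} [TopologicalSpace X]
  {U V W Z : Type*} [NormedAddCommGroup U] [NormedSpace ℝ U] [NormedAddCommGroup V]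
  [NormedSpace ℝ V]
  [NormedAddCommGroup W] [NormedSpace ℝ W] [NormedAddCommGroup Z] [NormedSpace ℝ Z]

/-- A family of smooth germs at the origin whose jets depend continuously on the parameter. -/
def JetContinuous (F : X → V → W) : Prop :=
  (∀ x, SmoothNear (F x) 0) ∧ ∀ k, Continuous fun x => iteratedFDeriv ℝ k (F x) 0

namespace JetContinuous

theorem continuous_eval {F : X → V → W} (hF : JetContinuous F) : Continuous fun x => F x 0 := by
  have h := (ContinuousMultilinearMap.apply ℝ (fun _ : Fin 0 => V) W 0).continuous.comp (hF.2 0)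
  exact h.congr fun x => by simp [iteratedFDeriv_zero_apply]

theorem fderiv {F : X → V → W} (hF : JetContinuous F) :
    JetContinuous fun x => fderiv ℝ (F x) := by
  refine ⟨fun x => (hF.1 x).fderiv, fun k => ?_⟩
  have h := (continuousMultilinearCurryRightEquiv' ℝ k V W).continuous.comp (hF.2 (k + 1))
  refine h.congr fun x => ?_
  simp only [Function.comp_apply, iteratedFDeriv_succ_eq_comp_right,
    LinearIsometryEquiv.apply_symm_apply]

theorem clm_comp {F : X → V → W} (hF : JetContinuous F) (T : W →L[ℝ] Z) :
    JetContinuous fun x y => T (F x y) := by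
  refine ⟨fun x => (hF.1 x).clm_comp T, fun k => ?_⟩
  have h := (ContinuousLinearMap.compContinuousMultilinearMapL ℝ (fun _ : Fin k => V) W Z
    T).continuous.comp (hF.2 k)
  refine h.congr fun x => ?_
  exact (T.iteratedFDeriv_comp_left (hF.1 x).contDiffAt (WithTop.coe_le_coe.2 le_top)).symm

theorem fderiv_apply {F : X → V → W} (hF : JetContinuous F) (v : V) :
    JetContinuous fun x y => _root_.fderiv ℝ (F x) y v :=
  hF.fderiv.clm_comp (ContinuousLinearMap.apply ℝ W v)

theorem add {F G : X → V → W} (hF : JetContinuous F) (hG : JetContinuous G) :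
    JetContinuous fun x y => F x y + G x y := by
  refine ⟨fun x => (hF.1 x).add (hG.1 x), fun k => ?_⟩
  refine ((hF.2 k).add (hG.2 k)).congr fun x => ?_
  exact (iteratedFDeriv_add_apply ((hF.1 x).contDiffAt.of_le (WithTop.coe_le_coe.2 le_top))
    ((hG.1 x).contDiffAt.of_le (WithTop.coe_le_coe.2 le_top))).symm

theorem const {f : V → W} (hf : SmoothNear f 0) : JetContinuous fun _ : X => f :=
  ⟨fun _ => hf, fun _ => continuous_const⟩

theorem smul_const {c : X → ℝ} (hc : Continuous c) {f : V → W} (hf : SmoothNear f 0) :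
    JetContinuous fun x y => c x • f y := by
  refine ⟨fun x => (smoothNear_const (c x) 0).smul hf, fun k => ?_⟩
  refine (hc.smul (continuous_const (y := iteratedFDeriv ℝ k f 0))).congr fun x => ?_
  exact (iteratedFDeriv_const_smul_apply
    (hf.contDiffAt.of_le (WithTop.coe_le_coe.2 le_top))).symm

theorem prodMk {F : X → V → W} {G : X → V → Z} (hF : JetContinuous F) (hG : JetContinuous G) :
    JetContinuous fun x y => (F x y, G x y) := by
  have h := (hF.clm_comp (ContinuousLinearMap.inl ℝ W Z)).add
    (hG.clm_comp (ContinuousLinearMap.inr ℝ W Z))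
  simpa using h

/-- By the formula of Faà di Bruno, each coefficient of a composition is a finite sum of multilinear
expressions in the coefficients of the two factors. -/
theorem continuous_taylorComp {q : X → FormalMultilinearSeries ℝ W Z}
    {p : X → FormalMultilinearSeries ℝ V W} (hq : ∀ k, Continuous fun x => q x k)
    (hp : ∀ k, Continuous fun x => p x k) (k : ℕ) :
    Continuous fun x => (q x).taylorComp (p x) k := by
  refine continuous_finsetSum _ fun c _ => ?_
  have hB : Continuous (fun z : (W [×c.length]→L[ℝ] Z) × (∀ i, V [×c.partSize i]→L[ℝ] W) =>
      c.compAlongOrderedFinpartitionL ℝ V W Z z.1 z.2) :=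
    continuousOn_univ.1 (ContinuousLinearMap.analyticOnNhd_uncurry_of_multilinear
      (c.compAlongOrderedFinpartitionL ℝ V W Z) (s := Set.univ)).continuousOn
  exact hB.comp ((hq _).prodMk (continuous_pi fun i => hp _))

theorem comp_left {F : X → V → W} (hF : JetContinuous F) {p : W → Z} (hp : ContDiff ℝ ∞ p) :
    JetContinuous fun x y => p (F x y) := by
  refine ⟨fun x => (smoothNear_of_contDiff hp _).comp_of_eq (hF.1 x) rfl, fun k => ?_⟩
  have h : Continuous fun x =>
      (ftaylorSeries ℝ p (F x 0)).taylorComp (ftaylorSeries ℝ (F x) 0) k := by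
    refine continuous_taylorComp (fun k => ?_) hF.2 k
    exact (hp.continuous_iteratedFDeriv (WithTop.coe_le_coe.2 le_top)).comp hF.continuous_eval
  refine h.congr fun x => ?_
  exact (iteratedFDeriv_comp hp.contDiffAt (hF.1 x).contDiffAt (WithTop.coe_le_coe.2 le_top)).symm

theorem comp_right {F : X → V → W} (hF : JetContinuous F) {h : U → V} (hh : SmoothNear h 0)
    (h0 : h 0 = 0) : JetContinuous fun x y => F x (h y) := by
  refine ⟨fun x => (hF.1 x).comp_of_eq hh h0, fun k => ?_⟩
  have hc : Continuous fun x =>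
      (ftaylorSeries ℝ (F x) 0).taylorComp (ftaylorSeries ℝ h 0) k :=
    continuous_taylorComp hF.2 (fun _ => continuous_const) k
  refine hc.congr fun x => ?_
  have hx : ContDiffAt ℝ ∞ (F x) (h 0) := by rw [h0]; exact (hF.1 x).contDiffAt
  have := iteratedFDeriv_comp hx hh.contDiffAt (i := k) (WithTop.coe_le_coe.2 le_top)
  rw [h0] at this
  exact this.symm

theorem jetOf {F : X → V → Space} (hF : JetContinuous F) (a b : V) :
    JetContinuous fun x => MinkowskiSurface.jetOf a b (F x) :=
  (hF.fderiv_apply a).prodMk ((hF.fderiv_apply b).prodMk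
    (((hF.fderiv_apply a).fderiv_apply a).prodMk (((hF.fderiv_apply a).fderiv_apply b).prodMk
      ((hF.fderiv_apply b).fderiv_apply b))))

end JetContinuous

end JetContinuous

theorem jetContinuous_localParam : JetContinuous fun x : LocalParam => x.toFun :=
  ⟨fun x => x.smooth, fun _ => continuous_iInf_dom continuous_induced_dom⟩

theorem jetContinuous_deformation (x : LocalParam) (E : Submodule ℝ Space) :
    JetContinuous fun D : Deformation x E => D.h :=
  ⟨fun D => D.smooth, fun _ => continuous_iInf_dom continuous_induced_dom⟩

theorem continuous_localParam {X : Type*} [TopologicalSpace X] {F : X → LocalParam}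
    (hF : JetContinuous fun x => (F x).toFun) : Continuous F :=
  continuous_iInf_rng.2 fun k => continuous_induced_rng.2 (hF.2 k)

theorem continuous_toDeformation {X : Type*} [TopologicalSpace X] {x : LocalParam}
    {E : Submodule ℝ Space} {F : X → Deformation x E} (hF : JetContinuous fun z => (F z).h) :
    Continuous F :=
  continuous_iInf_rng.2 fun k => continuous_induced_rng.2 (hF.2 k)

/-! Linear algebra in the parameter plane. -/

/-- A functional on the plane that kills `v` is a multiple of `p ↦ det (v, p)`. It is used with the
tangent vector of the LPL to get `dH = lam dL`. -/
theorem exists_smul_eq_of_apply_eq_zero {T₁ T₂ : Plane →L[ℝ] ℝ} {v : Plane} (hv : v ≠ 0)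
    (h₁ : T₁ v = 0) (h₂ : T₂ v = 0) (hT : T₂ ≠ 0) : ∃ lam : ℝ, T₁ = lam • T₂ := by
  have key : ∀ T : Plane →L[ℝ] ℝ, T v = 0 → ∀ p : Plane, (v.1 ^ 2 + v.2 ^ 2) * T p =
      (v.1 * T (0, 1) - v.2 * T (1, 0)) * (v.1 * p.2 - v.2 * p.1) := by
    intro T hT p
    rw [apply_plane] at hT
    rw [apply_plane T p]
    simp only [smul_eq_mul] at hT ⊢
    linear_combination (v.1 * p.1 + v.2 * p.2) * hT
  have hN : v.1 ^ 2 + v.2 ^ 2 ≠ 0 := by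
    intro h
    have e1 : v.1 = 0 := by nlinarith [sq_nonneg v.1, sq_nonneg v.2]
    have e2 : v.2 = 0 := by nlinarith [sq_nonneg v.1, sq_nonneg v.2]
    exact hv (Prod.ext e1 e2)
  set μ₁ := v.1 * T₁ (0, 1) - v.2 * T₁ (1, 0) with hμ₁
  set μ₂ := v.1 * T₂ (0, 1) - v.2 * T₂ (1, 0) with hμ₂
  have hμ : μ₂ ≠ 0 := by
    intro h
    apply hT
    ext <;>
    · have := key T₂ h₂
      rw [← hμ₂, h] at this
      simpa [hN] using this _
  refine ⟨μ₁ / μ₂, ContinuousLinearMap.ext fun p => ?_⟩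
  have k1 := key T₁ h₁ p
  have k2 := key T₂ h₂ p
  rw [← hμ₁] at k1
  rw [← hμ₂] at k2
  rw [smul_apply, smul_eq_mul]
  field_simp
  apply mul_left_cancel₀ hN
  linear_combination μ₂ * k1 - μ₁ * k2

theorem exists_smul_eq_of_kernel {T : Plane →L[ℝ] ℝ} (hT : T ≠ 0) {v w : Plane} (hv : v ≠ 0)
    (hw : w ≠ 0) (h₁ : T v = 0) (h₂ : T w = 0) : ∃ μ : ℝ, μ ≠ 0 ∧ v = μ • w := by
  rw [apply_plane] at h₁ h₂
  simp only [smul_eq_mul] at h₁ h₂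
  have hdet : v.1 * w.2 - v.2 * w.1 = 0 := by
    by_contra hne
    apply hT
    have e1 : T (1, 0) = 0 := by
      have : (v.1 * w.2 - v.2 * w.1) * T (1, 0) = 0 := by linear_combination w.2 * h₁ - v.2 * h₂
      exact (mul_eq_zero.1 this).resolve_left hne
    have e2 : T (0, 1) = 0 := by
      have : (v.1 * w.2 - v.2 * w.1) * T (0, 1) = 0 := by linear_combination v.1 * h₂ - w.1 * h₁
      exact (mul_eq_zero.1 this).resolve_left hne
    refine ContinuousLinearMap.ext fun p => ?_
    rw [apply_plane, e1, e2]; simp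
  have hN : w.1 ^ 2 + w.2 ^ 2 ≠ 0 := by
    intro h
    have e1 : w.1 = 0 := by nlinarith [sq_nonneg w.1, sq_nonneg w.2]
    have e2 : w.2 = 0 := by nlinarith [sq_nonneg w.1, sq_nonneg w.2]
    exact hw (Prod.ext e1 e2)
  have hvw : v = ((v.1 * w.1 + v.2 * w.2) / (w.1 ^ 2 + w.2 ^ 2)) • w := by
    refine Prod.ext ?_ ?_
    · simp only [Prod.smul_fst, smul_eq_mul]
      field_simp
      linear_combination w.2 * hdet
    · simp only [Prod.smul_snd, smul_eq_mul]
      field_simp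
      linear_combination -w.1 * hdet
  refine ⟨_, ?_, hvw⟩
  intro h
  rw [h, zero_smul] at hvw
  exact hv hvw

theorem fderiv_fderiv_smul {Z : Plane → ℝ} {q : Plane} (hZ : SmoothNear Z q) (μ : ℝ) (v : Plane) :
    fderiv ℝ (fun y => fderiv ℝ Z y (μ • v)) q (μ • v) =
      μ ^ 2 * fderiv ℝ (fun y => fderiv ℝ Z y v) q v := by
  rw [fderiv_fderiv_apply hZ, fderiv_fderiv_apply hZ]
  simp only [map_smul, smul_apply, smul_eq_mul]
  ring

/-! Points of the LPL at which the LPL, the PC and the MCNC are tangent. -/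

/-- The origin is a regular point of the LPL in the Lorentzian region, it is on the MCNC, and
`dH = lam dL` there. -/
structure TangentLPL (f : Plane → Space) (lam : ℝ) : Prop where
  pos : 0 < metricDisc f 0
  L_zero : lplDisc f 0 = 0
  dL_ne : fderiv ℝ (lplDisc f) 0 ≠ 0
  H_zero : Hbar f 0 = 0
  dH_eq : fderiv ℝ (Hbar f) 0 = lam • fderiv ℝ (lplDisc f) 0

/-- Nondegenerate tangency; the sign of `lam` times the second derivative of `H ∘ γ`
determines the configuration. -/
def NondegenerateLPL (c : Configuration) (f : Plane → Space) : Prop :=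
  ∃ (lam : ℝ) (γ : ℝ → Plane), TangentLPL f lam ∧ IsRegularArc (lplDisc f) γ ∧
    c.sign * lam * deriv (deriv (fun s => Hbar f (γ s))) 0 < 0

/-- The arc is the `s`-axis of the straightening coordinates of the constant family; its velocity is
nonzero because `S` maps it to 1. -/
theorem exists_regularArc {φ : Plane → ℝ} (hφ : SmoothNear φ 0) (h0 : φ 0 = 0)
    (hd : fderiv ℝ φ 0 ≠ 0) : ∃ γ, IsRegularArc φ γ := by
  have hs : SmoothNear (fun y : ℝ × Plane => φ y.2) 0 :=
    hφ.comp_of_eq (smoothNear_of_contDiff contDiff_snd 0) rfl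
  have hfd : ∀ v : Plane, fderiv ℝ (fun y : ℝ × Plane => φ y.2) 0 (0, v) = fderiv ℝ φ 0 v := by
    intro v
    have h1 : HasFDerivAt (fun y : ℝ × Plane => φ y.2)
        ((fderiv ℝ φ 0).comp (ContinuousLinearMap.snd ℝ ℝ Plane)) 0 :=
      HasFDerivAt.comp (0 : ℝ × Plane) (g := φ) hφ.differentiableAt.hasFDerivAt hasFDerivAt_snd
    rw [h1.fderiv]; rfl
  obtain ⟨v, hv⟩ : ∃ v, fderiv ℝ φ 0 v ≠ 0 := by
    by_contra! h
    exact hd (ContinuousLinearMap.ext h)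
  obtain ⟨Φ, S, hΦ, Φ0, hLΦ, hSΦ, -⟩ := exists_straightening hs h0 ⟨v, by rwa [hfd]⟩
  have hι : SmoothNear (fun s : ℝ => ((0, (s, 0)) : ℝ × Plane)) 0 :=
    smoothNear_of_contDiff (by fun_prop) 0
  have tι : Tendsto (fun s : ℝ => ((0, (s, 0)) : ℝ × Plane)) (𝓝 0) (𝓝 0) := hι.continuousAt
  have hγ : SmoothNear (fun s : ℝ => Φ (0, (s, 0))) 0 := hΦ.comp_of_eq hι rfl
  refine ⟨fun s => Φ (0, (s, 0)), hγ, Φ0, ?_, (tι.eventually hLΦ).mono fun s hs => hs⟩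
  intro h
  have h1 : HasDerivAt (fun s : ℝ => S (Φ (0, (s, 0)))) (S (deriv (fun s : ℝ => Φ (0, (s, 0))) 0)) 0 :=
    S.hasFDerivAt.comp_hasDerivAt 0 hγ.differentiableAt.hasDerivAt
  have h2 : (fun s : ℝ => S (Φ (0, (s, 0)))) =ᶠ[𝓝 0] fun s => s :=
    (tι.eventually hSΦ).mono fun s hs => hs
  have h3 := h2.deriv_eq
  rw [h1.deriv, h, map_zero, deriv_id''] at h3
  exact zero_ne_one h3

namespace IsRegularArc

variable {φ ψ : Plane → ℝ} {γ : ℝ → Plane}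

theorem smooth_comp (hγ : IsRegularArc φ γ) (hψ : SmoothNear ψ 0) :
    SmoothNear (fun s => ψ (γ s)) 0 :=
  hψ.comp_of_eq hγ.1 hγ.2.1

theorem deriv_comp (hγ : IsRegularArc φ γ) (hψ : SmoothNear ψ 0) :
    deriv (fun s => ψ (γ s)) 0 = fderiv ℝ ψ 0 (deriv γ 0) := by
  have h1 : HasFDerivAt ψ (fderiv ℝ ψ 0) (γ 0) := by
    rw [hγ.2.1]; exact hψ.differentiableAt.hasFDerivAt
  exact (h1.comp_hasDerivAt 0 hγ.1.differentiableAt.hasDerivAt).deriv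

theorem fderiv_eq_zero (hγ : IsRegularArc φ γ) (hφ : SmoothNear φ 0) :
    fderiv ℝ φ 0 (deriv γ 0) = 0 := by
  rw [← hγ.deriv_comp hφ]
  have h : (fun s => φ (γ s)) =ᶠ[𝓝 0] fun _ => 0 := hγ.2.2.2
  rw [h.deriv_eq, deriv_const]

end IsRegularArc

namespace TangentLPL

variable {f : Plane → Space} {lam : ℝ} {γ : ℝ → Plane}

theorem K_zero (h : TangentLPL f lam) : Kbar f 0 = 0 := by
  have h1 := lplDisc_eq_sq_add f 0
  rw [h.L_zero, h.H_zero] at h1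
  have h2 : metricDisc f 0 * Kbar f 0 = 0 := by linarith
  exact (mul_eq_zero.1 h2).resolve_left h.pos.ne'

/-- Where `H = K = 0`, the fundamental identity gives `dL = 4 δ dK`. -/
theorem dK_ne (h : TangentLPL f lam) (hf : SmoothNear f 0) : fderiv ℝ (Kbar f) 0 ≠ 0 := by
  intro hK
  apply h.dL_ne
  have e : lplDisc f = fun q => Hbar f q ^ 2 + 4 * metricDisc f q * Kbar f q :=
    funext (lplDisc_eq_sq_add f)
  have d1 := (smoothNear_Hbar hf).differentiableAt.hasFDerivAt
  have d2 := (smoothNear_metricDisc hf).differentiableAt.hasFDerivAt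
  have d3 := (smoothNear_Kbar hf).differentiableAt.hasFDerivAt
  have d4 : HasFDerivAt (fun q => Hbar f q ^ 2 + 4 * metricDisc f q * Kbar f q) _ 0 :=
    (d1.pow 2).add ((d2.const_mul 4).mul d3)
  rw [e, d4.fderiv, h.H_zero, h.K_zero, hK]
  simp

theorem deriv_H_arc (h : TangentLPL f lam) (hf : SmoothNear f 0)
    (hγ : IsRegularArc (lplDisc f) γ) : deriv (fun s => Hbar f (γ s)) 0 = 0 := by
  rw [hγ.deriv_comp (smoothNear_Hbar hf), h.dH_eq, smul_apply,
    hγ.fderiv_eq_zero (smoothNear_lplDisc hf), smul_zero]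

theorem smooth_diff (hf : SmoothNear f 0) (lam : ℝ) :
    SmoothNear (fun q => Hbar f q - lam * lplDisc f q) 0 :=
  (smoothNear_Hbar hf).sub ((smoothNear_const lam 0).mul (smoothNear_lplDisc hf))

/-- On the LPL, `H` agrees with `H - lam L`, which is critical at the origin. -/
theorem deriv_deriv_H_arc (h : TangentLPL f lam) (hf : SmoothNear f 0)
    (hγ : IsRegularArc (lplDisc f) γ) : deriv (deriv (fun s => Hbar f (γ s))) 0 =
      fderiv ℝ (fun y => fderiv ℝ (fun q => Hbar f q - lam * lplDisc f q) y (deriv γ 0)) 0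
        (deriv γ 0) := by
  have hZ := smooth_diff hf lam
  have hdZ : fderiv ℝ (fun q => Hbar f q - lam * lplDisc f q) 0 = 0 := by
    have d : HasFDerivAt (fun q => Hbar f q - lam * lplDisc f q) _ 0 :=
      (smoothNear_Hbar hf).differentiableAt.hasFDerivAt.sub
        ((smoothNear_lplDisc hf).differentiableAt.hasFDerivAt.const_mul lam)
    rw [d.fderiv, h.dH_eq, sub_self]
  have key := deriv_deriv_comp_of_fderiv_eq_zero (Z := fun q => Hbar f q - lam * lplDisc f q)
    (γ := γ) (s := 0) (by rwa [hγ.2.1]) hγ.1 (by rwa [hγ.2.1])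
  rw [hγ.2.1] at key
  rw [← key]
  have e : (fun s => Hbar f (γ s)) =ᶠ[𝓝 0] fun s => Hbar f (γ s) - lam * lplDisc f (γ s) := by
    filter_upwards [hγ.2.2.2] with s hs
    rw [hs, mul_zero, sub_zero]
  exact e.deriv.deriv_eq

/-- On the LPL, `K` is a negative multiple of `H²`. -/
theorem K_arc (h : TangentLPL f lam) (hf : SmoothNear f 0) (hγ : IsRegularArc (lplDisc f) γ) :
    ∃ a : ℝ → ℝ, SmoothNear a 0 ∧ a 0 ≠ 0 ∧ (Kbar f ∘ γ) =ᶠ[𝓝 0]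
      a * ((fun s => Hbar f (γ s)) * fun s => Hbar f (γ s)) := by
  have hδ := hγ.smooth_comp (smoothNear_metricDisc hf)
  have hpos : ∀ᶠ s in 𝓝 (0 : ℝ), 0 < metricDisc f (γ s) :=
    hδ.continuousAt.eventually (lt_mem_nhds (by simpa only [hγ.2.1] using h.pos))
  refine ⟨fun s => (-4 * metricDisc f (γ s))⁻¹, ?_, ?_, ?_⟩
  · filter_upwards [Filter.Eventually.and ((smoothNear_const (-4) 0).mul hδ) hpos] with s hs
    exact hs.1.inv (by linarith [hs.2])
  · simp only [hγ.2.1]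
    exact inv_ne_zero (by linarith [h.pos])
  · filter_upwards [hγ.2.2.2, hpos] with s hs hp
    have := lplDisc_eq_sq_add f (γ s)
    rw [hs] at this
    simp only [Function.comp_apply, Pi.mul_apply]
    field_simp
    linarith

end TangentLPL

/-! Orders of contact. -/

/-- The order is a supremum over all regular arcs: one arc suffices for the lower bound, but the
upper bound needs every arc. -/
theorem contactOrder_eq {φ ψ : Plane → ℝ} {k : ℕ}
    (h1 : ∃ γ, IsRegularArc φ γ ∧ ∀ j < k, iteratedDeriv j (ψ ∘ γ) 0 = 0)
    (h2 : ∀ γ, IsRegularArc φ γ → iteratedDeriv k (ψ ∘ γ) 0 ≠ 0) : contactOrder φ ψ = k := by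
  apply le_antisymm
  · refine iSup₂_le fun k' hk' => ?_
    obtain ⟨γ, hγ, hj⟩ := hk'
    by_contra hn
    exact h2 γ hγ (hj k (by exact_mod_cast not_le.1 hn))
  · exact le_iSup₂ (f := fun (k : ℕ) (_ : k ∈ {k : ℕ | ∃ γ : ℝ → Plane, IsRegularArc φ γ ∧
      ∀ j < k, iteratedDeriv j (ψ ∘ γ) 0 = 0}) => (k : ℕ∞)) k h1

theorem lt_contactOrder {φ ψ : Plane → ℝ} {k : ℕ} (h : (k : ℕ∞) < contactOrder φ ψ) :
    ∃ γ, IsRegularArc φ γ ∧ ∀ j ≤ k, iteratedDeriv j (ψ ∘ γ) 0 = 0 := by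
  obtain ⟨k', hk'⟩ := lt_iSup_iff.1 h
  obtain ⟨⟨γ, hγ, hj⟩, hk⟩ := lt_iSup_iff.1 hk'
  exact ⟨γ, hγ, fun j hjk => hj j (hjk.trans_lt (by exact_mod_cast hk))⟩

theorem iteratedDeriv_two (g : ℝ → ℝ) : iteratedDeriv 2 g = deriv (deriv g) := by
  rw [iteratedDeriv_succ, iteratedDeriv_one]

theorem iteratedDeriv_mul_smooth {f g : ℝ → ℝ} (hf : SmoothNear f 0) (hg : SmoothNear g 0)
    (n : ℕ) : iteratedDeriv n (f * g) 0 =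
      ∑ i ∈ Finset.range (n + 1), (n.choose i) * iteratedDeriv i f 0 * iteratedDeriv (n - i) g 0 :=
  iteratedDeriv_mul (hf.contDiffAt.of_le (WithTop.coe_le_coe.2 le_top))
    (hg.contDiffAt.of_le (WithTop.coe_le_coe.2 le_top))

/-- Leibniz' rule: `g²` starts at order 4, with fourth derivative `C(4, 2) (g'')²`. This is how
contact of order 2 with the MCNC becomes contact of order 4 with the PC. -/
theorem iteratedDeriv_mul_sq {a g : ℝ → ℝ} (ha : SmoothNear a 0) (hg : SmoothNear g 0)
    (g0 : g 0 = 0) (g1 : deriv g 0 = 0) :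
    (∀ j < 4, iteratedDeriv j (a * (g * g)) 0 = 0) ∧
      iteratedDeriv 4 (a * (g * g)) 0 = 6 * a 0 * deriv (deriv g) 0 ^ 2 := by
  have i0 : iteratedDeriv 0 g 0 = 0 := by rw [iteratedDeriv_zero, g0]
  have i1 : iteratedDeriv 1 g 0 = 0 := by rw [iteratedDeriv_one, g1]
  have hgg : SmoothNear (g * g) 0 := hg.mul hg
  have s0 : iteratedDeriv 0 (g * g) 0 = 0 := by
    rw [iteratedDeriv_mul_smooth hg hg]; simp [g0]
  have s1 : iteratedDeriv 1 (g * g) 0 = 0 := by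
    rw [iteratedDeriv_mul_smooth hg hg]; simp [Finset.sum_range_succ, g0]
  have s2 : iteratedDeriv 2 (g * g) 0 = 0 := by
    rw [iteratedDeriv_mul_smooth hg hg]; simp [Finset.sum_range_succ, g0, i1]
  have s3 : iteratedDeriv 3 (g * g) 0 = 0 := by
    rw [iteratedDeriv_mul_smooth hg hg]; simp [Finset.sum_range_succ, g0, i1]
  have s4 : iteratedDeriv 4 (g * g) 0 = 6 * deriv (deriv g) 0 ^ 2 := by
    rw [iteratedDeriv_mul_smooth hg hg]
    simp only [Finset.sum_range_succ, Finset.sum_range_zero, i0, i1, iteratedDeriv_two,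
      show Nat.choose 4 2 = 6 from rfl]
    norm_num [i0, i1, iteratedDeriv_two]
    ring
  refine ⟨fun j hj => ?_, ?_⟩
  · rw [iteratedDeriv_mul_smooth ha hgg]
    refine Finset.sum_eq_zero fun i _ => ?_
    have : j - i < 4 := by omega
    have : iteratedDeriv (j - i) (g * g) 0 = 0 := by
      generalize j - i = m at this
      interval_cases m <;> assumption
    rw [this, mul_zero]
  · rw [iteratedDeriv_mul_smooth ha hgg, Finset.sum_eq_single 0]
    · rw [Nat.sub_zero, s4, iteratedDeriv_zero]; simp; ring
    · intro i _ hi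
      have : 4 - i < 4 := by omega
      have : iteratedDeriv (4 - i) (g * g) 0 = 0 := by
        generalize 4 - i = m at this
        interval_cases m <;> assumption
      rw [this, mul_zero]
    · simp

namespace TangentLPL

variable {f : Plane → Space} {lam : ℝ} {γ : ℝ → Plane}

theorem iteratedDeriv_K_arc (h : TangentLPL f lam) (hf : SmoothNear f 0)
    (hγ : IsRegularArc (lplDisc f) γ) :
    (∀ j < 4, iteratedDeriv j (Kbar f ∘ γ) 0 = 0) ∧
      (deriv (deriv (fun s => Hbar f (γ s))) 0 ≠ 0 → iteratedDeriv 4 (Kbar f ∘ γ) 0 ≠ 0) := by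
  obtain ⟨a, ha, ha0, hK⟩ := h.K_arc hf hγ
  obtain ⟨k1, k2⟩ := iteratedDeriv_mul_sq ha (hγ.smooth_comp (smoothNear_Hbar hf))
    (by rw [hγ.2.1, h.H_zero]) (h.deriv_H_arc hf hγ)
  refine ⟨fun j hj => (hK.iteratedDeriv_eq j).trans (k1 j hj), fun hne => ?_⟩
  rw [hK.iteratedDeriv_eq 4, k2]
  exact mul_ne_zero (mul_ne_zero (by norm_num) ha0) (pow_ne_zero 2 hne)

theorem two_lt_contactOrder (h : TangentLPL f lam) (hf : SmoothNear f 0) :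
    2 < contactOrder (lplDisc f) (Kbar f) := by
  obtain ⟨γ, hγ⟩ := exists_regularArc (smoothNear_lplDisc hf) h.L_zero h.dL_ne
  have h1 : ((3 : ℕ) : ℕ∞) ≤ contactOrder (lplDisc f) (Kbar f) :=
    le_iSup₂ (f := fun (k : ℕ) (_ : k ∈ {k : ℕ | ∃ γ : ℝ → Plane, IsRegularArc (lplDisc f) γ ∧
      ∀ j < k, iteratedDeriv j (Kbar f ∘ γ) 0 = 0}) => (k : ℕ∞)) 3
      ⟨γ, hγ, fun j hj => (h.iteratedDeriv_K_arc hf hγ).1 j (by omega)⟩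
  exact lt_of_lt_of_le (by norm_num) h1

end TangentLPL

/-- Along the LPL, `H² = -4 δ K` has a vanishing 2-jet. Its value gives `H = 0`, and its second
derivative, which is then `2 (H')²`, gives `H' = 0`. So `dH` kills the tangent of the LPL and is a
multiple of `dL`. -/
theorem exists_tangentLPL_of_contactOrder {f : Plane → Space} (hf : SmoothNear f 0)
    (hpos : 0 < metricDisc f 0) (L0 : lplDisc f 0 = 0) (dL : fderiv ℝ (lplDisc f) 0 ≠ 0)
    (hc : 2 < contactOrder (lplDisc f) (Kbar f)) : ∃ lam, TangentLPL f lam := by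
  obtain ⟨γ, hγ, hj⟩ := lt_contactOrder (k := 2) hc
  set g : ℝ → ℝ := fun s => Hbar f (γ s) with hg
  have hgs : SmoothNear g 0 := hγ.smooth_comp (smoothNear_Hbar hf)
  have hKs : SmoothNear (Kbar f ∘ γ) 0 := hγ.smooth_comp (smoothNear_Kbar hf)
  have hδs : SmoothNear (fun s => -4 * metricDisc f (γ s)) 0 :=
    (smoothNear_const (-4) 0).mul (hγ.smooth_comp (smoothNear_metricDisc hf))
  have e : g * g =ᶠ[𝓝 0] (fun s => -4 * metricDisc f (γ s)) * (Kbar f ∘ γ) := by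
    filter_upwards [hγ.2.2.2] with s hs
    have := lplDisc_eq_sq_add f (γ s)
    rw [hs] at this
    simp only [Pi.mul_apply, Function.comp_apply, hg]
    linarith
  have hz : ∀ j ≤ 2, iteratedDeriv j (g * g) 0 = 0 := by
    intro j hj2
    rw [e.iteratedDeriv_eq j, iteratedDeriv_mul_smooth hδs hKs]
    refine Finset.sum_eq_zero fun i _ => ?_
    rw [hj (j - i) (by omega), mul_zero]
  have g0 : g 0 = 0 := by
    have := hz 0 (by omega)
    rw [iteratedDeriv_zero] at this
    exact mul_self_eq_zero.1 this
  have g1 : deriv g 0 = 0 := by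
    have := hz 2 le_rfl
    rw [iteratedDeriv_mul_smooth hgs hgs] at this
    simp only [Finset.sum_range_succ, Finset.sum_range_zero, iteratedDeriv_zero, g0,
      show Nat.choose 2 1 = 2 from rfl] at this
    norm_num [iteratedDeriv_one, g0] at this
    exact this
  have H0 : Hbar f 0 = 0 := by
    have := g0
    simp only [hg, hγ.2.1] at this
    exact this
  obtain ⟨lam, hlam⟩ := exists_smul_eq_of_apply_eq_zero hγ.2.2.1
    ((hγ.deriv_comp (smoothNear_Hbar hf)).symm.trans g1)
    (hγ.fderiv_eq_zero (smoothNear_lplDisc hf)) dL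
  exact ⟨lam, hpos, L0, dL, H0, hlam⟩

namespace NondegenerateLPL

variable {f : Plane → Space} {c : Configuration}

/-- The velocities of two arcs of the LPL are proportional, both being in the kernel of `dL`, and
the second derivative is multiplied by the square of the ratio. -/
theorem deriv_deriv_ne (h : NondegenerateLPL c f) (hf : SmoothNear f 0) {γ : ℝ → Plane}
    (hγ : IsRegularArc (lplDisc f) γ) : deriv (deriv (fun s => Hbar f (γ s))) 0 ≠ 0 := by
  obtain ⟨lam, η, ht, hη, hneg⟩ := h
  have hL := smoothNear_lplDisc hf
  obtain ⟨μ, hμ, e⟩ := exists_smul_eq_of_kernel ht.dL_ne hγ.2.2.1 hη.2.2.1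
    (hγ.fderiv_eq_zero hL) (hη.fderiv_eq_zero hL)
  rw [ht.deriv_deriv_H_arc hf hγ, e, fderiv_fderiv_smul (TangentLPL.smooth_diff hf lam),
    ← ht.deriv_deriv_H_arc hf hη]
  exact mul_ne_zero (pow_ne_zero 2 hμ) (right_ne_zero_of_mul hneg.ne)

theorem contactOrder_H (h : NondegenerateLPL c f) (hf : SmoothNear f 0) :
    contactOrder (lplDisc f) (Hbar f) = 2 := by
  have h' := h
  obtain ⟨lam, η, ht, hη, hneg⟩ := h'
  refine contactOrder_eq (k := 2) ⟨η, hη, fun j hj => ?_⟩ fun γ hγ => ?_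
  · interval_cases j
    · rw [iteratedDeriv_zero, Function.comp_apply, hη.2.1, ht.H_zero]
    · rw [iteratedDeriv_one]
      exact ht.deriv_H_arc hf hη
  · rw [iteratedDeriv_two]
    exact h.deriv_deriv_ne hf hγ

theorem contactOrder_K (h : NondegenerateLPL c f) (hf : SmoothNear f 0) :
    contactOrder (lplDisc f) (Kbar f) = 4 := by
  have h' := h
  obtain ⟨lam, η, ht, hη, hneg⟩ := h'
  exact contactOrder_eq (k := 4) ⟨η, hη, (ht.iteratedDeriv_K_arc hf hη).1⟩ fun γ hγ =>
    (ht.iteratedDeriv_K_arc hf hγ).2 (h.deriv_deriv_ne hf hγ)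

end NondegenerateLPL

/-! Invariance under changes of parameters. -/

section Invariance

theorem fderiv_comp_eq_id {h k : Plane → Plane} (hh : SmoothNear h 0) (h0 : h 0 = 0)
    (hk : SmoothNear k 0) (hkh : ∀ᶠ q in 𝓝 (0 : Plane), k (h q) = q) (v : Plane) :
    fderiv ℝ k 0 (fderiv ℝ h 0 v) = v := by
  have h1 : HasFDerivAt k (fderiv ℝ k 0) (h 0) := by
    rw [h0]; exact hk.differentiableAt.hasFDerivAt
  have h2 := (h1.comp 0 hh.differentiableAt.hasFDerivAt).fderiv
  have e : (k ∘ h) =ᶠ[𝓝 0] fun q => q := hkh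
  rw [e.fderiv_eq, fderiv_fun_id] at h2
  exact (congrArg (fun T : Plane →L[ℝ] Plane => T v) h2).symm

theorem jacobian_ne_zero {h k : Plane → Plane} (hh : SmoothNear h 0) (h0 : h 0 = 0)
    (hk : SmoothNear k 0) (hkh : ∀ᶠ q in 𝓝 (0 : Plane), k (h q) = q) : jacobian h 0 ≠ 0 := by
  intro hJ
  have hinj : ∀ v, fderiv ℝ h 0 v = 0 → v = 0 := by
    intro v hv
    rw [← fderiv_comp_eq_id hh h0 hk hkh v, hv, map_zero]
  unfold jacobian at hJ
  set a := fderiv ℝ h 0 (1, 0) with ha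
  set b := fderiv ℝ h 0 (0, 1) with hb
  -- If the Jacobian vanishes, the derivative kills both columns of its adjugate matrix.
  have h1 := hinj (b.2, -a.2) (by
    rw [apply_plane, ← ha, ← hb]
    refine Prod.ext ?_ ?_ <;> simp <;> linarith)
  have h2 := hinj (-b.1, a.1) (by
    rw [apply_plane, ← ha, ← hb]
    refine Prod.ext ?_ ?_ <;> simp <;> linarith)
  simp only [Prod.mk_eq_zero, neg_eq_zero] at h1 h2
  have : a = 0 := Prod.ext h2.2 h1.2
  have := hinj (1, 0) this
  simp at this

theorem fderiv_mul_comp_of_eq_zero {g f f' : Plane → ℝ} {h : Plane → Plane}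
    (hg : SmoothNear g 0) (hf : SmoothNear f 0) (hh : SmoothNear h 0) (h0 : h 0 = 0)
    (f0 : f 0 = 0) (hf' : f' =ᶠ[𝓝 0] fun q => g q * f (h q)) (v : Plane) :
    fderiv ℝ f' 0 v = g 0 * fderiv ℝ f 0 (fderiv ℝ h 0 v) := by
  have h1 : HasFDerivAt f (fderiv ℝ f 0) (h 0) := by
    rw [h0]; exact hf.differentiableAt.hasFDerivAt
  have h2 : HasFDerivAt (fun q => f (h q)) ((fderiv ℝ f 0).comp (fderiv ℝ h 0)) 0 :=
    h1.comp 0 hh.differentiableAt.hasFDerivAt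
  have h3 : HasFDerivAt (fun q => g q * f (h q)) _ 0 :=
    hg.differentiableAt.hasFDerivAt.mul h2
  rw [hf'.fderiv_eq, h3.fderiv, h0, f0]
  simp

theorem deriv_deriv_mul_of_eq_zero {u v : ℝ → ℝ} (hu : SmoothNear u 0) (hv : SmoothNear v 0)
    (v0 : v 0 = 0) (v1 : deriv v 0 = 0) :
    deriv (deriv (fun s => u s * v s)) 0 = u 0 * deriv (deriv v) 0 := by
  have e : deriv (fun s => u s * v s) =ᶠ[𝓝 0] fun s => deriv u s * v s + u s * deriv v s := by
    filter_upwards [hu, hv] with s h1 h2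
    exact ((h1.differentiableAt (by simp)).hasDerivAt.mul
      (h2.differentiableAt (by simp)).hasDerivAt).deriv
  rw [e.deriv_eq]
  have d : HasDerivAt (fun s => deriv u s * v s + u s * deriv v s) _ 0 :=
    (hu.deriv.differentiableAt.hasDerivAt.mul hv.differentiableAt.hasDerivAt).add
      (hu.differentiableAt.hasDerivAt.mul hv.deriv.differentiableAt.hasDerivAt)
  rw [d.deriv, v0, v1]; ring

variable {x y : Plane → Space} {h : Plane → Plane}

/-- At a common zero only the values of the factors `J³` of `H` and `J⁶` of `L` matter, so `lam` is
divided by `J³`. -/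
theorem TangentLPL.comp {lam : ℝ} (ht : TangentLPL x lam) (hx : SmoothNear x 0)
    (hh : IsDiffeoGerm h) (hy : y =ᶠ[𝓝 0] x ∘ h) :
    TangentLPL y (lam / jacobian h 0 ^ 3) := by
  obtain ⟨hs, h0, k, ks, k0, hkh, hhk⟩ := hh
  have hJ := jacobian_ne_zero hs h0 ks hkh
  have hJs := smoothNear_jacobian hs
  have inv := invariants_comp (by rwa [h0]) hs hy
  obtain ⟨i1, i2, i3, i4⟩ := inv.self_of_nhds
  rw [h0] at i1 i2 i3 i4
  have eL : lplDisc y =ᶠ[𝓝 0] fun q => jacobian h q ^ 6 * lplDisc x (h q) :=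
    inv.mono fun q hq => hq.2.2.2
  have eH : Hbar y =ᶠ[𝓝 0] fun q => jacobian h q ^ 3 * Hbar x (h q) :=
    inv.mono fun q hq => hq.2.2.1
  have dL := fderiv_mul_comp_of_eq_zero (hJs.pow 6) (smoothNear_lplDisc hx) hs h0 ht.L_zero eL
  have dH := fderiv_mul_comp_of_eq_zero (hJs.pow 3) (smoothNear_Hbar hx) hs h0 ht.H_zero eH
  refine ⟨?_, by rw [i4, ht.L_zero, mul_zero], fun h1 => ht.dL_ne ?_,
    by rw [i3, ht.H_zero, mul_zero], ?_⟩
  · rw [i1]; exact mul_pos (by positivity) ht.pos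
  · refine ContinuousLinearMap.ext fun v => ?_
    have := dL (fderiv ℝ k 0 v)
    rw [h1, fderiv_comp_eq_id ks k0 hs hhk] at this
    exact (mul_eq_zero.1 this.symm).resolve_left (pow_ne_zero 6 hJ)
  · refine ContinuousLinearMap.ext fun v => ?_
    rw [dH, ht.dH_eq, smul_apply, smul_apply, dL, smul_eq_mul, smul_eq_mul]
    field_simp

/-- Along the pulled back arc, `H''` is multiplied by `J³` while `lam` is divided by `J³`. The
product, and with it the configuration, is unchanged even if the change of parameters reverses the
orientation. -/
theorem NondegenerateLPL.comp {c : Configuration} (hn : NondegenerateLPL c x)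
    (hx : SmoothNear x 0) (hh : IsDiffeoGerm h) (hy : y =ᶠ[𝓝 0] x ∘ h) :
    NondegenerateLPL c y := by
  obtain ⟨lam, γ, ht, hγ, hneg⟩ := hn
  have ht' := ht.comp hx hh hy
  obtain ⟨hs, h0, k, ks, k0, hkh, hhk⟩ := hh
  have hJ := jacobian_ne_zero hs h0 ks hkh
  have hJs := smoothNear_jacobian hs
  have inv := invariants_comp (by rwa [h0]) hs hy
  have hkγ : SmoothNear (fun s => k (γ s)) 0 := ks.comp_of_eq hγ.1 hγ.2.1
  have hkγ0 : k (γ 0) = 0 := by rw [hγ.2.1, k0]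
  have tγ : Tendsto γ (𝓝 0) (𝓝 0) := by
    have := hγ.1.continuousAt.tendsto
    rwa [hγ.2.1] at this
  have tkγ : Tendsto (fun s => k (γ s)) (𝓝 0) (𝓝 0) := by
    have := hkγ.continuousAt.tendsto
    rwa [hkγ0] at this
  have hd : deriv (fun s => k (γ s)) 0 = fderiv ℝ k 0 (deriv γ 0) := by
    have h1 : HasFDerivAt k (fderiv ℝ k 0) (γ 0) := by
      rw [hγ.2.1]; exact ks.differentiableAt.hasFDerivAt
    exact (h1.comp_hasDerivAt 0 hγ.1.differentiableAt.hasDerivAt).deriv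
  refine ⟨_, fun s => k (γ s), ht', ⟨hkγ, hkγ0, ?_, ?_⟩, ?_⟩
  · rw [hd]
    intro h1
    apply hγ.2.2.1
    rw [← fderiv_comp_eq_id ks k0 hs hhk (deriv γ 0), h1, map_zero]
  · filter_upwards [tkγ.eventually inv, tγ.eventually hhk, hγ.2.2.2] with s h1 h2 h3
    rw [h1.2.2.2, h2, h3, mul_zero]
  · have e : (fun s => Hbar y (k (γ s))) =ᶠ[𝓝 0]
        fun s => jacobian h (k (γ s)) ^ 3 * Hbar x (γ s) := by
      filter_upwards [tkγ.eventually inv, tγ.eventually hhk] with s h1 h2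
      rw [h1.2.2.1, h2]
    rw [e.deriv.deriv_eq, deriv_deriv_mul_of_eq_zero ((hJs.pow 3).comp_of_eq hkγ hkγ0)
      (hγ.smooth_comp (smoothNear_Hbar hx)) (by rw [hγ.2.1, ht.H_zero]) (ht.deriv_H_arc hx hγ),
      hkγ0]
    convert hneg using 1
    field_simp

end Invariance

theorem exists_reparam {x y : LocalParam} {g : SurfaceGerm} (hx : Parametrizes x g)
    (hy : Parametrizes y g) : ∃ h, IsDiffeoGerm h ∧ y.toFun =ᶠ[𝓝 0] x.toFun ∘ h :=
  Quotient.exact (hx.trans hy.symm)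

/-- The contact order with the PC jumps from at most 2 to at least 4, so membership in `G1` is a
condition on first derivatives of `H` and `L`, in any parametrization. -/
theorem mem_G1_iff {x : LocalParam} {g : SurfaceGerm} (hx : Parametrizes x g) :
    g ∈ G1 ↔ ∃ lam, TangentLPL x lam := by
  constructor
  · rintro ⟨y, hy, h1, h2, h3, h4⟩
    obtain ⟨lam, ht⟩ := exists_tangentLPL_of_contactOrder y.smooth h1 h2 h3 h4
    obtain ⟨h, hh, e⟩ := exists_reparam hy hx
    exact ⟨_, ht.comp y.smooth hh e⟩
  · rintro ⟨lam, ht⟩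
    exact ⟨x, hx, ht.pos, ht.L_zero, ht.dL_ne, ht.two_lt_contactOrder x.smooth⟩

/-! The configuration of the three curves. -/

theorem smoothNear_comp_snd {W : Type*} [NormedAddCommGroup W] [NormedSpace ℝ W] {φ : Plane → W}
    (hφ : SmoothNear φ 0) : SmoothNear (fun y : ℝ × Plane => φ y.2) 0 :=
  hφ.comp_of_eq (smoothNear_of_contDiff contDiff_snd 0) rfl

theorem fderiv_comp_snd {φ : Plane → ℝ} (hφ : SmoothNear φ 0) (v : ℝ × Plane) :
    fderiv ℝ (fun y : ℝ × Plane => φ y.2) 0 v = fderiv ℝ φ 0 v.2 := by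
  have h1 : HasFDerivAt (fun y : ℝ × Plane => φ y.2)
      ((fderiv ℝ φ 0).comp (ContinuousLinearMap.snd ℝ ℝ Plane)) 0 :=
    HasFDerivAt.comp (0 : ℝ × Plane) (g := φ) hφ.differentiableAt.hasFDerivAt hasFDerivAt_snd
  rw [h1.fderiv]; rfl

theorem exists_ne_of_ne_zero {T : Plane →L[ℝ] ℝ} (hT : T ≠ 0) : ∃ v, T v ≠ 0 := by
  by_contra! h
  exact hT (ContinuousLinearMap.ext h)

/-- Families through a surface with a nondegenerate tangency: in adapted coordinates, the sign of
`∂²Q/∂s²` is the one given by the configuration. -/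
theorem adapted_second_deriv {c : Configuration} {f : Plane → Space} (hf : SmoothNear f 0)
    {lam : ℝ} {γ : ℝ → Plane} (ht : TangentLPL f lam) (hγ : IsRegularArc (lplDisc f) γ)
    (hneg : c.sign * lam * deriv (deriv (fun s => Hbar f (γ s))) 0 < 0)
    {L H : ℝ × Plane → ℝ} (hL : SmoothNear L 0) (hH : SmoothNear H 0)
    (eL : (fun q => L (0, q)) =ᶠ[𝓝 0] lplDisc f) (eH : (fun q => H (0, q)) =ᶠ[𝓝 0] Hbar f)
    (A : AdaptedCoordinates L H)
    (hHL : ∀ v : Plane, fderiv ℝ H 0 (0, v) = lam * fderiv ℝ L 0 (0, v)) :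
    0 < c.sign * fderiv ℝ (fun y => fderiv ℝ A.Q y (0, 1)) 0 (0, 1) := by
  have hlam : lam ≠ 0 := by rintro rfl; simp at hneg
  obtain ⟨ξ, hξ, hLξ, hQ⟩ := A.fderiv_fderiv_Q hL hH hlam hHL
  have dL : fderiv ℝ (lplDisc f) 0 ξ = 0 := by
    rw [← eL.fderiv_eq, fderiv_slice (t := 0) (q := 0) hL.differentiableAt]
    exact hLξ
  obtain ⟨μ, hμ, e⟩ := exists_smul_eq_of_kernel ht.dL_ne hξ hγ.2.2.1 dL
    (hγ.fderiv_eq_zero (smoothNear_lplDisc hf))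
  have eZ : (fun q : Plane => H (0, q) - lam * L (0, q)) =ᶠ[𝓝 0]
      fun q => Hbar f q - lam * lplDisc f q := by
    filter_upwards [eL, eH] with q h1 h2
    rw [h1, h2]
  rw [(fderiv_apply_congr eZ ξ).fderiv_eq, e,
    fderiv_fderiv_smul (TangentLPL.smooth_diff hf lam), ← ht.deriv_deriv_H_arc hf hγ] at hQ
  set d := fderiv ℝ (fun y => fderiv ℝ A.Q y (0, 1)) 0 (0, 1) with hd
  have h1 : lam ^ 2 * (c.sign * d) =
      -μ ^ 2 * (c.sign * lam * deriv (deriv (fun s => Hbar f (γ s))) 0) := by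
    linear_combination c.sign * lam * hQ
  have h2 : 0 < lam ^ 2 * (c.sign * d) := by
    rw [h1, neg_mul, neg_pos]
    exact mul_neg_of_pos_of_neg (by positivity) hneg
  exact pos_of_mul_pos_right h2 (sq_nonneg _)

/-- Adapted coordinates for the constant family give `L = Q(0, s)` on the MCNC, and `c.sign * Q(0,
s)` has a strict minimum 0 at `s = 0`. On the PC, `L = H²`; this is positive off the origin, since
`H = 0` there would make `L` vanish on the MCNC. -/
theorem NondegenerateLPL.hasConfiguration {c : Configuration} {x : LocalParam}
    (h : NondegenerateLPL c x) : HasConfiguration c x := by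
  obtain ⟨lam, γ, ht, hγ, hneg⟩ := h
  have hlam : lam ≠ 0 := by rintro rfl; simp at hneg
  have hLs := smoothNear_lplDisc x.smooth
  have hHs := smoothNear_Hbar x.smooth
  refine ⟨ht.dK_ne x.smooth, ?_, ht.K_zero, ht.H_zero, ?_⟩
  · rw [ht.dH_eq]; exact smul_ne_zero hlam ht.dL_ne
  have hL := smoothNear_comp_snd hLs
  have hH := smoothNear_comp_snd hHs
  have hHL : ∀ v : Plane, fderiv ℝ (fun y : ℝ × Plane => Hbar x y.2) 0 (0, v) =
      lam * fderiv ℝ (fun y : ℝ × Plane => lplDisc x y.2) 0 (0, v) := by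
    intro v
    rw [fderiv_comp_snd hHs, fderiv_comp_snd hLs, ht.dH_eq]; rfl
  obtain ⟨v, hv⟩ := exists_ne_of_ne_zero ht.dL_ne
  obtain ⟨A⟩ := exists_adaptedCoordinates hL hH ht.L_zero ht.H_zero hlam hHL
    ⟨v, by rwa [fderiv_comp_snd hLs]⟩
  have hss := adapted_second_deriv x.smooth ht hγ hneg hL hH EventuallyEq.rfl EventuallyEq.rfl A hHL
  have hQs : fderiv ℝ A.Q 0 (0, 1) = 0 := by
    have := A.fderiv_Q hL hH hHL (0, 1)
    simpa [hlam] using this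
  have hfd : (fun y => fderiv ℝ (fun z => c.sign * A.Q z) y (0, 1)) =ᶠ[𝓝 0]
      fun y => c.sign * fderiv ℝ A.Q y (0, 1) := by
    filter_upwards [A.smoothQ] with y hy
    rw [fderiv_const_mul (hy.differentiableAt (by simp))]
    rfl
  have hpos := eventually_pos_slice (q := fun z => c.sign * A.Q z)
    ((smoothNear_const c.sign 0).mul A.smoothQ) (by simp [A.Q_zero])
    (hfd.self_of_nhds.trans (by simp [hQs]))
    (by rw [hfd.fderiv_eq, fderiv_const_mul (A.smoothQ.fderiv_apply _).differentiableAt]; exact hss)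
  have t1 : Tendsto (fun q : Plane => ((0, q) : ℝ × Plane)) (𝓝 0) (𝓝 0) :=
    (Continuous.prodMk_right (0 : ℝ)).tendsto 0
  have t2 : Tendsto (fun q : Plane => ((0, (A.S q, lplDisc x q)) : ℝ × Plane)) (𝓝 0) (𝓝 0) := by
    have h1 : ContinuousAt (fun q : Plane => ((0, (A.S q, lplDisc x q)) : ℝ × Plane)) 0 :=
      continuousAt_const.prodMk (A.S.continuous.continuousAt.prodMk hLs.continuousAt)
    have h2 := h1.tendsto
    simp only [ht.L_zero, map_zero] at h2
    exact h2
  have t3 : Tendsto A.S (𝓝 0) (𝓝 0) := A.S.continuous.tendsto' _ _ (map_zero _)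
  have key : ∀ᶠ q in 𝓝 (0 : Plane), q ≠ 0 → Hbar x q = 0 → 0 < c.sign * lplDisc x q := by
    filter_upwards [t1.eventually A.left_inv, t2.eventually A.H_iff, t3.eventually hpos]
      with q h1 h2 h3 hq hHq
    rw [h1] at h2
    have hLQ := h2.1 hHq
    rw [hLQ]
    refine h3 fun hS => hq ?_
    rw [hS, show A.Q (0, 0) = 0 from A.Q_zero] at hLQ
    rw [hS, hLQ] at h1
    rw [← h1]
    exact A.Φ_zero
  filter_upwards [key] with q hq hq0
  refine ⟨fun hK => ?_, fun hH0 => hq hq0 hH0⟩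
  have hid := lplDisc_eq_sq_add x q
  rw [show Kbar x q = 0 from hK, mul_zero, add_zero] at hid
  rw [hid]
  refine sq_pos_of_ne_zero fun hH0 => ?_
  have := hq hq0 hH0
  rw [hid, hH0] at this
  simp at this

theorem NondegenerateLPL.staticPart {c : Configuration} {x : LocalParam} {g : SurfaceGerm}
    (h : NondegenerateLPL c x) (hx : Parametrizes x g) : StaticPart c g := by
  intro y hy
  obtain ⟨k, hk, e⟩ := exists_reparam hx hy
  have h' := h.comp x.smooth hk e
  exact ⟨h'.contactOrder_K y.smooth, h'.contactOrder_H y.smooth, h'.hasConfiguration⟩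

theorem Configuration.sign_ne_zero (c : Configuration) : c.sign ≠ 0 := by
  cases c <;> simp [Configuration.sign]

/-! Bifurcation of the three curves in a family. -/

namespace Deformation

variable {x : LocalParam} {E : Submodule ℝ Space}

/-- The total map of a deformation. -/
def total (D : Deformation x E) (y : ℝ × Plane) : Space := x y.2 + D.h y

theorem smooth_total (D : Deformation x E) : SmoothNear D.total 0 :=
  (smoothNear_comp_snd x.smooth).add D.smooth

theorem planeJet_surface (D : Deformation x E) :
    ∀ᶠ y in 𝓝 (0 : ℝ × Plane), planeJet (D.surface y.1) y.2 = familyJet D.total y :=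
  D.smooth_total.eventually.mono fun _ hy => planeJet_slice hy

theorem familyJet_zero (D : Deformation x E) :
    (fun q => familyJet D.total (0, q)) =ᶠ[𝓝 0] planeJet x := by
  have t1 : Tendsto (fun q : Plane => ((0, q) : ℝ × Plane)) (𝓝 0) (𝓝 0) :=
    (Continuous.prodMk_right (0 : ℝ)).tendsto 0
  have e : D.surface 0 =ᶠ[𝓝 0] x.toFun := by
    filter_upwards [D.at_zero] with q hq
    simp [surface, hq]
  filter_upwards [t1.eventually D.planeJet_surface, jetOf_congr (1, 0) (0, 1) e] with q h1 h2
  rw [← h1]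
  exact h2

/-- The velocity of the family of functions given by the polynomial `p` in the jets. -/
noncomputable def velocity (D : Deformation x E) (p : Jet → ℝ) : ℝ :=
  fderiv ℝ (fun y => p (familyJet D.total y)) 0 (1, 0)

theorem continuous_velocity {p : Jet → ℝ} (hp : ContDiff ℝ ∞ p) :
    Continuous fun D : Deformation x E => D.velocity p := by
  have h1 : JetContinuous fun D : Deformation x E => D.total :=
    (JetContinuous.const (smoothNear_comp_snd x.smooth)).add (jetContinuous_deformation x E)
  exact (((h1.jetOf (0, (1, 0)) (0, (0, 1))).comp_left hp).fderiv_apply (1, 0)).continuous_eval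

/-- The deformed surfaces stay Lorentzian near the origin, so the PC of each of them has the
equation `L = H²`. -/
theorem eventually_invariants (D : Deformation x E) (hx : 0 < metricDisc x 0) :
    ∀ᶠ y in 𝓝 (0 : ℝ × Plane), lplDisc (D.surface y.1) y.2 = jetL (familyJet D.total y) ∧
      Hbar (D.surface y.1) y.2 = jetH (familyJet D.total y) ∧
      (Kbar (D.surface y.1) y.2 = 0 ↔
        jetL (familyJet D.total y) = jetH (familyJet D.total y) ^ 2) := by
  have hpos : ∀ᶠ y in 𝓝 (0 : ℝ × Plane), 0 < jetDisc (familyJet D.total y) := by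
    have h0 : familyJet D.total 0 = planeJet x 0 := D.familyJet_zero.self_of_nhds
    rw [metricDisc_eq] at hx
    refine (smoothNear_jet contDiff_jetDisc _ _ D.smooth_total).continuousAt.eventually
      (lt_mem_nhds ?_)
    simpa only [h0] using hx
  filter_upwards [D.planeJet_surface, hpos] with y h1 h2
  simp only [lplDisc_eq, Hbar_eq, Kbar_eq, h1, true_and]
  rw [jetL_eq]
  constructor
  · intro h4; rw [h4, mul_zero, add_zero]
  · intro h4
    have : jetDisc (familyJet D.total y) * jetK (familyJet D.total y) = 0 := by linarith
    exact (mul_eq_zero.1 this).resolve_left h2.ne'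

section Coordinates

variable {D : Deformation x E} {L H : ℝ × Plane → ℝ}

/-- Any two of `L = 0`, `H = 0`, `L = H²` imply the third, so only the solutions of the first two
have to be counted. -/
theorem intersectionsBifurcate_of_folds
    (A : AdaptedCoordinates L H) (hL : SmoothNear L 0) (L0 : L 0 = 0)
    (hall : ∀ᶠ y in 𝓝 (0 : ℝ × Plane), lplDisc (D.surface y.1) y.2 = L y ∧
      Hbar (D.surface y.1) y.2 = H y ∧ (Kbar (D.surface y.1) y.2 = 0 ↔ L y = H y ^ 2))
    {ε σ : ℝ} (hfold : Folds A.Q ε σ) : IntersectionsBifurcate D σ := by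
  intro W hW
  obtain ⟨ρ₁, hρ₁, hW'⟩ := Metric.mem_nhds_iff.1 hW
  obtain ⟨ρ₂, hρ₂, hball⟩ := Metric.eventually_nhds_iff.1 hall
  have e1 : ∀ᶠ ρ in 𝓝[>] (0 : ℝ), ρ ∈ Set.Ioo 0 (min ρ₁ ρ₂) := Ioo_mem_nhdsGT (lt_min hρ₁ hρ₂)
  obtain ⟨ρ, hρ, hcard⟩ := (e1.and (A.card_solutions hL L0 hfold)).exists
  refine ⟨Metric.ball 0 ρ, Metric.ball_mem_nhds 0 hρ.1,
    (Metric.ball_subset_ball (hρ.2.le.trans (min_le_left _ _))).trans hW', ?_⟩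
  filter_upwards [hcard, Metric.ball_mem_nhds (0 : ℝ) hρ₂] with t ht1 ht2
  have hV : ∀ q ∈ Metric.ball (0 : Plane) ρ, (q ∈ LPL (D.surface t) ↔ L (t, q) = 0) ∧
      (q ∈ MCNC (D.surface t) ↔ H (t, q) = 0) ∧
      (q ∈ PC (D.surface t) ↔ L (t, q) = H (t, q) ^ 2) := by
    intro q hq
    have hd : dist ((t, q) : ℝ × Plane) 0 < ρ₂ := by
      rw [Prod.dist_eq]
      exact max_lt ht2 ((Metric.mem_ball.1 hq).trans (hρ.2.trans_le (min_le_right _ _)))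
    obtain ⟨h1, h2, h3⟩ := hball hd
    refine ⟨?_, ?_, h3⟩
    · rw [← h1]; rfl
    · rw [← h2]; rfl
  have hset : Metric.ball (0 : Plane) ρ ∩ LPL (D.surface t) ∩ MCNC (D.surface t) =
      {q | q ∈ Metric.ball (0 : Plane) ρ ∧ L (t, q) = 0 ∧ H (t, q) = 0} := by
    ext q
    rw [Set.mem_inter_iff, Set.mem_inter_iff, Set.mem_ofPred_eq, and_assoc]
    exact and_congr_right fun hq => by rw [(hV q hq).1, (hV q hq).2.1]
  rw [hset]
  refine ⟨ht1.1, fun h => ?_, ?_, ?_⟩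
  · exact Set.eq_empty_of_forall_notMem fun q hq => ht1.2 h q hq.1 hq.2
  · ext q
    rw [Set.mem_inter_iff, Set.mem_inter_iff, Set.mem_ofPred_eq, and_assoc]
    refine and_congr_right fun hq => ?_
    rw [(hV q hq).1, (hV q hq).2.2]
    refine and_congr_right fun h0 => ?_
    rw [h0, eq_comm, pow_eq_zero_iff two_ne_zero]
  · ext q
    rw [Set.mem_inter_iff, Set.mem_inter_iff, Set.mem_ofPred_eq, and_assoc]
    refine and_congr_right fun hq => ?_
    rw [(hV q hq).2.1, (hV q hq).2.2, and_comm]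
    refine and_congr_left fun h0 => ?_
    rw [h0, zero_pow two_ne_zero]

theorem curvesDeform_of_folds
    (A : AdaptedCoordinates L H) (hL : SmoothNear L 0) (hH : SmoothNear H 0)
    (hall : ∀ᶠ y in 𝓝 (0 : ℝ × Plane), lplDisc (D.surface y.1) y.2 = L y ∧
      Hbar (D.surface y.1) y.2 = H y ∧ (Kbar (D.surface y.1) y.2 = 0 ↔ L y = H y ^ 2))
    {c : Configuration} {σ : ℝ} (hfold : Folds A.Q c.sign σ) : CurvesDeform D c σ := by
  refine ⟨A.Φ, A.P, A.Q, A.smoothΦ, A.Φ_zero, A.bijective_fderiv_slice hL, A.smoothP,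
    A.smoothQ, A.P_zero, A.Q_zero, ?_, A.P_relations hH, hfold⟩
  have tΦ : Tendsto (fun y : ℝ × Plane => ((y.1, A.Φ y) : ℝ × Plane)) (𝓝 0) (𝓝 0) := by
    have h1 : ContinuousAt (fun y : ℝ × Plane => ((y.1, A.Φ y) : ℝ × Plane)) 0 :=
      continuousAt_fst.prodMk A.smoothΦ.continuousAt
    have h2 := h1.tendsto
    simp only [A.Φ_zero, Prod.fst_zero] at h2
    exact h2
  filter_upwards [tΦ.eventually hall, A.L_comp, A.H_iff, A.P_iff] with y h1 h2 h3 h4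
  obtain ⟨k1, k2, k3⟩ := h1
  refine ⟨?_, k3.trans h4, ?_⟩
  · rw [← h2, ← k1]; rfl
  · rw [← h3, ← k2]; rfl

/-- Tangency gives `Q_s = 0`, nondegeneracy gives the sign of `Q_ss`, and the velocity condition
gives `Q_t ≠ 0`: these are the hypotheses of the fold. -/
theorem bifurcates_of_velocity {c : Configuration} {lam : ℝ} {γ : ℝ → Plane}
    (ht : TangentLPL x lam) (hγ : IsRegularArc (lplDisc x) γ)
    (hneg : c.sign * lam * deriv (deriv (fun s => Hbar x (γ s))) 0 < 0)
    (hL : SmoothNear L 0) (hH : SmoothNear H 0)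
    (hall : ∀ᶠ y in 𝓝 (0 : ℝ × Plane), lplDisc (D.surface y.1) y.2 = L y ∧
      Hbar (D.surface y.1) y.2 = H y ∧ (Kbar (D.surface y.1) y.2 = 0 ↔ L y = H y ^ 2))
    (eL : (fun q => L (0, q)) =ᶠ[𝓝 0] lplDisc x) (eH : (fun q => H (0, q)) =ᶠ[𝓝 0] Hbar x)
    (hv : fderiv ℝ H 0 (1, 0) - lam * fderiv ℝ L 0 (1, 0) ≠ 0) : D.Bifurcates c := by
  have hlam : lam ≠ 0 := by rintro rfl; simp at hneg
  have L0 : L 0 = 0 := eL.self_of_nhds.trans ht.L_zero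
  have H0 : H 0 = 0 := eH.self_of_nhds.trans ht.H_zero
  have dL : ∀ v, fderiv ℝ L 0 (0, v) = fderiv ℝ (lplDisc x) 0 v := fun v => by
    rw [← eL.fderiv_eq]
    exact (fderiv_slice (t := 0) (q := 0) hL.differentiableAt v).symm
  have dH : ∀ v, fderiv ℝ H 0 (0, v) = fderiv ℝ (Hbar x) 0 v := fun v => by
    rw [← eH.fderiv_eq]
    exact (fderiv_slice (t := 0) (q := 0) hH.differentiableAt v).symm
  have hHL : ∀ v : Plane, fderiv ℝ H 0 (0, v) = lam * fderiv ℝ L 0 (0, v) := by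
    intro v
    rw [dH, dL, ht.dH_eq]; rfl
  obtain ⟨v, hv'⟩ := exists_ne_of_ne_zero ht.dL_ne
  obtain ⟨A⟩ := exists_adaptedCoordinates hL hH L0 H0 hlam hHL ⟨v, by rwa [dL]⟩
  have hss := adapted_second_deriv x.smooth ht hγ hneg hL hH eL eH A hHL
  have hQs : fderiv ℝ A.Q 0 (0, 1) = 0 := by
    have := A.fderiv_Q hL hH hHL (0, 1)
    simpa [hlam] using this
  have hQt : fderiv ℝ A.Q 0 (1, 0) ≠ 0 := by
    intro h0
    have := A.fderiv_Q hL hH hHL (1, 0)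
    rw [h0, mul_zero, neg_one_mul, eq_comm, neg_eq_zero] at this
    exact hv this
  -- `σ` is the direction of `t` in which `c.sign * Q` decreases at the origin, which is where its
  -- two zeros appear.
  obtain ⟨σ, hσ, hσt⟩ : ∃ σ : ℝ, (σ = 1 ∨ σ = -1) ∧ σ * (c.sign * fderiv ℝ A.Q 0 (1, 0)) < 0 := by
    rcases lt_or_gt_of_ne (mul_ne_zero c.sign_ne_zero hQt) with h | h
    · exact ⟨1, .inl rfl, by linarith⟩
    · exact ⟨-1, .inr rfl, by linarith⟩
  have hfold : Folds A.Q c.sign σ := folds_of_fderiv A.smoothQ A.Q_zero hQs hss hσt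
  exact ⟨σ, hσ, intersectionsBifurcate_of_folds A hL L0 hall hfold,
    curvesDeform_of_folds A hL hH hall hfold⟩

end Coordinates

theorem bifurcates (D : Deformation x E) {c : Configuration} {lam : ℝ} {γ : ℝ → Plane}
    (ht : TangentLPL x lam) (hγ : IsRegularArc (lplDisc x) γ)
    (hneg : c.sign * lam * deriv (deriv (fun s => Hbar x (γ s))) 0 < 0)
    (hv : D.velocity jetH - lam * D.velocity jetL ≠ 0) : D.Bifurcates c :=
  bifurcates_of_velocity ht hγ hneg (smoothNear_jet contDiff_jetL _ _ D.smooth_total)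
    (smoothNear_jet contDiff_jetH _ _ D.smooth_total) (D.eventually_invariants ht.pos)
    (D.familyJet_zero.mono fun q hq => by simp only [lplDisc_eq, hq])
    (D.familyJet_zero.mono fun q hq => by simp only [Hbar_eq, hq]) hv

end Deformation

/-! Perturbations in a fixed direction. -/

/-- For differentiating explicit polynomials: the derivative is the linear coefficient along a line,
and `c, d, k` absorb the terms of order 2 to 4. -/
theorem fderiv_eq_of_line {V : Type*} [NormedAddCommGroup V] [NormedSpace ℝ V] {φ : V → ℝ}
    {y v : V} {a b c d k : ℝ} (hφ : DifferentiableAt ℝ φ y)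
    (h : ∀ s : ℝ, φ (y + s • v) = a + s * b + s ^ 2 * (c + s * d + s ^ 2 * k)) :
    fderiv ℝ φ y v = b := by
  rw [fderiv_eq_deriv_line hφ, funext h]
  have h1 : HasDerivAt (fun s : ℝ => a + s * b + s ^ 2 * (c + s * d + s ^ 2 * k))
      (0 + 1 * b + (((2 : ℕ) * (0 : ℝ) ^ (2 - 1) * 1) * (c + 0 * d + 0 ^ 2 * k) +
        (0 : ℝ) ^ 2 * (0 + 1 * d + ((2 : ℕ) * (0 : ℝ) ^ (2 - 1) * 1) * k))) 0 :=
    (((hasDerivAt_const (0 : ℝ) a).add ((hasDerivAt_id (0 : ℝ)).mul_const b))).add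
      (((hasDerivAt_id (0 : ℝ)).pow 2).mul (((hasDerivAt_const (0 : ℝ) c).add
        ((hasDerivAt_id (0 : ℝ)).mul_const d)).add (((hasDerivAt_id (0 : ℝ)).pow 2).mul_const k)))
  rw [h1.deriv]; simp

theorem jetOf_smul_const {V : Type*} [NormedAddCommGroup V] [NormedSpace ℝ V] {a b : V}
    {φ φa φb φaa φab φbb : V → ℝ} (hφ : ContDiff ℝ ∞ φ)
    (ha : ∀ y, fderiv ℝ φ y a = φa y) (hb : ∀ y, fderiv ℝ φ y b = φb y)
    (haa : ∀ y, fderiv ℝ φa y a = φaa y) (hab : ∀ y, fderiv ℝ φa y b = φab y)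
    (hbb : ∀ y, fderiv ℝ φb y b = φbb y) (e : Space) (y : V) :
    jetOf a b (fun y => φ y • e) y =
      (φa y • e, φb y • e, φaa y • e, φab y • e, φbb y • e) := by
  have key : ∀ {ψ : V → ℝ}, Differentiable ℝ ψ → ∀ y v,
      fderiv ℝ (fun y => ψ y • e) y v = fderiv ℝ ψ y v • e := by
    intro ψ hψ y v
    exact congrArg (fun T : V →L[ℝ] Space => T v) ((hψ y).hasFDerivAt.smul_const e).fderiv
  have hd : ∀ v, Differentiable ℝ fun y => fderiv ℝ φ y v := fun v y =>
    ((smoothNear_of_contDiff hφ y).fderiv_apply v).differentiableAt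
  have hφd : Differentiable ℝ φ := hφ.differentiable (by simp)
  have e1 : (fun y => fderiv ℝ φ y a) = φa := funext ha
  have e2 : (fun y => fderiv ℝ φ y b) = φb := funext hb
  have hda := hd a
  have hdb := hd b
  rw [e1] at hda
  rw [e2] at hdb
  unfold jetOf
  simp only [key hφd, ha, hb, key hda, key hdb, haa, hab, hbb]

theorem mink_cross_left (a b : Space) : mink (cross a b) a = 0 := by
  rw [mink_cross]; ring

theorem mink_cross_right (a b : Space) : mink (cross a b) b = 0 := by
  rw [mink_cross]; ring

theorem mink_cross_self (j : Jet) :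
    mink (cross j.1 j.2.1) (cross j.1 j.2.1) = jetDisc j := by
  rw [mink_cross]
  simp [jetDisc, jetE, jetF, jetG, mink, cross]
  ring

/-- The scalar product with a fixed vector. -/
def minkLinear (a : Space) : Space →ₗ[ℝ] ℝ where
  toFun b := mink a b
  map_add' b c := by simp [mink]; ring
  map_smul' r b := by simp [mink]; ring

/-- Otherwise `E` and the tangent plane are both orthogonal to the normal `n`, hence so is the whole
space. But `⟨n, n⟩ = δ > 0`. -/
theorem exists_transverse {x : LocalParam} {E : Submodule ℝ Space} (hx : 0 < metricDisc x 0)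
    (hE : E ⊔ LinearMap.range (fderiv ℝ x 0 : Plane →ₗ[ℝ] Space) = ⊤) :
    ∃ e ∈ E, mink (cross (planeJet x 0).1 (planeJet x 0).2.1) e ≠ 0 := by
  by_contra! h
  set n := cross (planeJet x 0).1 (planeJet x 0).2.1 with hn
  have h1 : E ≤ LinearMap.ker (minkLinear n) := fun e he => h e he
  have h2 : LinearMap.range (fderiv ℝ x 0 : Plane →ₗ[ℝ] Space) ≤ LinearMap.ker (minkLinear n) := by
    rintro _ ⟨v, rfl⟩
    rw [LinearMap.mem_ker, ContinuousLinearMap.coe_coe, apply_plane, map_add, map_smul, map_smul]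
    rw [show minkLinear n (fderiv ℝ x 0 (1, 0)) = 0 from mink_cross_left _ _,
      show minkLinear n (fderiv ℝ x 0 (0, 1)) = 0 from mink_cross_right _ _]
    simp
  have h3 := sup_le h1 h2
  rw [hE] at h3
  have h4 : mink n n = 0 := h3 (Submodule.mem_top (x := n))
  rw [hn, mink_cross_self] at h4
  rw [metricDisc_eq] at hx
  exact hx.ne' h4

/-- `t (α u² + 2 β u v + γ v²) / 2`. -/
noncomputable def quadraticFamily (α β γ : ℝ) (y : ℝ × Plane) : ℝ :=
  y.1 * (α * y.2.1 ^ 2 + 2 * β * y.2.1 * y.2.2 + γ * y.2.2 ^ 2) / 2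

theorem contDiff_quadraticFamily (α β γ : ℝ) : ContDiff ℝ ∞ (quadraticFamily α β γ) := by
  unfold quadraticFamily; fun_prop

theorem familyJet_quadraticFamily (α β γ : ℝ) (e : Space) (y : ℝ × Plane) :
    familyJet (fun y => quadraticFamily α β γ y • e) y =
      ((y.1 * (α * y.2.1 + β * y.2.2)) • e, (y.1 * (β * y.2.1 + γ * y.2.2)) • e,
        (y.1 * α) • e, (y.1 * β) • e, (y.1 * γ) • e) := by
  have hd : ∀ y, DifferentiableAt ℝ (quadraticFamily α β γ) y := fun y =>
    (contDiff_quadraticFamily α β γ).differentiable (by simp) y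
  refine jetOf_smul_const (φa := fun y => y.1 * (α * y.2.1 + β * y.2.2))
    (φb := fun y => y.1 * (β * y.2.1 + γ * y.2.2)) (φaa := fun y => y.1 * α)
    (φab := fun y => y.1 * β) (φbb := fun y => y.1 * γ)
    (contDiff_quadraticFamily α β γ) (fun y => ?_) (fun y => ?_) (fun y => ?_) (fun y => ?_)
    (fun y => ?_) e y
  · refine fderiv_eq_of_line (a := quadraticFamily α β γ y) (c := y.1 * α / 2) (d := 0) (k := 0)
      (hd y) fun s => ?_
    simp [quadraticFamily]; ring
  · refine fderiv_eq_of_line (a := quadraticFamily α β γ y) (c := y.1 * γ / 2) (d := 0) (k := 0)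
      (hd y) fun s => ?_
    simp [quadraticFamily]; ring
  · refine fderiv_eq_of_line (a := y.1 * (α * y.2.1 + β * y.2.2)) (c := 0) (d := 0) (k := 0)
      (by fun_prop) fun s => ?_
    simp; ring
  · refine fderiv_eq_of_line (a := y.1 * (α * y.2.1 + β * y.2.2)) (c := 0) (d := 0) (k := 0)
      (by fun_prop) fun s => ?_
    simp; ring
  · refine fderiv_eq_of_line (a := y.1 * (β * y.2.1 + γ * y.2.2)) (c := 0) (d := 0) (k := 0)
      (by fun_prop) fun s => ?_
    simp; ring

namespace Deformation

variable {x : LocalParam} {E : Submodule ℝ Space}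

/-- Addition of `t (α u² + 2 β u v + γ v²) e / 2` to a deformation. -/
noncomputable def addQuadratic (D : Deformation x E) {e : Space} (he : e ∈ E) (α β γ : ℝ) : Deformation x E where
  h y := D.h y + quadraticFamily α β γ y • e
  smooth := D.smooth.add
    (smoothNear_of_contDiff ((contDiff_quadraticFamily α β γ).smul contDiff_const) 0)
  mem := D.mem.mono fun y hy => E.add_mem hy (E.smul_mem _ he)
  at_zero := D.at_zero.mono fun q hq => by simp [hq, quadraticFamily]

theorem velocity_eq (D : Deformation x E) {p : Jet → ℝ} (hp : ContDiff ℝ ∞ p) :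
    D.velocity p = fderiv ℝ p (planeJet x 0) (fderiv ℝ (familyJet D.total) 0 (1, 0)) := by
  have h0 : familyJet D.total 0 = planeJet x 0 := D.familyJet_zero.self_of_nhds
  have h1 : HasFDerivAt p (fderiv ℝ p (planeJet x 0)) (familyJet D.total 0) := by
    rw [h0]; exact (hp.differentiable (by simp) _).hasFDerivAt
  have h2 := h1.comp 0 (smoothNear_jetOf (0, (1, 0)) (0, (0, 1))
    D.smooth_total).differentiableAt.hasFDerivAt
  exact congrArg (fun T : ℝ × Plane →L[ℝ] ℝ => T (1, 0)) h2.fderiv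

/-- At the origin of the plane, the added term moves only the second-order part of the jet, linearly
in `t`. -/
theorem velocity_addQuadratic (D : Deformation x E) {e : Space} (he : e ∈ E) (α β γ : ℝ)
    {p : Jet → ℝ} (hp : ContDiff ℝ ∞ p) : (D.addQuadratic he α β γ).velocity p =
      D.velocity p + fderiv ℝ p (planeJet x 0) (vertJet e α β γ) := by
  have hsm : SmoothNear (fun y => quadraticFamily α β γ y • e) 0 :=
    smoothNear_of_contDiff ((contDiff_quadraticFamily α β γ).smul contDiff_const) 0
  have e1 : (D.addQuadratic he α β γ).total =
      fun y => D.total y + quadraticFamily α β γ y • e :=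
    funext fun y => (add_assoc _ _ _).symm
  have e2 : familyJet (D.addQuadratic he α β γ).total =ᶠ[𝓝 0] fun y => familyJet D.total y +
      familyJet (fun y => quadraticFamily α β γ y • e) y := by
    filter_upwards [D.smooth_total.eventually, hsm.eventually] with y h1 h2
    rw [e1]
    exact jetOf_add _ _ h1 h2
  have hj := smoothNear_jetOf ((0, (1, 0)) : ℝ × Plane) (0, (0, 1)) hsm
  have e3 : fderiv ℝ (familyJet (fun y => quadraticFamily α β γ y • e)) 0 (1, 0) =
      vertJet e α β γ := by
    rw [fderiv_eq_deriv_line hj.differentiableAt]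
    have : (fun s : ℝ => familyJet (fun y => quadraticFamily α β γ y • e)
        (0 + s • ((1, 0) : ℝ × Plane))) = fun s => s • vertJet e α β γ := by
      funext s
      rw [familyJet_quadraticFamily]
      simp [vertJet, mul_smul]
    rw [this]
    have hd : HasDerivAt (fun s : ℝ => s • vertJet e α β γ) ((1 : ℝ) • vertJet e α β γ) 0 :=
      (hasDerivAt_id (0 : ℝ)).smul_const _
    rw [hd.deriv, one_smul]
  rw [velocity_eq _ hp, velocity_eq _ hp, ← map_add, e2.fderiv_eq,
    fderiv_fun_add (smoothNear_jetOf _ _ D.smooth_total).differentiableAt hj.differentiableAt,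
    add_apply, e3]

theorem continuous_addQuadratic (D : Deformation x E) {e : Space} (he : e ∈ E) (α β γ : ℝ) :
    Continuous fun ε : ℝ => D.addQuadratic he (ε * α) (ε * β) (ε * γ) := by
  apply continuous_toDeformation
  have hsm : SmoothNear (fun y => quadraticFamily α β γ y • e) 0 :=
    smoothNear_of_contDiff ((contDiff_quadraticFamily α β γ).smul contDiff_const) 0
  have h := (JetContinuous.const (X := ℝ) D.smooth).add
    (JetContinuous.smul_const (continuous_id (X := ℝ)) hsm)
  convert h using 4 with ε y
  change D.h y + quadraticFamily (ε * α) (ε * β) (ε * γ) y • e = _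
  simp only [id, smul_smul, quadraticFamily]
  congr 2
  ring

end Deformation

/-- If the expression vanished identically, then `(E, F, G) = κ (l, m, n)` and `δ = -κ² K = 0`. -/
theorem exists_quadratic_direction {j : Jet} (hδ : jetDisc j ≠ 0) (hK : jetK j = 0) (κ : ℝ) :
    ∃ α β γ : ℝ, α * jetG j - 2 * β * jetF j + γ * jetE j -
      κ * (α * jetn j - 2 * β * jetm j + γ * jetl j) ≠ 0 := by
  by_contra! h
  have h1 := h 1 0 0
  have h2 := h 0 1 0
  have h3 := h 0 0 1
  apply hδ
  have e1 : jetG j = κ * jetn j := by linarith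
  have e2 : jetF j = κ * jetm j := by linarith
  have e3 : jetE j = κ * jetl j := by linarith
  have : jetDisc j = -κ ^ 2 * jetK j := by
    rw [jetDisc, jetK, e1, e2, e3]; ring
  rw [this, hK, mul_zero]

/-- On a path with affine values of nonzero slope, `θ` has only one zero. -/
theorem dense_of_affine_paths {X : Type*} [TopologicalSpace X] {θ : X → ℝ}
    (h : ∀ x, ∃ (p : ℝ → X) (C : ℝ), Continuous p ∧ Inseparable (p 0) x ∧ C ≠ 0 ∧
      ∀ ε, θ (p ε) = θ x + ε * C) : Dense {x | θ x ≠ 0} := by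
  intro x
  rw [mem_closure_iff]
  intro U hU hxU
  obtain ⟨p, C, hp, hp0, hC, hθ⟩ := h x
  have h1 : ∀ᶠ ε in 𝓝 (0 : ℝ), p ε ∈ U := by
    have : p 0 ∈ U := (hp0.mem_open_iff hU).2 hxU
    exact hp.continuousAt.eventually_mem (hU.mem_nhds this)
  have h2 : ∀ᶠ ε in 𝓝[≠] (0 : ℝ), p ε ∈ U ∧ θ (p ε) ≠ 0 := by
    have h3 : ∀ᶠ ε in 𝓝[≠] (0 : ℝ), θ (p ε) ≠ 0 := by
      by_cases hx : θ x = 0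
      · filter_upwards [self_mem_nhdsWithin] with ε hε
        rw [hθ, hx, zero_add]
        exact mul_ne_zero hε hC
      · have hc : ContinuousAt (fun ε => θ x + ε * C) 0 := by fun_prop
        have := hc.eventually_ne (y := 0) (by simpa using hx)
        filter_upwards [this.filter_mono nhdsWithin_le_nhds] with ε hε
        rwa [hθ]
    exact (h1.filter_mono nhdsWithin_le_nhds).and h3
  obtain ⟨ε, hε⟩ := h2.exists
  exact ⟨p ε, hε.1, hε.2⟩

/-- The open set consists of the deformations with `H_t ≠ lam L_t`; density comes from adding
multiples of a suitable quadratic term along a vector of `E` transverse to the surface. -/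
theorem NondegenerateLPL.familyPart {c : Configuration} {x : LocalParam} {g : SurfaceGerm}
    (h : NondegenerateLPL c x) (hx : Parametrizes x g) : FamilyPart c g := by
  intro y hy E hE
  obtain ⟨k, hk, e⟩ := exists_reparam hx hy
  obtain ⟨lam, γ, ht, hγ, hneg⟩ := h.comp x.smooth hk e
  refine ⟨{D | D.velocity jetH - lam * D.velocity jetL ≠ 0}, ?_, ?_,
    fun D hD => D.bifurcates ht hγ hneg hD⟩
  · exact isOpen_ne_fun ((Deformation.continuous_velocity contDiff_jetH).sub
      (continuous_const.mul (Deformation.continuous_velocity contDiff_jetL))) continuous_const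
  · obtain ⟨v, hv, hne⟩ := exists_transverse ht.pos hE
    have hδ : jetDisc (planeJet y 0) ≠ 0 := ht.pos.ne'
    have hK : jetK (planeJet y 0) = 0 := ht.K_zero
    have hH : jetH (planeJet y 0) = 0 := ht.H_zero
    -- The constant is `lam` times the factor `4 δ` of `fderiv_jetL_vertJet`.
    obtain ⟨a, b, d, hdir⟩ := exists_quadratic_direction hδ hK (4 * lam * jetDisc (planeJet y 0))
    refine dense_of_affine_paths (θ := fun D : Deformation y E =>
      D.velocity jetH - lam * D.velocity jetL) fun D => ?_
    refine ⟨fun ε => D.addQuadratic hv (ε * a) (ε * b) (ε * d), _,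
      D.continuous_addQuadratic hv a b d, ?_, mul_ne_zero hne hdir, fun ε => ?_⟩
    · have : D.addQuadratic hv (0 * a) (0 * b) (0 * d) = D := by
        cases D
        simp [Deformation.addQuadratic, quadraticFamily]
      simp only [this]
      exact Inseparable.refl D
    · simp only [Deformation.velocity_addQuadratic D hv _ _ _ contDiff_jetH,
        Deformation.velocity_addQuadratic D hv _ _ _ contDiff_jetL, fderiv_jetH_vertJet,
        fderiv_jetL_vertJet hH]
      ring

/-! Openness of the nondegeneracy condition. -/

/-- A vector in the kernel of `dL`. -/
noncomputable def kernelVec (f : Plane → Space) : Plane :=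
  (-fderiv ℝ (lplDisc f) 0 (0, 1), fderiv ℝ (lplDisc f) 0 (1, 0))

/-- The squared norm of the gradient of `L`. -/
noncomputable def gradSq (f : Plane → Space) : ℝ :=
  fderiv ℝ (lplDisc f) 0 (1, 0) ^ 2 + fderiv ℝ (lplDisc f) 0 (0, 1) ^ 2

/-- The product of the gradients of `H` and `L`. -/
noncomputable def gradProd (f : Plane → Space) : ℝ :=
  fderiv ℝ (Hbar f) 0 (1, 0) * fderiv ℝ (lplDisc f) 0 (1, 0) +
    fderiv ℝ (Hbar f) 0 (0, 1) * fderiv ℝ (lplDisc f) 0 (0, 1)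

/-- A polynomial in the jet of `f` whose sign determines the configuration, see
`TangentLPL.exists_tangencyIndex_eq`. -/
noncomputable def tangencyIndex (f : Plane → Space) : ℝ :=
  gradProd f * (gradSq f * fderiv ℝ (fderiv ℝ (Hbar f)) 0 (kernelVec f) (kernelVec f) -
    gradProd f * fderiv ℝ (fderiv ℝ (lplDisc f)) 0 (kernelVec f) (kernelVec f))

theorem continuous_tangencyIndex : Continuous fun x : LocalParam => tangencyIndex x := by
  have hH : JetContinuous fun x : LocalParam => Hbar x :=
    (jetContinuous_localParam.jetOf (1, 0) (0, 1)).comp_left contDiff_jetH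
  have hL : JetContinuous fun x : LocalParam => lplDisc x :=
    (jetContinuous_localParam.jetOf (1, 0) (0, 1)).comp_left contDiff_jetL
  have cH := fun v => (hH.fderiv_apply v).continuous_eval
  have cL := fun v => (hL.fderiv_apply v).continuous_eval
  have cp : Continuous fun x : LocalParam => gradProd x :=
    ((cH _).mul (cL _)).add ((cH _).mul (cL _))
  have cs : Continuous fun x : LocalParam => gradSq x := ((cL _).pow 2).add ((cL _).pow 2)
  have cw : Continuous fun x : LocalParam => kernelVec x := (cL _).neg.prodMk (cL _)
  have c2H := (hH.fderiv.fderiv.continuous_eval.clm_apply cw).clm_apply cw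
  have c2L := (hL.fderiv.fderiv.continuous_eval.clm_apply cw).clm_apply cw
  exact cp.mul ((cs.mul c2H).sub (cp.mul c2L))

theorem fderiv_congr_nhds {V W : Type*} [NormedAddCommGroup V] [NormedSpace ℝ V]
    [NormedAddCommGroup W] [NormedSpace ℝ W] {f g : V → W} {y : V} (h : f =ᶠ[𝓝 y] g) :
    fderiv ℝ f y = fderiv ℝ g y ∧ fderiv ℝ (fderiv ℝ f) y = fderiv ℝ (fderiv ℝ g) y :=
  ⟨h.fderiv_eq, h.fderiv.fderiv_eq⟩

theorem tangencyIndex_congr {f g : Plane → Space} (h : f =ᶠ[𝓝 0] g) :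
    tangencyIndex f = tangencyIndex g := by
  have hj := jetOf_congr (1, 0) (0, 1) h
  have hH : Hbar f =ᶠ[𝓝 0] Hbar g := hj.mono fun q hq => by
    simp only [Hbar_eq]; exact congrArg jetH hq
  have hL : lplDisc f =ᶠ[𝓝 0] lplDisc g := hj.mono fun q hq => by
    simp only [lplDisc_eq]; exact congrArg jetL hq
  simp only [tangencyIndex, gradProd, gradSq, kernelVec, (fderiv_congr_nhds hH).1,
    (fderiv_congr_nhds hH).2, (fderiv_congr_nhds hL).1, (fderiv_congr_nhds hL).2]

theorem gradSq_pos {f : Plane → Space} (h : fderiv ℝ (lplDisc f) 0 ≠ 0) : 0 < gradSq f := by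
  rcases (add_nonneg (sq_nonneg (fderiv ℝ (lplDisc f) 0 (1, 0)))
    (sq_nonneg (fderiv ℝ (lplDisc f) 0 (0, 1)))).lt_or_eq with h1 | h1
  · exact h1
  · exfalso
    apply h
    have e1 : fderiv ℝ (lplDisc f) 0 (1, 0) = 0 := by
      nlinarith [sq_nonneg (fderiv ℝ (lplDisc f) 0 (1, 0)),
        sq_nonneg (fderiv ℝ (lplDisc f) 0 (0, 1))]
    have e2 : fderiv ℝ (lplDisc f) 0 (0, 1) = 0 := by
      nlinarith [sq_nonneg (fderiv ℝ (lplDisc f) 0 (1, 0)),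
        sq_nonneg (fderiv ℝ (lplDisc f) 0 (0, 1))]
    refine ContinuousLinearMap.ext fun v => ?_
    rw [apply_plane, e1, e2]; simp

theorem kernelVec_ne_zero {f : Plane → Space} (h : fderiv ℝ (lplDisc f) 0 ≠ 0) :
    kernelVec f ≠ 0 := by
  intro h1
  have h2 := gradSq_pos h
  simp only [kernelVec, Prod.mk_eq_zero, neg_eq_zero] at h1
  rw [gradSq, h1.1, h1.2] at h2
  simp at h2

theorem fderiv_kernelVec (f : Plane → Space) : fderiv ℝ (lplDisc f) 0 (kernelVec f) = 0 := by
  rw [apply_plane]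
  simp only [kernelVec, smul_eq_mul]
  ring

namespace TangentLPL

variable {f : Plane → Space} {lam : ℝ} {γ : ℝ → Plane}

/-- This recovers `lam` from the gradients up to the positive factor `gradSq`, so that
`tangencyIndex` can be a polynomial in the jet, defined without assuming tangency. -/
theorem gradProd_eq (h : TangentLPL f lam) : gradProd f = lam * gradSq f := by
  simp only [gradProd, gradSq, h.dH_eq, smul_apply, smul_eq_mul]
  ring

/-- Under tangency the index is `lam gradSq²` times the Hessian of `H - lam L` on `kernelVec`. The
velocity of the arc is `μ` times that vector, hence `κ = μ² / gradSq²`. -/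
theorem exists_tangencyIndex_eq (h : TangentLPL f lam) (hf : SmoothNear f 0)
    (hγ : IsRegularArc (lplDisc f) γ) :
    ∃ κ > 0, κ * tangencyIndex f = lam * deriv (deriv (fun s => Hbar f (γ s))) 0 := by
  have hL := smoothNear_lplDisc hf
  obtain ⟨μ, hμ, e⟩ := exists_smul_eq_of_kernel h.dL_ne hγ.2.2.1 (kernelVec_ne_zero h.dL_ne)
    (hγ.fderiv_eq_zero hL) (fderiv_kernelVec f)
  have hN := gradSq_pos h.dL_ne
  have hH := smoothNear_Hbar hf
  have hd : fderiv ℝ (fun y => fderiv ℝ (fun q => Hbar f q - lam * lplDisc f q) y (kernelVec f)) 0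
      (kernelVec f) = fderiv ℝ (fderiv ℝ (Hbar f)) 0 (kernelVec f) (kernelVec f) -
        lam * fderiv ℝ (fderiv ℝ (lplDisc f)) 0 (kernelVec f) (kernelVec f) := by
    have e1 : (fun y => fderiv ℝ (fun q => Hbar f q - lam * lplDisc f q) y (kernelVec f))
        =ᶠ[𝓝 0] fun y => fderiv ℝ (Hbar f) y (kernelVec f) -
          lam * fderiv ℝ (lplDisc f) y (kernelVec f) := by
      filter_upwards [hH, hL] with y h1 h2
      have d : HasFDerivAt (fun q => Hbar f q - lam * lplDisc f q) _ y :=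
        (h1.differentiableAt (by simp)).hasFDerivAt.sub
          ((h2.differentiableAt (by simp)).hasFDerivAt.const_mul lam)
      rw [d.fderiv]; rfl
    have d : HasFDerivAt (fun y => fderiv ℝ (Hbar f) y (kernelVec f) -
        lam * fderiv ℝ (lplDisc f) y (kernelVec f)) _ 0 :=
      (hH.fderiv_apply (kernelVec f)).differentiableAt.hasFDerivAt.sub
        ((hL.fderiv_apply (kernelVec f)).differentiableAt.hasFDerivAt.const_mul lam)
    rw [e1.fderiv_eq, d.fderiv, sub_apply, smul_apply, fderiv_fderiv_apply hH,
      fderiv_fderiv_apply hL, smul_eq_mul]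
  refine ⟨μ ^ 2 / gradSq f ^ 2, by positivity, ?_⟩
  rw [h.deriv_deriv_H_arc hf hγ, e, fderiv_fderiv_smul (smooth_diff hf lam), hd, tangencyIndex,
    h.gradProd_eq]
  field_simp

theorem nondegenerateLPL (h : TangentLPL f lam) (hf : SmoothNear f 0) {c : Configuration}
    (hc : c.sign * tangencyIndex f < 0) : NondegenerateLPL c f := by
  obtain ⟨γ, hγ⟩ := exists_regularArc (smoothNear_lplDisc hf) h.L_zero h.dL_ne
  obtain ⟨κ, hκ, e⟩ := h.exists_tangencyIndex_eq hf hγ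
  refine ⟨lam, γ, h, hγ, ?_⟩
  rw [mul_assoc, ← e]
  nlinarith

theorem exists_nondegenerateLPL (h : TangentLPL f lam) (hf : SmoothNear f 0)
    (hc : tangencyIndex f ≠ 0) : ∃ c, NondegenerateLPL c f := by
  rcases lt_or_gt_of_ne hc with h1 | h1
  · exact ⟨.sameSide, h.nondegenerateLPL hf (by simpa [Configuration.sign] using h1)⟩
  · exact ⟨.oppositeSides, h.nondegenerateLPL hf (by simpa [Configuration.sign] using h1)⟩

/-- The converse direction of the criterion: with `dH ≠ 0`, a zero index forces `H'' = 0` along the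
LPL, that is, contact of order at least 3 with the MCNC. -/
theorem tangencyIndex_ne_zero (h : TangentLPL f lam) (hf : SmoothNear f 0)
    (hH : fderiv ℝ (Hbar f) 0 ≠ 0) (hc : contactOrder (lplDisc f) (Hbar f) = 2) :
    tangencyIndex f ≠ 0 := by
  intro h0
  obtain ⟨γ, hγ⟩ := exists_regularArc (smoothNear_lplDisc hf) h.L_zero h.dL_ne
  obtain ⟨κ, hκ, e⟩ := h.exists_tangencyIndex_eq hf hγ
  rw [h0, mul_zero] at e
  have hlam : lam ≠ 0 := by
    rintro rfl
    apply hH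
    rw [h.dH_eq, zero_smul]
  have h2 := (mul_eq_zero.1 e.symm).resolve_left hlam
  have h1 : ((3 : ℕ) : ℕ∞) ≤ contactOrder (lplDisc f) (Hbar f) := by
    refine le_iSup₂ (f := fun (k : ℕ) (_ : k ∈ {k : ℕ | ∃ γ : ℝ → Plane,
      IsRegularArc (lplDisc f) γ ∧ ∀ j < k, iteratedDeriv j (Hbar f ∘ γ) 0 = 0}) => (k : ℕ∞)) 3
      ⟨γ, hγ, fun j hj => ?_⟩
    interval_cases j
    · rw [iteratedDeriv_zero, Function.comp_apply, hγ.2.1, h.H_zero]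
    · rw [iteratedDeriv_one]
      exact h.deriv_H_arc hf hγ
    · rw [iteratedDeriv_two]
      exact h2
  rw [hc] at h1
  exact absurd h1 (by norm_num)

end TangentLPL

/-! ### Passage to the quotient space of surface germs. -/

/-- A change of parameters. -/
def LocalParam.comp (x : LocalParam) {h : Plane → Plane} (hh : IsDiffeoGerm h) : LocalParam where
  toFun := x.toFun ∘ h
  smooth := x.smooth.comp_of_eq hh.1 hh.2.1
  immersion := by
    obtain ⟨hs, h0, k, ks, k0, hkh, hhk⟩ := hh
    have h1 : HasFDerivAt x.toFun (fderiv ℝ x.toFun 0) (h 0) := by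
      rw [h0]; exact x.smooth.differentiableAt.hasFDerivAt
    rw [(h1.comp 0 hs.differentiableAt.hasFDerivAt).fderiv]
    exact x.immersion.comp (Function.LeftInverse.injective
      (g := fderiv ℝ k 0) (fderiv_comp_eq_id hs h0 ks hkh))

theorem LocalParam.continuous_comp {h : Plane → Plane} (hh : IsDiffeoGerm h) :
    Continuous fun x : LocalParam => x.comp hh :=
  continuous_localParam (jetContinuous_localParam.comp_right hh.1 hh.2.1)

theorem parametrizes_comp {x : LocalParam} {g : SurfaceGerm} (hx : Parametrizes x g)
    {h : Plane → Plane} (hh : IsDiffeoGerm h) : Parametrizes (x.comp hh) g := by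
  rw [← hx]
  exact (Quotient.sound (s := paramSetoid) ⟨h, hh, EventuallyEq.rfl⟩).symm

/-- Composition with a fixed change of parameters is continuous, so the saturation of an open set is
open. The congruence hypothesis is needed because a `LocalParam` is a map, not a germ:
reparametrized representatives agree only near the origin. -/
theorem isOpen_image_of_congr {O : Set LocalParam} (hO : IsOpen O)
    (hcongr : ∀ x y : LocalParam, x.toFun =ᶠ[𝓝 0] y.toFun → x ∈ O → y ∈ O) :
    IsOpen {g : SurfaceGerm | ∃ x ∈ O, Parametrizes x g} := by
  refine isOpen_coinduced.2 (isOpen_iff_mem_nhds.2 ?_)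
  rintro y ⟨x, hx, hxy⟩
  obtain ⟨h, hh, e⟩ := exists_reparam (x := y) (y := x) rfl hxy
  have hy : y.comp hh ∈ O := hcongr _ _ e hx
  refine mem_of_superset ((hO.preimage (LocalParam.continuous_comp hh)).mem_nhds hy) ?_
  intro z hz
  exact ⟨z.comp hh, hz, parametrizes_comp rfl hh⟩

theorem exists_parametrizes (g : SurfaceGerm) : ∃ x, Parametrizes x g := Quotient.exists_rep g

/-- The forward direction needs only that the MCNC is regular and has contact of order 2; the
converse gets everything from the sign of the index. -/
theorem generic_iff {x : LocalParam} {g : SurfaceGerm} (hx : Parametrizes x g) {lam : ℝ}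
    (ht : TangentLPL x lam) :
    (∃ c : Configuration, StaticPart c g ∧ FamilyPart c g) ↔ tangencyIndex x ≠ 0 := by
  constructor
  · rintro ⟨c, hs, -⟩
    obtain ⟨-, h2, h3⟩ := hs x hx
    exact ht.tangencyIndex_ne_zero x.smooth h3.2.1 h2
  · intro h
    obtain ⟨c, hc⟩ := ht.exists_nondegenerateLPL x.smooth h
    exact ⟨c, hc.staticPart hx, hc.familyPart hx⟩

theorem isOpen_generic :
    IsOpen {g : G1 | ∃ c : Configuration, StaticPart c g ∧ FamilyPart c g} := by
  have hO : IsOpen {g : SurfaceGerm | ∃ x ∈ {x : LocalParam | tangencyIndex x ≠ 0},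
      Parametrizes x g} := by
    refine isOpen_image_of_congr (isOpen_ne_fun continuous_tangencyIndex continuous_const) ?_
    intro x y h hx
    rwa [Set.mem_ofPred_eq, ← tangencyIndex_congr h]
  convert hO.preimage continuous_subtype_val using 1
  ext ⟨g, hg⟩
  constructor
  · intro h
    obtain ⟨x, hx⟩ := exists_parametrizes g
    obtain ⟨lam, ht⟩ := (mem_G1_iff hx).1 hg
    exact ⟨x, (generic_iff hx ht).1 h, hx⟩
  · rintro ⟨x, hx, hxg⟩
    obtain ⟨lam, ht⟩ := (mem_G1_iff hxg).1 hg
    exact (generic_iff hxg ht).2 hx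

/-! Parametrizations along null directions. -/

/-- The coordinate directions are null, and the second fundamental form is a multiple of `du²`. -/
structure NullJet (j : Jet) : Prop where
  E_zero : jetE j = 0
  G_zero : jetG j = 0
  m_zero : jetm j = 0
  n_zero : jetn j = 0

theorem NullJet.jetH_eq {j : Jet} (h : NullJet j) : jetH j = 0 := by
  rw [jetH, h.G_zero, h.m_zero, h.n_zero]; ring

theorem NullJet.jetL_eq {j : Jet} (h : NullJet j) : jetL j = 0 := by
  rw [jetL, h.G_zero, h.m_zero, h.n_zero]; ring

theorem NullJet.jetF_ne {j : Jet} (h : NullJet j) (hδ : 0 < jetDisc j) : jetF j ≠ 0 := by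
  intro h0
  rw [jetDisc, h.E_zero, h0] at hδ
  simp at hδ

/-- The linear map of the plane with columns `(a, b)` and `(c, d)`. -/
def linearChange (a b c d : ℝ) (q : Plane) : Plane := (a * q.1 + c * q.2, b * q.1 + d * q.2)

theorem contDiff_linearChange (a b c d : ℝ) : ContDiff ℝ ∞ (linearChange a b c d) := by
  unfold linearChange; fun_prop

theorem linearChange_comp {a b c d J : ℝ} (hJ : a * d - b * c = J) (h : J ≠ 0) (q : Plane) :
    linearChange (d / J) (-b / J) (-c / J) (a / J) (linearChange a b c d q) = q := by
  refine Prod.ext ?_ ?_ <;> simp only [linearChange] <;> field_simp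
  · linear_combination q.1 * hJ
  · linear_combination q.2 * hJ

theorem linearChange_comp' {a b c d J : ℝ} (hJ : a * d - b * c = J) (h : J ≠ 0) (q : Plane) :
    linearChange a b c d (linearChange (d / J) (-b / J) (-c / J) (a / J) q) = q := by
  refine Prod.ext ?_ ?_ <;> simp only [linearChange] <;> field_simp
  · linear_combination q.1 * hJ
  · linear_combination q.2 * hJ

theorem isDiffeoGerm_linearChange {a b c d : ℝ} (h : a * d - b * c ≠ 0) :
    IsDiffeoGerm (linearChange a b c d) :=
  ⟨smoothNear_of_contDiff (contDiff_linearChange a b c d) 0, by simp [linearChange], _,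
    smoothNear_of_contDiff (contDiff_linearChange _ _ _ _) 0, by simp [linearChange],
    .of_forall (linearChange_comp rfl h), .of_forall (linearChange_comp' rfl h)⟩

theorem fderiv_linearChange (a b c d : ℝ) (v : Plane) :
    fderiv ℝ (linearChange a b c d) 0 v = linearChange a b c d v := by
  let T : Plane →L[ℝ] Plane := LinearMap.toContinuousLinearMap
    { toFun := linearChange a b c d
      map_add' := fun p q => by
        refine Prod.ext ?_ ?_ <;> simp [linearChange] <;> ring
      map_smul' := fun r q => by
        refine Prod.ext ?_ ?_ <;> simp [linearChange] <;> ring }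
  exact congrArg (fun S : Plane →L[ℝ] Plane => S v) (T.hasFDerivAt (x := 0)).fderiv

theorem exists_null_directions {j : Jet} (hδ : 0 < jetDisc j) : ∃ a b c d : ℝ,
    a * d - b * c ≠ 0 ∧ a ^ 2 * jetE j + 2 * a * b * jetF j + b ^ 2 * jetG j = 0 ∧
      c ^ 2 * jetE j + 2 * c * d * jetF j + d ^ 2 * jetG j = 0 := by
  by_cases hE : jetE j = 0
  · have hF : jetF j ≠ 0 := by
      intro hF
      rw [jetDisc, hE, hF] at hδ
      simp at hδ
    -- For `E = 0` the direction `(1, 0)` is null, and `(-G, 2F)` solves the remaining linear factor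
    -- `2 c F + d G = 0`.
    refine ⟨1, 0, -jetG j, 2 * jetF j, by simpa using hF, by rw [hE]; ring, by rw [hE]; ring⟩
  · have hs := Real.sq_sqrt hδ.le
    have hs0 := (Real.sqrt_pos.2 hδ).ne'
    set s := √(jetDisc j)
    rw [jetDisc] at hs
    refine ⟨-jetF j + s, jetE j, -jetF j - s, jetE j, ?_, ?_, ?_⟩
    · rw [show (-jetF j + s) * jetE j - jetE j * (-jetF j - s) = 2 * s * jetE j by ring]
      exact mul_ne_zero (mul_ne_zero two_ne_zero hs0) hE
    · linear_combination jetE j * hs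
    · linear_combination jetE j * hs

/-- Along null directions `E = G = 0` and `H = -2 m F` with `F ≠ 0`, so `H = 0` gives `m = 0`. Then
`K = l n = 0`, and the two directions are exchanged if it is `l` that vanishes. -/
theorem exists_reparam_nullJet {j : Jet} (hδ : 0 < jetDisc j) (hH : jetH j = 0) (hK : jetK j = 0) :
    ∃ a b c d : ℝ, a * d - b * c ≠ 0 ∧
      ∀ k₁ k₂ k₃ k₄ k₅ k₆, NullJet (reparamJet j a b c d k₁ k₂ k₃ k₄ k₅ k₆) := by
  obtain ⟨a, b, c, d, hJ, h1, h2⟩ := exists_null_directions hδ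
  set J := a * d - b * c with hJdef
  have hm : a * c * jetl j + (a * d + b * c) * jetm j + b * d * jetn j = 0 := by
    have e1 := jetH_reparam j a b c d 0 0 0 0 0 0
    have e2 := jetDisc_reparam j a b c d 0 0 0 0 0 0
    rw [jetH, jetE_reparam, jetG_reparam, jetF_reparam, jetm_reparam, h1, h2, hH] at e1
    rw [jetDisc, jetE_reparam, jetG_reparam, jetF_reparam, h1, h2] at e2
    have hF : a * c * jetE j + (a * d + b * c) * jetF j + b * d * jetG j ≠ 0 := by
      intro h0
      rw [h0] at e2
      have : (a * d - b * c) ^ 2 * jetDisc j = 0 := by rw [← e2]; ring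
      exact (mul_ne_zero (pow_ne_zero 2 hJ) hδ.ne') this
    have : J * (a * c * jetl j + (a * d + b * c) * jetm j + b * d * jetn j) *
        (a * c * jetE j + (a * d + b * c) * jetF j + b * d * jetG j) = 0 := by
      linear_combination -e1 / 2
    exact (mul_eq_zero.1 ((mul_eq_zero.1 this).resolve_right hF)).resolve_left hJ
  have hln : (a ^ 2 * jetl j + 2 * a * b * jetm j + b ^ 2 * jetn j) *
      (c ^ 2 * jetl j + 2 * c * d * jetm j + d ^ 2 * jetn j) = 0 := by
    rw [jetK] at hK
    linear_combination (a * c * jetl j + (a * d + b * c) * jetm j + b * d * jetn j) * hm +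
      (a * d - b * c) ^ 2 * hK
  rcases mul_eq_zero.1 hln with h | h
  · refine ⟨c, d, a, b, fun h0 => hJ (by rw [hJdef]; linear_combination -h0),
      fun k₁ k₂ k₃ k₄ k₅ k₆ => ⟨?_, ?_, ?_, ?_⟩⟩
    · rw [jetE_reparam, h2]
    · rw [jetG_reparam, h1]
    · rw [jetm_reparam]; linear_combination (c * b - d * a) * hm
    · rw [jetn_reparam, h, mul_zero]
  · refine ⟨a, b, c, d, hJ, fun k₁ k₂ k₃ k₄ k₅ k₆ => ⟨?_, ?_, ?_, ?_⟩⟩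
    · rw [jetE_reparam, h1]
    · rw [jetG_reparam, h2]
    · rw [jetm_reparam, hm, mul_zero]
    · rw [jetn_reparam, h, mul_zero]

theorem TangentLPL.exists_null_parametrization {x : LocalParam} {g : SurfaceGerm} {lam : ℝ}
    (hx : Parametrizes x g) (ht : TangentLPL x lam) : ∃ (y : LocalParam) (mu : ℝ),
      Parametrizes y g ∧ TangentLPL y mu ∧ NullJet (planeJet y 0) := by
  obtain ⟨a, b, c, d, hJ, hnull⟩ := exists_reparam_nullJet (j := planeJet x 0) ht.pos ht.H_zero
    ht.K_zero
  have hh := isDiffeoGerm_linearChange hJ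
  refine ⟨x.comp hh, _, parametrizes_comp hx hh, ht.comp x.smooth hh EventuallyEq.rfl, ?_⟩
  have h0 : linearChange a b c d 0 = 0 := hh.2.1
  obtain ⟨k₁, k₂, k₃, k₄, k₅, k₆, e⟩ := planeJet_comp (x := x) (h := linearChange a b c d) (q := 0)
    (by rw [h0]; exact x.smooth) hh.1
  rw [h0, fderiv_linearChange, fderiv_linearChange] at e
  simp only [linearChange, mul_one, mul_zero, add_zero, zero_add] at e
  change NullJet (planeJet (x.toFun ∘ linearChange a b c d) 0)
  rw [e]
  exact hnull _ _ _ _ _ _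

/-! Perturbations of order three and four along the normal. -/

/-- `β u²v/2 + κ uv²/2 + p u³v/6 + r uv³/6`. -/
noncomputable def bump (β κ p r : ℝ) (q : Plane) : ℝ :=
  β * (q.1 ^ 2 * q.2 / 2) + κ * (q.1 * q.2 ^ 2 / 2) + p * (q.1 ^ 3 * q.2 / 6) +
    r * (q.1 * q.2 ^ 3 / 6)

theorem contDiff_bump (β κ p r : ℝ) : ContDiff ℝ ∞ (bump β κ p r) := by
  unfold bump; fun_prop

/-- The jet of the perturbation. -/
noncomputable def bumpJet (e : Space) (β κ p r : ℝ) (q : Plane) : Jet :=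
  ((β * q.1 * q.2 + κ * q.2 ^ 2 / 2 + p * q.1 ^ 2 * q.2 / 2 + r * q.2 ^ 3 / 6) • e,
    (β * q.1 ^ 2 / 2 + κ * q.1 * q.2 + p * q.1 ^ 3 / 6 + r * q.1 * q.2 ^ 2 / 2) • e,
    (β * q.2 + p * q.1 * q.2) • e,
    (β * q.1 + κ * q.2 + p * q.1 ^ 2 / 2 + r * q.2 ^ 2 / 2) • e,
    (κ * q.1 + r * q.1 * q.2) • e)

theorem planeJet_bump (e : Space) (β κ p r : ℝ) (q : Plane) :
    planeJet (fun q => bump β κ p r q • e) q = bumpJet e β κ p r q := by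
  have hd : ∀ q, DifferentiableAt ℝ (bump β κ p r) q := fun q =>
    (contDiff_bump β κ p r).differentiable (by simp) q
  refine jetOf_smul_const
    (φa := fun q : Plane =>
      β * q.1 * q.2 + κ * q.2 ^ 2 / 2 + p * q.1 ^ 2 * q.2 / 2 + r * q.2 ^ 3 / 6)
    (φb := fun q : Plane =>
      β * q.1 ^ 2 / 2 + κ * q.1 * q.2 + p * q.1 ^ 3 / 6 + r * q.1 * q.2 ^ 2 / 2)
    (φaa := fun q : Plane => β * q.2 + p * q.1 * q.2)
    (φab := fun q : Plane => β * q.1 + κ * q.2 + p * q.1 ^ 2 / 2 + r * q.2 ^ 2 / 2)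
    (φbb := fun q : Plane => κ * q.1 + r * q.1 * q.2)
    (contDiff_bump β κ p r) (fun q => ?_) (fun q => ?_) (fun q => ?_) (fun q => ?_)
    (fun q => ?_) e q
  · refine fderiv_eq_of_line (a := bump β κ p r q) (c := β * q.2 / 2 + p * q.1 * q.2 / 2)
      (d := p * q.2 / 6) (k := 0) (hd q) fun s => ?_
    simp [bump]; ring
  · refine fderiv_eq_of_line (a := bump β κ p r q) (c := κ * q.1 / 2 + r * q.1 * q.2 / 2)
      (d := r * q.1 / 6) (k := 0) (hd q) fun s => ?_
    simp [bump]; ring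
  · refine fderiv_eq_of_line
      (a := β * q.1 * q.2 + κ * q.2 ^ 2 / 2 + p * q.1 ^ 2 * q.2 / 2 + r * q.2 ^ 3 / 6)
      (c := p * q.2 / 2) (d := 0) (k := 0) (by fun_prop) fun s => ?_
    simp; ring
  · refine fderiv_eq_of_line
      (a := β * q.1 * q.2 + κ * q.2 ^ 2 / 2 + p * q.1 ^ 2 * q.2 / 2 + r * q.2 ^ 3 / 6)
      (c := κ / 2 + r * q.2 / 2) (d := r / 6) (k := 0) (by fun_prop) fun s => ?_
    simp; ring
  · refine fderiv_eq_of_line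
      (a := β * q.1 ^ 2 / 2 + κ * q.1 * q.2 + p * q.1 ^ 3 / 6 + r * q.1 * q.2 ^ 2 / 2)
      (c := r * q.1 / 2) (d := 0) (k := 0) (by fun_prop) fun s => ?_
    simp; ring

theorem bumpJet_zero (e : Space) (β κ p r : ℝ) : bumpJet e β κ p r 0 = 0 := by
  simp [bumpJet]

theorem contDiff_bumpJet (e : Space) (β κ p r : ℝ) : ContDiff ℝ ∞ (bumpJet e β κ p r) := by
  unfold bumpJet
  fun_prop

/-- The part linear in `s` comes only from the cubic coefficients `β, κ`. The quartic coefficients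
`p, r` enter the second-order components only at order `s²`. -/
theorem bumpJet_line (e : Space) (β κ p r : ℝ) (v : Plane) (s : ℝ) :
    bumpJet e β κ p r (s • v) =
      s • vertJet e (β * v.2) (β * v.1 + κ * v.2) (κ * v.1) +
      s ^ 2 • ((β * v.1 * v.2 + κ * v.2 ^ 2 / 2) • e, (β * v.1 ^ 2 / 2 + κ * v.1 * v.2) • e,
        (p * v.1 * v.2) • e, (p * v.1 ^ 2 / 2 + r * v.2 ^ 2 / 2) • e, (r * v.1 * v.2) • e) +
      s ^ 3 • ((p * v.1 ^ 2 * v.2 / 2 + r * v.2 ^ 3 / 6) • e,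
        (p * v.1 ^ 3 / 6 + r * v.1 * v.2 ^ 2 / 2) • e, 0, 0, 0) := by
  simp only [bumpJet, vertJet, Prod.smul_mk, Prod.mk_add_mk, smul_smul, ← add_smul, smul_zero,
    zero_add, add_zero, Prod.smul_fst, Prod.smul_snd, smul_eq_mul]
  refine Prod.ext ?_ (Prod.ext ?_ (Prod.ext ?_ (Prod.ext ?_ ?_))) <;> dsimp only <;> congr 1 <;>
    ring

theorem hasDerivAt_cubic {V : Type*} [NormedAddCommGroup V] [NormedSpace ℝ V] (a b c : V) (s : ℝ) :
    HasDerivAt (fun s : ℝ => s • a + s ^ 2 • b + s ^ 3 • c)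
      (a + (2 * s) • b + (3 * s ^ 2) • c) s := by
  have h : HasDerivAt (fun s : ℝ => s • a + s ^ 2 • b + s ^ 3 • c) _ s :=
    (((hasDerivAt_id s).smul_const a).add ((hasDerivAt_pow 2 s).smul_const b)).add
      ((hasDerivAt_pow 3 s).smul_const c)
  simpa using h

theorem deriv_deriv_cubic {V : Type*} [NormedAddCommGroup V] [NormedSpace ℝ V] (a b c : V) :
    deriv (deriv fun s : ℝ => s • a + s ^ 2 • b + s ^ 3 • c) 0 = (2 : ℝ) • b := by
  rw [funext fun s => (hasDerivAt_cubic a b c s).deriv]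
  have h : HasDerivAt (fun s : ℝ => a + (2 * s) • b + (3 * s ^ 2) • c)
      ((0 : V) + ((2 : ℝ) * 1) • b + ((3 : ℝ) * ((2 : ℕ) * (0 : ℝ) ^ (2 - 1))) • c) 0 :=
    ((hasDerivAt_const (0 : ℝ) a).add (((hasDerivAt_id (0 : ℝ)).const_mul 2).smul_const b)).add
      (((hasDerivAt_pow 2 (0 : ℝ)).const_mul 3).smul_const c)
  rw [h.deriv]; simp

theorem deriv_deriv_add {V : Type*} [NormedAddCommGroup V] [NormedSpace ℝ V] {f g : ℝ → V}
    {s : ℝ} (hf : SmoothNear f s) (hg : SmoothNear g s) :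
    deriv (fun r => f r + g r) s = deriv f s + deriv g s ∧
      deriv (deriv fun r => f r + g r) s = deriv (deriv f) s + deriv (deriv g) s := by
  refine ⟨deriv_fun_add hf.differentiableAt hg.differentiableAt, ?_⟩
  have e : (deriv fun r => f r + g r) =ᶠ[𝓝 s] fun r => deriv f r + deriv g r := by
    filter_upwards [hf, hg] with r h1 h2
    exact deriv_fun_add (h1.differentiableAt (by simp)) (h2.differentiableAt (by simp))
  rw [e.deriv_eq]
  exact deriv_fun_add hf.deriv.differentiableAt hg.deriv.differentiableAt

theorem fderiv_fderiv_eq_line {F : Plane → ℝ} (hF : SmoothNear F 0) (w : Plane) :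
    fderiv ℝ (fderiv ℝ F) 0 w w = deriv (deriv fun s : ℝ => F (s • w)) 0 := by
  have hγ : SmoothNear (fun s : ℝ => s • w) 0 := smoothNear_of_contDiff (by fun_prop) 0
  have h1 : deriv (fun s : ℝ => s • w) = fun _ => w := funext fun s => by
    simpa using ((hasDerivAt_id s).smul_const w).deriv
  have h := deriv_deriv_comp (Z := F) (γ := fun s : ℝ => s • w) (s := 0) (by simpa using hF) hγ
  rw [h, h1, ← fderiv_fderiv_apply hF]
  simp

theorem smoothNear_bump (β κ p r : ℝ) (e : Space) :
    SmoothNear (fun q => bump β κ p r q • e) 0 :=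
  smoothNear_of_contDiff ((contDiff_bump β κ p r).smul contDiff_const) 0

theorem fderiv_bump (β κ p r : ℝ) (e : Space) :
    fderiv ℝ (fun q => bump β κ p r q • e) 0 = 0 := by
  refine ContinuousLinearMap.ext fun v => ?_
  have h := planeJet_bump e β κ p r 0
  rw [bumpJet_zero] at h
  have h1 : fderiv ℝ (fun q => bump β κ p r q • e) 0 (1, 0) = 0 := congrArg Prod.fst h
  have h2 : fderiv ℝ (fun q => bump β κ p r q • e) 0 (0, 1) = 0 :=
    congrArg (fun j : Jet => j.2.1) h
  rw [apply_plane, h1, h2]; simp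

namespace LocalParam

/-- The perturbation of a parametrization in the direction `e`. -/
noncomputable def perturb (x : LocalParam) (e : Space) (β κ p r : ℝ) : LocalParam where
  toFun q := x q + bump β κ p r q • e
  smooth := x.smooth.add (smoothNear_bump β κ p r e)
  immersion := by
    rw [fderiv_fun_add x.smooth.differentiableAt (smoothNear_bump β κ p r e).differentiableAt,
      fderiv_bump, add_zero]
    exact x.immersion

variable (x : LocalParam) (e : Space) (β κ p r : ℝ)

theorem planeJet_perturb :
    planeJet (x.perturb e β κ p r) =ᶠ[𝓝 0] fun q => planeJet x q + bumpJet e β κ p r q := by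
  filter_upwards [x.smooth.eventually] with q hq
  rw [← planeJet_bump]
  exact jetOf_add (1, 0) (0, 1) hq
    (smoothNear_of_contDiff ((contDiff_bump β κ p r).smul contDiff_const) q)

theorem planeJet_perturb_zero : planeJet (x.perturb e β κ p r) 0 = planeJet x 0 := by
  have h : planeJet (x.perturb e β κ p r) 0 = planeJet x 0 + bumpJet e β κ p r 0 :=
    (planeJet_perturb x e β κ p r).self_of_nhds
  rw [h, bumpJet_zero, add_zero]

theorem continuous_perturb {X : Type*} [TopologicalSpace X] {β κ p r : X → ℝ}
    (hβ : Continuous β) (hκ : Continuous κ) (hp : Continuous p) (hr : Continuous r) :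
    Continuous fun z => x.perturb e (β z) (κ z) (p z) (r z) := by
  apply continuous_localParam
  have s1 := smoothNear_bump 1 0 0 0 e
  have s2 := smoothNear_bump 0 1 0 0 e
  have s3 := smoothNear_bump 0 0 1 0 e
  have s4 := smoothNear_bump 0 0 0 1 e
  have h := (JetContinuous.const x.smooth).add ((((JetContinuous.smul_const hβ s1).add
    (JetContinuous.smul_const hκ s2)).add (JetContinuous.smul_const hp s3)).add
      (JetContinuous.smul_const hr s4))
  convert h using 4 with z q
  change x q + bump (β z) (κ z) (p z) (r z) q • e = _
  simp only [smul_smul, ← add_smul, bump]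
  congr 2
  ring

theorem perturb_zero : x.perturb e 0 0 0 0 = x := by
  cases x
  simp [perturb, bump]

theorem fderiv_jet_perturb {P : Jet → ℝ} (hP : ContDiff ℝ ∞ P) (v : Plane) :
    fderiv ℝ (fun q => P (planeJet (x.perturb e β κ p r) q)) 0 v =
      fderiv ℝ (fun q => P (planeJet x q)) 0 v +
        fderiv ℝ P (planeJet x 0) (vertJet e (β * v.2) (β * v.1 + κ * v.2) (κ * v.1)) := by
  have hx := (smoothNear_jetOf (1, 0) (0, 1) x.smooth).differentiableAt
  have hP0 : HasFDerivAt P (fderiv ℝ P (planeJet x 0)) (planeJet x 0) :=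
    (hP.differentiable (by simp) _).hasFDerivAt
  have hb : DifferentiableAt ℝ (bumpJet e β κ p r) 0 :=
    (contDiff_bumpJet e β κ p r).differentiable (by simp) 0
  have e1 : (fun q => P (planeJet (x.perturb e β κ p r) q)) =ᶠ[𝓝 0]
      fun q => P (planeJet x q + bumpJet e β κ p r q) :=
    (planeJet_perturb x e β κ p r).mono fun q hq => by simp only [hq]
  have d1 : HasFDerivAt (fun q => P (planeJet x q)) _ 0 := hP0.comp 0 hx.hasFDerivAt
  have hP1 : HasFDerivAt P (fderiv ℝ P (planeJet x 0)) (planeJet x 0 + bumpJet e β κ p r 0) := by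
    rw [bumpJet_zero, add_zero]; exact hP0
  have d2 : HasFDerivAt (fun q => P (planeJet x q + bumpJet e β κ p r q)) _ 0 :=
    hP1.comp (f := fun q => planeJet x q + bumpJet e β κ p r q) 0 (hx.hasFDerivAt.add hb.hasFDerivAt)
  have e2 : fderiv ℝ (bumpJet e β κ p r) 0 v =
      vertJet e (β * v.2) (β * v.1 + κ * v.2) (κ * v.1) := by
    rw [fderiv_eq_deriv_line hb]
    simp only [zero_add, bumpJet_line]
    rw [(hasDerivAt_cubic _ _ _ 0).deriv]
    simp
  rw [e1.fderiv_eq, d1.fderiv, d2.fderiv, ← e2, ContinuousLinearMap.comp_apply,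
    ContinuousLinearMap.comp_apply, add_apply, map_add]

/-- A quartic perturbation changes neither the value nor the velocity of the jet along a line. Only
its acceleration changes, and this enters through the differential of `P`. -/
theorem fderiv_fderiv_jet_perturb {P : Jet → ℝ} (hP : ContDiff ℝ ∞ P) (w : Plane) :
    fderiv ℝ (fderiv ℝ (fun q => P (planeJet (x.perturb e 0 0 p r) q))) 0 w w =
      fderiv ℝ (fderiv ℝ (fun q => P (planeJet x q))) 0 w w +
        fderiv ℝ P (planeJet x 0) (vertJet e (2 * p * w.1 * w.2) (p * w.1 ^ 2 + r * w.2 ^ 2)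
          (2 * r * w.1 * w.2)) := by
  have hl : SmoothNear (fun s : ℝ => s • w) 0 := smoothNear_of_contDiff (by fun_prop) 0
  have l0 : (0 : ℝ) • w = 0 := zero_smul ℝ w
  have hγ : SmoothNear (fun s : ℝ => planeJet x (s • w)) 0 :=
    (smoothNear_jetOf (1, 0) (0, 1) x.smooth).comp_of_eq hl l0
  have hb : SmoothNear (fun s : ℝ => bumpJet e 0 0 p r (s • w)) 0 :=
    (smoothNear_of_contDiff (contDiff_bumpJet e 0 0 p r) 0).comp_of_eq hl l0
  rw [fderiv_fderiv_eq_line (smoothNear_jet hP (1, 0) (0, 1) x.smooth),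
    fderiv_fderiv_eq_line (smoothNear_jet hP (1, 0) (0, 1) (x.perturb e 0 0 p r).smooth)]
  have tl : Tendsto (fun s : ℝ => s • w) (𝓝 0) (𝓝 0) := by
    have := hl.continuousAt.tendsto
    rwa [l0] at this
  have e1 : (fun s : ℝ => P (planeJet (x.perturb e 0 0 p r) (s • w))) =ᶠ[𝓝 0]
      fun s => P (planeJet x (s • w) + bumpJet e 0 0 p r (s • w)) :=
    (tl.eventually (planeJet_perturb x e 0 0 p r)).mono fun s hs => by simp only [hs]
  rw [e1.deriv.deriv_eq]
  rw [deriv_deriv_comp (γ := fun s : ℝ => planeJet x (s • w)) (smoothNear_of_contDiff hP _) hγ,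
    deriv_deriv_comp (γ := fun s : ℝ => planeJet x (s • w) + bumpJet e 0 0 p r (s • w))
      (smoothNear_of_contDiff hP _) (hγ.add hb), (deriv_deriv_add hγ hb).1,
      (deriv_deriv_add hγ hb).2]
  have b1 : deriv (fun s : ℝ => bumpJet e 0 0 p r (s • w)) 0 = 0 := by
    simp only [bumpJet_line]
    rw [(hasDerivAt_cubic _ _ _ 0).deriv]
    simp [vertJet]
  have b2 : deriv (deriv fun s : ℝ => bumpJet e 0 0 p r (s • w)) 0 =
      vertJet e (2 * p * w.1 * w.2) (p * w.1 ^ 2 + r * w.2 ^ 2) (2 * r * w.1 * w.2) := by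
    simp only [bumpJet_line]
    rw [deriv_deriv_cubic]
    simp only [vertJet, Prod.smul_mk, smul_smul]
    refine Prod.ext ?_ (Prod.ext ?_ (Prod.ext ?_ (Prod.ext ?_ ?_))) <;> dsimp only
    · simp
    · simp
    all_goals congr 1; ring
  rw [b1, b2]
  simp only [l0, bumpJet_zero, add_zero, map_add, add_assoc]

end LocalParam

/-- The normal vector at the origin. -/
noncomputable def normalVec (x : LocalParam) : Space :=
  cross (planeJet x 0).1 (planeJet x 0).2.1

namespace LocalParam

variable {x : LocalParam}

/-- In null parameters `H` responds only to the mixed second derivative of the perturbation, and `L`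
only to the derivative in the direction `vv`. This separation makes it possible to steer `dH` and
`dL`. -/
theorem fderiv_Hbar_perturb (hn : NullJet (planeJet x 0)) (β κ p r : ℝ) (v : Plane) :
    fderiv ℝ (Hbar (x.perturb (normalVec x) β κ p r)) 0 v = fderiv ℝ (Hbar x) 0 v -
      2 * metricDisc x 0 * jetF (planeJet x 0) * (β * v.1 + κ * v.2) := by
  rw [Hbar_eq, fderiv_jet_perturb _ _ _ _ _ _ contDiff_jetH, fderiv_jetH_vertJet, normalVec,
    mink_cross_self, hn.E_zero, hn.G_zero, Hbar_eq, metricDisc_eq]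
  ring

theorem fderiv_lplDisc_perturb (hn : NullJet (planeJet x 0)) (β κ p r : ℝ) (v : Plane) :
    fderiv ℝ (lplDisc (x.perturb (normalVec x) β κ p r)) 0 v = fderiv ℝ (lplDisc x) 0 v +
      4 * metricDisc x 0 ^ 2 * jetl (planeJet x 0) * κ * v.1 := by
  rw [lplDisc_eq, fderiv_jet_perturb _ _ _ _ _ _ contDiff_jetL, fderiv_jetL_vertJet hn.jetH_eq,
    normalVec, mink_cross_self, hn.m_zero, hn.n_zero, lplDisc_eq, metricDisc_eq]
  ring

theorem fderiv_fderiv_Hbar_perturb (hn : NullJet (planeJet x 0)) (p r : ℝ) (w : Plane) :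
    fderiv ℝ (fderiv ℝ (Hbar (x.perturb (normalVec x) 0 0 p r))) 0 w w =
      fderiv ℝ (fderiv ℝ (Hbar x)) 0 w w -
        2 * metricDisc x 0 * jetF (planeJet x 0) * (p * w.1 ^ 2 + r * w.2 ^ 2) := by
  rw [Hbar_eq, fderiv_fderiv_jet_perturb _ _ _ _ contDiff_jetH, fderiv_jetH_vertJet, normalVec,
    mink_cross_self, hn.E_zero, hn.G_zero, Hbar_eq, metricDisc_eq]
  ring

theorem fderiv_fderiv_lplDisc_perturb (hn : NullJet (planeJet x 0)) (p r : ℝ) (w : Plane) :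
    fderiv ℝ (fderiv ℝ (lplDisc (x.perturb (normalVec x) 0 0 p r))) 0 w w =
      fderiv ℝ (fderiv ℝ (lplDisc x)) 0 w w +
        8 * metricDisc x 0 ^ 2 * jetl (planeJet x 0) * r * w.1 * w.2 := by
  rw [lplDisc_eq, fderiv_fderiv_jet_perturb _ _ _ _ contDiff_jetL,
    fderiv_jetL_vertJet hn.jetH_eq, normalVec, mink_cross_self, hn.m_zero, hn.n_zero, lplDisc_eq,
    metricDisc_eq]
  ring

/-- The 2-jet at the origin is unchanged, so only the relation between the differentials has to be
checked. -/
theorem tangentLPL_perturb (hn : NullJet (planeJet x 0)) (hpos : 0 < metricDisc x 0)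
    {β κ p r mu : ℝ}
    (hL : fderiv ℝ (lplDisc (x.perturb (normalVec x) β κ p r)) 0 ≠ 0)
    (h1 : fderiv ℝ (Hbar (x.perturb (normalVec x) β κ p r)) 0 (1, 0) =
      mu * fderiv ℝ (lplDisc (x.perturb (normalVec x) β κ p r)) 0 (1, 0))
    (h2 : fderiv ℝ (Hbar (x.perturb (normalVec x) β κ p r)) 0 (0, 1) =
      mu * fderiv ℝ (lplDisc (x.perturb (normalVec x) β κ p r)) 0 (0, 1)) :
    TangentLPL (x.perturb (normalVec x) β κ p r) mu := by
  have e := planeJet_perturb_zero x (normalVec x) β κ p r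
  refine ⟨?_, ?_, hL, ?_, ContinuousLinearMap.ext fun v => ?_⟩
  · simp only [metricDisc_eq, e]
    simpa only [metricDisc_eq] using hpos
  · simp only [lplDisc_eq, e]; exact hn.jetL_eq
  · simp only [Hbar_eq, e]; exact hn.jetH_eq
  · rw [apply_plane, h1, h2, apply_plane (mu • _)]
    simp only [smul_apply]
    rfl

end LocalParam

theorem apply_ne_zero_of_ne_zero {T : Plane →L[ℝ] ℝ} (hT : T ≠ 0) (h : T (0, 1) = 0) :
    T (1, 0) ≠ 0 := by
  intro h1
  apply hT
  refine ContinuousLinearMap.ext fun v => ?_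
  rw [apply_plane, h, h1]; simp

namespace TangentLPL

variable {x : LocalParam} {lam : ℝ}

/-- Cubic perturbations make the MCNC regular. -/
theorem exists_near_ne_zero (ht : TangentLPL x lam) (hn : NullJet (planeJet x 0))
    {U : Set LocalParam} (hU : IsOpen U) (hxU : x ∈ U) : ∃ y ∈ U, ∃ mu : ℝ, mu ≠ 0 ∧
      TangentLPL y mu ∧ NullJet (planeJet y 0) := by
  by_cases hlam : lam ≠ 0
  · exact ⟨x, hxU, lam, hlam, ht, hn⟩
  push Not at hlam
  have dH : fderiv ℝ (Hbar x) 0 = 0 := by rw [ht.dH_eq, hlam, zero_smul]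
  have hF := hn.jetF_ne ht.pos
  have hδ := ht.pos.ne'
  obtain ⟨β, κ, hβ, hκ, hβ0, hκ0, hmu⟩ : ∃ β κ : ℝ → ℝ, Continuous β ∧ Continuous κ ∧ β 0 = 0 ∧
      κ 0 = 0 ∧ ∀ ε ≠ 0, ∃ mu : ℝ, mu ≠ 0 ∧
        TangentLPL (x.perturb (normalVec x) (β ε) (κ ε) 0 0) mu := by
    set Lu := fderiv ℝ (lplDisc x) 0 (1, 0) with hLu
    set Lv := fderiv ℝ (lplDisc x) 0 (0, 1) with hLv
    by_cases h0 : Lv = 0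
    · have hLu0 : Lu ≠ 0 := apply_ne_zero_of_ne_zero ht.dL_ne h0
      -- With `L_v = 0` the term `u²v` alone gives `dH = (-2 δ F ε, 0)`, parallel to the unchanged
      -- `dL = (L_u, 0)`.
      refine ⟨fun ε => ε, fun _ => 0, continuous_id, continuous_const, rfl, rfl, fun ε hε => ?_⟩
      refine ⟨-(2 * metricDisc x 0 * jetF (planeJet x 0) * ε) / Lu, ?_,
        LocalParam.tangentLPL_perturb hn ht.pos ?_ ?_ ?_⟩
      · exact div_ne_zero (neg_ne_zero.2 (by positivity)) hLu0
      · intro h1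
        have h2 := LocalParam.fderiv_lplDisc_perturb hn ε 0 0 0 (1, 0)
        rw [h1, ← hLu] at h2
        simp at h2
        exact hLu0 h2.symm
      · rw [LocalParam.fderiv_Hbar_perturb hn, LocalParam.fderiv_lplDisc_perturb hn, dH, ← hLu]
        simp
        field_simp
      · rw [LocalParam.fderiv_Hbar_perturb hn, LocalParam.fderiv_lplDisc_perturb hn, dH, ← hLv, h0]
        simp
    -- With `κ = ε` one has `dL = (L_u + 4 δ² l ε, L_v)` and `dH = -2 δ F (β, ε)`; this `β` makes
    -- them parallel.
    · refine ⟨fun ε => ε * (Lu + 4 * metricDisc x 0 ^ 2 * jetl (planeJet x 0) * ε) / Lv,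
        fun ε => ε, by fun_prop, continuous_id, by simp, rfl, fun ε hε => ?_⟩
      refine ⟨-(2 * metricDisc x 0 * jetF (planeJet x 0) * ε) / Lv, ?_,
        LocalParam.tangentLPL_perturb hn ht.pos ?_ ?_ ?_⟩
      · exact div_ne_zero (neg_ne_zero.2 (by positivity)) h0
      · intro h1
        have h2 := LocalParam.fderiv_lplDisc_perturb hn
          (ε * (Lu + 4 * metricDisc x 0 ^ 2 * jetl (planeJet x 0) * ε) / Lv) ε 0 0 (0, 1)
        rw [h1, ← hLv] at h2
        simp at h2
        exact h0 h2.symm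
      · rw [LocalParam.fderiv_Hbar_perturb hn, LocalParam.fderiv_lplDisc_perturb hn, dH, ← hLu]
        simp
        field_simp
      · rw [LocalParam.fderiv_Hbar_perturb hn, LocalParam.fderiv_lplDisc_perturb hn, dH, ← hLv]
        simp
        field_simp
  have hc := x.continuous_perturb (normalVec x) hβ hκ continuous_const continuous_const
    (p := fun _ => 0) (r := fun _ => 0)
  have h1 : ∀ᶠ ε in 𝓝 (0 : ℝ), x.perturb (normalVec x) (β ε) (κ ε) 0 0 ∈ U := by
    refine hc.continuousAt.eventually_mem (hU.mem_nhds ?_)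
    rwa [hβ0, hκ0, LocalParam.perturb_zero]
  obtain ⟨ε, hε, hε0⟩ := ((h1.filter_mono nhdsWithin_le_nhds).and
    (self_mem_nhdsWithin (a := (0 : ℝ)) (s := {0}ᶜ))).exists
  obtain ⟨mu, hmu0, hmu1⟩ := hmu ε hε0
  refine ⟨_, hε, mu, hmu0, hmu1, ?_⟩
  rwa [LocalParam.planeJet_perturb_zero]

/-- Quartic perturbations change the index of tangency at a constant rate. -/
theorem exists_affine_path (ht : TangentLPL x lam) (hlam : lam ≠ 0)
    (hn : NullJet (planeJet x 0)) : ∃ (y : ℝ → LocalParam) (C : ℝ), Continuous y ∧ y 0 = x ∧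
      C ≠ 0 ∧ (∀ ε, TangentLPL (y ε) lam) ∧
      ∀ ε, tangencyIndex (y ε) = tangencyIndex x + ε * C := by
  have hF := hn.jetF_ne ht.pos
  have hδ := ht.pos.ne'
  have hN := (gradSq_pos ht.dL_ne).ne'
  set w := kernelVec x with hw
  have hw0 : w ≠ 0 := kernelVec_ne_zero ht.dL_ne
  have dH : ∀ p r : ℝ, fderiv ℝ (Hbar (x.perturb (normalVec x) 0 0 p r)) 0 =
      fderiv ℝ (Hbar x) 0 := fun p r => ContinuousLinearMap.ext fun v => by
    rw [LocalParam.fderiv_Hbar_perturb hn]; ring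
  have dL : ∀ p r : ℝ, fderiv ℝ (lplDisc (x.perturb (normalVec x) 0 0 p r)) 0 =
      fderiv ℝ (lplDisc x) 0 := fun p r => ContinuousLinearMap.ext fun v => by
    rw [LocalParam.fderiv_lplDisc_perturb hn]; ring
  -- Quartic terms leave `dH`, `dL` and the kernel vector unchanged; only the two Hessians vary, and
  -- they do so linearly.
  have hind : ∀ p r : ℝ, tangencyIndex (x.perturb (normalVec x) 0 0 p r) = tangencyIndex x +
      gradProd x * (gradSq x * (-(2 * metricDisc x 0 * jetF (planeJet x 0) *
        (p * w.1 ^ 2 + r * w.2 ^ 2))) -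
        gradProd x * (8 * metricDisc x 0 ^ 2 * jetl (planeJet x 0) * r * w.1 * w.2)) := by
    intro p r
    have e1 : gradProd (x.perturb (normalVec x) 0 0 p r) = gradProd x := by
      simp only [gradProd, dH, dL]
    have e2 : gradSq (x.perturb (normalVec x) 0 0 p r) = gradSq x := by
      simp only [gradSq, dL]
    have e3 : kernelVec (x.perturb (normalVec x) 0 0 p r) = w := by
      rw [hw]; simp only [kernelVec, dL]
    rw [tangencyIndex, tangencyIndex, e1, e2, e3, LocalParam.fderiv_fderiv_Hbar_perturb hn,
      LocalParam.fderiv_fderiv_lplDisc_perturb hn]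
    ring
  have htan : ∀ p r : ℝ, TangentLPL (x.perturb (normalVec x) 0 0 p r) lam := by
    intro p r
    refine LocalParam.tangentLPL_perturb hn ht.pos ?_ ?_ ?_
    · rw [dL]; exact ht.dL_ne
    · rw [dH, dL, ht.dH_eq]; rfl
    · rw [dH, dL, ht.dH_eq]; rfl
  have hip : gradProd x ≠ 0 := by
    rw [ht.gradProd_eq]; exact mul_ne_zero hlam hN
  -- The coefficient `r` also changes the Hessian of `L`, through `w.1 * w.2`, so it is used only
  -- when `w.1 = 0`; otherwise `p` suffices.
  by_cases h1 : w.1 = 0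
  · have h2 : w.2 ≠ 0 := fun h2 => hw0 (Prod.ext h1 h2)
    refine ⟨fun ε => x.perturb (normalVec x) 0 0 0 ε,
      gradProd x * (gradSq x * (-(2 * metricDisc x 0 * jetF (planeJet x 0) * w.2 ^ 2))),
      x.continuous_perturb _ continuous_const continuous_const continuous_const continuous_id,
      x.perturb_zero _, ?_, fun ε => htan _ _, fun ε => ?_⟩
    · exact mul_ne_zero hip (mul_ne_zero hN (neg_ne_zero.2 (by positivity)))
    · rw [hind, h1]; ring
  · refine ⟨fun ε => x.perturb (normalVec x) 0 0 ε 0,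
      gradProd x * (gradSq x * (-(2 * metricDisc x 0 * jetF (planeJet x 0) * w.1 ^ 2))),
      x.continuous_perturb _ continuous_const continuous_const continuous_id continuous_const,
      x.perturb_zero _, ?_, fun ε => htan _ _, fun ε => ?_⟩
    · exact mul_ne_zero hip (mul_ne_zero hN (neg_ne_zero.2 (by positivity)))
    · rw [hind]; ring

end TangentLPL

/-! ### Density of the generic germs. -/

theorem continuous_quotient_mk : Continuous (Quotient.mk paramSetoid : LocalParam → SurfaceGerm) :=
  continuous_quotient_mk'

/-- Choose null parameters, make `lam` nonzero by a small cubic perturbation, then leave the zero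
set of the index by a small quartic one. Tangency is kept throughout, so the germs stay in `G1`. -/
theorem dense_generic :
    Dense {g : G1 | ∃ c : Configuration, StaticPart c g ∧ FamilyPart c g} := by
  rintro ⟨g, hg⟩
  rw [mem_closure_iff]
  rintro _ ⟨U, hU, rfl⟩ hgU
  obtain ⟨x₀, hx₀⟩ := exists_parametrizes g
  obtain ⟨lam₀, ht₀⟩ := (mem_G1_iff hx₀).1 hg
  obtain ⟨x, lam, hx, ht, hn⟩ := ht₀.exists_null_parametrization hx₀
  have hO := hU.preimage continuous_quotient_mk
  obtain ⟨y, hyU, mu, hmu, hty, hny⟩ := ht.exists_near_ne_zero hn hO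
    (show Quotient.mk paramSetoid x ∈ U by rw [show Quotient.mk paramSetoid x = g from hx]; exact hgU)
  obtain ⟨z, C, hz, hz0, hC, htz, hind⟩ := hty.exists_affine_path hmu hny
  have h1 : ∀ᶠ ε in 𝓝 (0 : ℝ), z ε ∈ Quotient.mk paramSetoid ⁻¹' U := by
    refine hz.continuousAt.eventually_mem (hO.mem_nhds ?_)
    rwa [hz0]
  have h2 : ∀ᶠ ε in 𝓝[≠] (0 : ℝ), tangencyIndex (z ε) ≠ 0 := by
    by_cases h0 : tangencyIndex y = 0
    · filter_upwards [self_mem_nhdsWithin] with ε hε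
      rw [hind, h0, zero_add]
      exact mul_ne_zero hε hC
    · have hc : ContinuousAt (fun ε => tangencyIndex (z ε)) 0 :=
        (continuous_tangencyIndex.comp hz).continuousAt
      exact (hc.eventually_ne (y := 0) (by rwa [hz0])).filter_mono nhdsWithin_le_nhds
  obtain ⟨ε, hε1, hε2⟩ := ((h1.filter_mono nhdsWithin_le_nhds).and h2).exists
  have hp : Parametrizes (z ε) (Quotient.mk paramSetoid (z ε)) := rfl
  exact ⟨⟨_, (mem_G1_iff hp).2 ⟨mu, htz ε⟩⟩, hε1, (generic_iff hp (htz ε)).2 hε2⟩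

/-! An element of `G1`. -/

/-- `u²/2 + v³/6`. -/
noncomputable def modelHeight (q : Plane) : ℝ := q.1 ^ 2 / 2 + q.2 ^ 3 / 6

/-- `(u, v) ↦ (u + v, u²/2 + v³/6, u - v)`. -/
noncomputable def modelMap (q : Plane) : Space :=
  (q.1 • ![1, 0, 1] + q.2 • ![1, 0, -1]) + modelHeight q • ![0, 1, 0]

theorem contDiff_modelHeight : ContDiff ℝ ∞ modelHeight := by
  unfold modelHeight; fun_prop

theorem contDiff_modelMap : ContDiff ℝ ∞ modelMap := by
  unfold modelMap modelHeight; fun_prop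

theorem planeJet_modelMap (q : Plane) : planeJet modelMap q =
    (![1, q.1, 1], ![1, q.2 ^ 2 / 2, -1], ![0, 1, 0], 0, ![0, q.2, 0]) := by
  have hd : ∀ q, DifferentiableAt ℝ modelHeight q := fun q =>
    contDiff_modelHeight.differentiable (by simp) q
  have h1 : planeJet (fun q => modelHeight q • (![0, 1, 0] : Space)) q =
      (q.1 • ![0, 1, 0], (q.2 ^ 2 / 2) • ![0, 1, 0], (1 : ℝ) • ![0, 1, 0], (0 : ℝ) • ![0, 1, 0],
        q.2 • ![0, 1, 0]) := by
    refine jetOf_smul_const (φa := fun q : Plane => q.1) (φb := fun q : Plane => q.2 ^ 2 / 2)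
      (φaa := fun _ => 1) (φab := fun _ => 0) (φbb := fun q : Plane => q.2)
      contDiff_modelHeight (fun q => ?_) (fun q => ?_) (fun q => ?_) (fun q => ?_)
      (fun q => ?_) _ q
    · refine fderiv_eq_of_line (a := modelHeight q) (c := 1 / 2) (d := 0) (k := 0) (hd q)
        fun s => ?_
      simp [modelHeight]; ring
    · refine fderiv_eq_of_line (a := modelHeight q) (c := q.2 / 2) (d := 1 / 6) (k := 0) (hd q)
        fun s => ?_
      simp [modelHeight]; ring
    · refine fderiv_eq_of_line (a := q.1) (c := 0) (d := 0) (k := 0) (by fun_prop) fun s => ?_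
      simp
    · refine fderiv_eq_of_line (a := q.1) (c := 0) (d := 0) (k := 0) (by fun_prop) fun s => ?_
      simp
    · refine fderiv_eq_of_line (a := q.2 ^ 2 / 2) (c := 1 / 2) (d := 0) (k := 0) (by fun_prop)
        fun s => ?_
      simp; ring
  let T : Plane →L[ℝ] Space :=
    (ContinuousLinearMap.fst ℝ ℝ ℝ).smulRight ![1, 0, 1] +
      (ContinuousLinearMap.snd ℝ ℝ ℝ).smulRight ![1, 0, -1]
  have h2 : planeJet T q = (![1, 0, 1], ![1, 0, -1], 0, 0, 0) := by
    unfold planeJet jetOf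
    simp only [ContinuousLinearMap.fderiv]
    simp [T]
  have h3 := jetOf_add (1, 0) (0, 1) (smoothNear_of_contDiff T.contDiff q)
    (smoothNear_of_contDiff (contDiff_modelHeight.smul (contDiff_const (c := ![0, 1, 0]))) q)
  change planeJet (fun z => T z + modelHeight z • ![0, 1, 0]) q = planeJet T q +
    planeJet (fun q => modelHeight q • (![0, 1, 0] : Space)) q at h3
  rw [h1, h2] at h3
  refine Eq.trans h3 ?_
  simp

theorem Hbar_modelMap (q : Plane) : Hbar modelMap q = q.2 ^ 4 / 2 + 2 * q.2 * q.1 ^ 2 := by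
  rw [Hbar_eq]
  simp only [planeJet_modelMap, jetH, jetl, jetm, jetn, jetE, jetF, jetG, mink_cross]
  simp [mink]
  ring

theorem lplDisc_modelMap (q : Plane) : lplDisc modelMap q =
    (2 * q.1 ^ 2 * q.2 - q.2 ^ 4 / 2) ^ 2 + 16 * (2 + q.1 * q.2 ^ 2 / 2) ^ 2 * q.2 := by
  rw [lplDisc_eq]
  simp only [planeJet_modelMap, jetL, jetl, jetm, jetn, jetE, jetF, jetG, mink_cross]
  simp [mink]
  ring

/-- The model surface. -/
noncomputable def modelParam : LocalParam where
  toFun := modelMap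
  smooth := smoothNear_of_contDiff contDiff_modelMap 0
  immersion := by
    have h := planeJet_modelMap 0
    have h1 : fderiv ℝ modelMap 0 (1, 0) = ![1, 0, 1] := congrArg Prod.fst h
    have h2 : fderiv ℝ modelMap 0 (0, 1) = ![1, (0 : ℝ) ^ 2 / 2, -1] :=
      congrArg (fun j : Jet => j.2.1) h
    rw [injective_iff_map_eq_zero]
    intro v hv
    rw [apply_plane, h1, h2] at hv
    have e0 := congrFun hv 0
    have e2 := congrFun hv 2
    simp at e0 e2
    exact Prod.ext (by simp; linarith) (by simp; linarith)

/-- `H` has no linear part on the model, hence `lam = 0`, and the linear part of `L` is `64 v`. The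
model is itself degenerate; it only serves as a point of `G1` to be perturbed. -/
theorem tangentLPL_modelParam : TangentLPL modelParam 0 := by
  have hd : DifferentiableAt ℝ (lplDisc modelMap) 0 :=
    (smoothNear_lplDisc modelParam.smooth).differentiableAt
  refine ⟨?_, ?_, fun h => ?_, ?_, ?_⟩
  · change 0 < metricDisc modelMap 0
    rw [metricDisc_eq]
    simp only [planeJet_modelMap, jetDisc, jetE, jetF, jetG]
    simp [mink]
  · change lplDisc modelMap 0 = 0
    rw [lplDisc_modelMap]; simp
  · have h1 : fderiv ℝ (lplDisc modelMap) 0 (0, 1) = 64 := by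
      rw [fderiv_eq_deriv_line hd]
      simp only [lplDisc_modelMap]
      have h2 : HasDerivAt (fun s : ℝ => s ^ 8 / 4 + 64 * s)
          (((8 : ℕ) * (0 : ℝ) ^ (8 - 1)) / 4 + 64 * 1) 0 :=
        ((hasDerivAt_pow 8 (0 : ℝ)).div_const 4).add ((hasDerivAt_id (0 : ℝ)).const_mul 64)
      rw [show (64 : ℝ) = ((8 : ℕ) * (0 : ℝ) ^ (8 - 1)) / 4 + 64 * 1 by norm_num, ← h2.deriv]
      congr 1
      funext s
      simp
      ring
    rw [show fderiv ℝ (lplDisc modelMap) 0 = 0 from h] at h1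
    norm_num at h1
  · change Hbar modelMap 0 = 0
    rw [Hbar_modelMap]; simp
  · rw [zero_smul]
    refine ContinuousLinearMap.ext fun v => ?_
    refine fderiv_eq_of_line (a := 0) (b := 0) (c := 0) (d := 2 * v.2 * v.1 ^ 2)
      (k := v.2 ^ 4 / 2) (smoothNear_Hbar modelParam.smooth).differentiableAt fun s => ?_
    change Hbar modelMap _ = _
    rw [Hbar_modelMap]
    simp
    ring

theorem nullJet_modelParam : NullJet (planeJet modelParam 0) := by
  change NullJet (planeJet modelMap 0)
  rw [planeJet_modelMap]
  constructor <;> simp [jetE, jetG, jetm, jetn, mink]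

theorem exists_configuration (c : Configuration) :
    ∃ g ∈ G1, StaticPart c g ∧ FamilyPart c g := by
  obtain ⟨y, -, mu, hmu, hty, hny⟩ := tangentLPL_modelParam.exists_near_ne_zero
    nullJet_modelParam isOpen_univ (Set.mem_univ _)
  obtain ⟨z, C, -, -, hC, htz, hind⟩ := hty.exists_affine_path hmu hny
  -- The index is affine and nonconstant along the path; this parameter gives it the value
  -- `-c.sign`, so no index needs to be computed.
  have h1 : c.sign * tangencyIndex (z ((-tangencyIndex y - c.sign) / C)) < 0 := by
    rw [hind, div_mul_cancel₀ _ hC]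
    cases c <;> simp only [Configuration.sign] <;> linarith
  have hp : Parametrizes (z ((-tangencyIndex y - c.sign) / C)) _ := rfl
  have hnd := (htz _).nondegenerateLPL (LocalParam.smooth _) h1
  exact ⟨_, (mem_G1_iff hp).2 ⟨mu, htz _⟩, hnd.staticPart hp, hnd.familyPart hp⟩

end MinkowskiSurface

theorem mainTheorem4 :
    IsGenericIn G1 (fun g => ∃ c : Configuration, StaticPart c g ∧ FamilyPart c g) ∧
      ∀ c : Configuration, ∃ g ∈ G1, StaticPart c g ∧ FamilyPart c g :=
  ⟨⟨isOpen_generic, dense_generic⟩, exists_configuration⟩
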